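/- Let $n\ge 1$, $\kappa\in[0,\infty)$, $c_t\in\mathbb R$ and $K_{W_t}>0$ for $t=1,\dots,n$. Consider the additive Gaussian noise channel with feedback $$Y_t=X_t+V_t,\qquad V_t=c_tV_{t-1}+W_t,\qquad V_0=v_0,\qquad t=1,\dots,n,$$ where the $W_t\sim N(0,K_{W_t})$ are independent and $v_0\in\mathbb R$ is known to encoder and decoder. Write $X^t=(X_1,\dots,X_t)$, etc., and let $\mathbf P_{v_0},\mathbf E_{v_0}$ refer to $V_0=v_0$. A strategy is a family of conditional distributions $\mathbf P_{X_t|X^{t-1},Y^{t-1},V_0}$, $t=1,\dots,n$; given $(X^{t-1},Y^{t-1})$ the input $X_t$ is drawn from it, and $W_t$ is independent of $(X^t,Y^{t-1})$. A strategy is admissible if $\frac1n\mathbf E_{v_0}\sum_{t=1}^nX_t^2\le\kappa$. Let $H$ denote differential entropy (natural logarithm). The $n$-finite transmission feedback information capacity is $$C_n(\kappa,v_0)=\sup\big\{H(Y^n|v_0)-H(V^n|v_0)\big\},$$ the supremum being over the admissible strategies that are conditionally Gaussian with $(X^n,Y^n)$ jointly Gaussian given $V_0=v_0$. For real $\Lambda_t$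 and $K_{Z_t}\ge0$, $t=1,\dots,n$, define $K_0=0$ and, for $t=1,\dots,n$, $$S_t=K_{Z_t}+K_{W_t}+(\Lambda_t+c_t)^2K_{t-1},\qquad M_t=\frac{K_{W_t}+c_tK_{t-1}(\Lambda_t+c_t)}{S_t},\qquad F_t=c_t-M_t(\Lambda_t+c_t),$$ $$K_t=c_t^2K_{t-1}+K_{W_t}-\frac{\big(K_{W_t}+c_tK_{t-1}(\Lambda_t+c_t)\big)^2}{S_t}\qquad\text{(generalized difference Riccati equation).}$$ Call $(\Lambda_t,K_{Z_t})_{t\le n}$ feasible if $K_{Z_t}\ge 0$ and $\frac1n\sum_{t=1}^n\{\Lambda_t^2K_{t-1}+K_{Z_t}\}\le\kappa$. Then the following hold. (0) For every admissible strategy (Gaussian or not), $Y^n$ and $V^n$ have densities given $V_0=v_0$ and their differential entropies are convergent integrals. (a) For all real $\Lambda_t$ and all $K_{Z_t}\ge0$ one has $K_t\ge0$, and for every $v_0$ there is a process with $$X_t=\Lambda_t\big(V_{t-1}-\widehat V_{t-1}\big)+Z_t,\quad t=1,\dots,n,\qquad \widehat V_t=\mathbf E_{v_0}\{V_t|Y^t\},$$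 where $Z_t\sim N(0,K_{Z_t})$ and $W_t$, $t=1,\dots,n$, are all mutually independent. Every such process has the following properties (equalities between random variables being almost sure). * It is induced by one and the same strategy, which is conditionally Gaussian with $(X^n,Y^n)$ jointly Gaussian, depends on the past only through $(V_{t-1},Y^{t-1},V_0)$, that is $\mathbf P_{X_t|X^{t-1},Y^{t-1},V_0}=\mathbf P_{X_t|V_{t-1},Y^{t-1},V_0}$, and satisfies $$H(Y^n|v_0)-H(V^n|v_0)=\frac12\sum_{t=1}^n\log\frac{(\Lambda_t+c_t)^2K_{t-1}+K_{Z_t}+K_{W_t}}{K_{W_t}}.$$ * $Z_t$ is independent of $(V^{t-1},X^{t-1},Y^{t-1})$, and $Z^n$ is independent of $V^n$. * $X_1=Z_1$ and $Y_1=Z_1+c_1v_0+W_1$. For $t\ge2$, with $\widehat X_t=\mathbf E_{v_0}\{X_t|Y^t\}$ and $\overline\Lambda_t=-\Lambda_t$, $X_t=\overline\Lambda_t(X_{t-1}-\widehat X_{t-1})+Z_t$ and $Y_t=\overline\Lambda_t(X_{t-1}-\widehat X_{t-1})+c_t(Y_{t-1}-X_{t-1})+W_t+Z_t$. For all $t$,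 $Y_t=\Lambda_t(V_{t-1}-\widehat V_{t-1})+c_tV_{t-1}+W_t+Z_t$. * All $X_t,V_t$ are square integrable, $\frac1n\mathbf E_{v_0}\sum_{t=1}^nX_t^2=\frac1n\sum_{t=1}^n\{\Lambda_t^2K_{t-1}+K_{Z_t}\}$, and $K_t=\mathbf E_{v_0}(V_t-\widehat V_t)^2=\mathbf E_{v_0}(X_t-\widehat X_t)^2$ for $t=1,\dots,n$. * The innovations $I_t=Y_t-\mathbf E_{v_0}\{Y_t|Y^{t-1}\}$ satisfy $I_t=Y_t-c_t\widehat V_{t-1}=(\Lambda_t+c_t)(V_{t-1}-\widehat V_{t-1})+Z_t+W_t$ and $I_1=Z_1+W_1$. They are orthogonal, and $I_t\sim N(0,S_t)$. * (Generalized Kalman filter) $\widehat V_0=v_0$ and $\widehat V_t=c_t\widehat V_{t-1}+M_tI_t=F_t\widehat V_{t-1}+M_t\big(Y_t+\Lambda_t\widehat V_{t-1}\big)$. The error $E_t=V_t-\widehat V_t$ satisfies $E_t=F_tE_{t-1}-M_t(Z_t+W_t)+W_t$. There is a feasible $(\Lambda_t,K_{Z_t})_{t\le n}$, not depending on $v_0$,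 whose induced strategy is for every $v_0$ admissible and optimal: its pay-off $H(Y^n|v_0)-H(V^n|v_0)$ is the maximum over all admissible strategies, Gaussian or not, and in particular equals $C_n(\kappa,v_0)$. (b) For every $v_0$, $$C_n(\kappa,v_0)=\sup\ \frac12\sum_{t=1}^n\log\frac{(\Lambda_t+c_t)^2K_{t-1}+K_{Z_t}+K_{W_t}}{K_{W_t}},$$ where the supremum is over all feasible $(\Lambda_t,K_{Z_t})_{t\le n}$ and is attained. -/

import Mathlib

open MeasureTheory ProbabilityTheory

noncomputable section

namespace AGN

/-! Additive Gaussian noise channel `Y_t = X_t + V_t`, `t = 1, …, n`, with feedback and with the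
autoregressive noise `V_t = c_t V_{t-1} + W_t`, `W_t ∼ N(0, K_{W_t})` independent, `V_0 = v₀` known.
Coefficient sequences are indexed by time: `c t`, `KW t`, `Λ t`, `KZ t` with `1 ≤ t ≤ n`. -/

/-- Histories `(x^t, y^t)` of inputs and outputs up to time `t`; the entries with index `i : Fin t`
are those of time `i + 1`. -/
abbrev Hist (t : ℕ) : Type := (Fin t → ℝ) × (Fin t → ℝ)

/-- The noise sample at time `t`, as a function of the history: `v_t = y_t - x_t`, `v_0 = v₀`. -/
def noiseAt (v₀ : ℝ) : {t : ℕ} → Hist t → ℝ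
  | 0, _ => v₀
  | t + 1, h => h.2 (Fin.last t) - h.1 (Fin.last t)

/-- A time-varying randomized channel input strategy with feedback: `kernel t` is the conditional
distribution of `X_{t+1}` given `(V_0, (X^t, Y^t))`. -/
structure Strategy where
  kernel : (t : ℕ) → Kernel (ℝ × Hist t) ℝ
  markov : ∀ t, IsMarkovKernel (kernel t)

/-- The joint law of `(X^t, Y^t)` given `V_0 = v₀`, under the strategy `P`. At time `t + 1` the input
is drawn from `P` given the past, `W_{t+1}` is drawn independently of everything else, and
`Y_{t+1} = X_{t+1} + (c_{t+1} V_t + W_{t+1})`. -/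
def jointLaw (c KW : ℕ → ℝ) (P : Strategy) (v₀ : ℝ) : (t : ℕ) → Measure (Hist t)
  | 0 => Measure.dirac (Fin.elim0, Fin.elim0)
  | t + 1 =>
    (((jointLaw c KW P v₀ t).compProd ((P.kernel t).sectR v₀)).prod
        (gaussianReal 0 (KW (t + 1)).toNNReal)).map
      (fun q : (Hist t × ℝ) × ℝ =>
        (Fin.snoc (α := fun _ => ℝ) q.1.1.1 q.1.2,
         Fin.snoc (α := fun _ => ℝ) q.1.1.2
          (q.1.2 + (c (t + 1) * noiseAt v₀ q.1.1 + q.2))))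

/-- The law of `Y^n` given `V_0 = v₀`. -/
def outputLaw (c KW : ℕ → ℝ) (P : Strategy) (v₀ : ℝ) (n : ℕ) : Measure (Fin n → ℝ) :=
  (jointLaw c KW P v₀ n).map (fun h => h.2)

/-- The law of `V^n = Y^n - X^n` given `V_0 = v₀`. -/
def noiseLaw (c KW : ℕ → ℝ) (P : Strategy) (v₀ : ℝ) (n : ℕ) : Measure (Fin n → ℝ) :=
  (jointLaw c KW P v₀ n).map (fun h => h.2 - h.1)

/-- Differential entropy `-∫ f log f` (natural logarithm) of a law on `ℝⁿ` with density `f`. -/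
def differentialEntropy {n : ℕ} (μ : Measure (Fin n → ℝ)) : ℝ :=
  ∫ x, Real.negMulLog (μ.rnDeriv volume x).toReal

/-- The law has a density and its differential entropy is a convergent integral. -/
def HasFiniteEntropy {n : ℕ} (μ : Measure (Fin n → ℝ)) : Prop :=
  μ ≪ volume ∧ Integrable (fun x => Real.negMulLog (μ.rnDeriv volume x).toReal) volume

/-- The pay-off `H(Y^n | v₀) - H(V^n | v₀)`. -/
def payoff (c KW : ℕ → ℝ) (P : Strategy) (v₀ : ℝ) (n : ℕ) : ℝ :=
  differentialEntropy (outputLaw c KW P v₀ n) - differentialEntropy (noiseLaw c KW P v₀ n)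

/-- The average power constraint `(1/n) E_{v₀} ∑ X_t² ≤ κ`. -/
def PowerAdmissible (c KW : ℕ → ℝ) (P : Strategy) (v₀ : ℝ) (n : ℕ) (κ : ℝ) : Prop :=
  (∀ i : Fin n, Integrable (fun h : Hist n => h.1 i ^ 2) (jointLaw c KW P v₀ n)) ∧
  (1 / (n : ℝ)) * ∑ i : Fin n, ∫ h, h.1 i ^ 2 ∂(jointLaw c KW P v₀ n) ≤ κ

/-- The strategy is conditionally Gaussian, with `(X^n, Y^n)` jointly Gaussian given `V_0 = v₀`. -/
def GaussianStrategy (c KW : ℕ → ℝ) (P : Strategy) (v₀ : ℝ) (n : ℕ) : Prop :=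
  (∀ t < n, ∀ᵐ h ∂(jointLaw c KW P v₀ t), IsGaussian (P.kernel t (v₀, h))) ∧
  IsGaussian (jointLaw c KW P v₀ n)

/-- The pay-offs of the power-admissible Gaussian strategies. -/
def gaussianPayoffs (c KW : ℕ → ℝ) (n : ℕ) (κ v₀ : ℝ) : Set ℝ :=
  {r | ∃ P : Strategy, PowerAdmissible c KW P v₀ n κ ∧ GaussianStrategy c KW P v₀ n ∧
    r = payoff c KW P v₀ n}

/-- The pay-offs of all power-admissible strategies, Gaussian or not. -/
def allPayoffs (c KW : ℕ → ℝ) (n : ℕ) (κ v₀ : ℝ) : Set ℝ :=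
  {r | ∃ P : Strategy, PowerAdmissible c KW P v₀ n κ ∧ r = payoff c KW P v₀ n}

/-- The `n`-finite transmission feedback information capacity `C_n(κ, v₀)`. -/
def ftfiCapacity (c KW : ℕ → ℝ) (n : ℕ) (κ v₀ : ℝ) : ℝ :=
  sSup (gaussianPayoffs c KW n κ v₀)

/-- The strategy depends on the past only through `(V_{t-1}, Y^{t-1}, V_0)`. -/
def DependsOnNoiseAndOutputs (P : Strategy) : Prop :=
  ∀ t, ∃ Q : Kernel (ℝ × ℝ × (Fin t → ℝ)) ℝ,
    ∀ (v₀ : ℝ) (h : Hist t), P.kernel t (v₀, h) = Q (v₀, noiseAt v₀ h, h.2)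

/-- Innovations variance `K_Z + K_W + (Λ + c)² K`. -/
def innovVar (c KW K Λ KZ : ℝ) : ℝ := KZ + KW + (Λ + c) ^ 2 * K

/-- The gain `M_t(K, Λ, K_Z)`. -/
def gainM (c KW K Λ KZ : ℝ) : ℝ := (KW + c * K * (Λ + c)) * (innovVar c KW K Λ KZ)⁻¹

/-- The coefficient `F_t(K, Λ, K_Z)`. -/
def coeffF (c KW K Λ KZ : ℝ) : ℝ := c - gainM c KW K Λ KZ * (Λ + c)

/-- The generalized difference Riccati equation, with `K_0 = 0`. -/
def riccati (c KW Λ KZ : ℕ → ℝ) : ℕ → ℝ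
  | 0 => 0
  | t + 1 =>
    c (t + 1) ^ 2 * riccati c KW Λ KZ t + KW (t + 1)
      - (KW (t + 1) + c (t + 1) * riccati c KW Λ KZ t * (Λ (t + 1) + c (t + 1))) ^ 2
        / (KZ (t + 1) + KW (t + 1) + (Λ (t + 1) + c (t + 1)) ^ 2 * riccati c KW Λ KZ t)

/-- The gain `M_t` along the Riccati recursion, `t ≥ 1`. -/
def gain (c KW Λ KZ : ℕ → ℝ) (t : ℕ) : ℝ :=
  gainM (c t) (KW t) (riccati c KW Λ KZ (t - 1)) (Λ t) (KZ t)

/-- The generalized Kalman filter as a function of the outputs: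
`v̂_t = c_t v̂_{t-1} + M_t (y_t - c_t v̂_{t-1})`, `v̂_0 = v₀`. -/
def filter (c KW Λ KZ : ℕ → ℝ) (v₀ : ℝ) : (t : ℕ) → (Fin t → ℝ) → ℝ
  | 0, _ => v₀
  | t + 1, y =>
    c (t + 1) * filter c KW Λ KZ v₀ t (fun i => y i.castSucc)
      + gain c KW Λ KZ (t + 1)
        * (y (Fin.last t) - c (t + 1) * filter c KW Λ KZ v₀ t (fun i => y i.castSucc))

theorem measurable_noiseAt (t : ℕ) :
    Measurable (fun p : ℝ × Hist t => noiseAt p.1 p.2) := by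
  cases t with
  | zero => exact measurable_fst
  | succ t =>
    simp only [noiseAt]
    fun_prop

theorem measurable_filter (c KW Λ KZ : ℕ → ℝ) (t : ℕ) :
    Measurable (fun p : ℝ × (Fin t → ℝ) => filter c KW Λ KZ p.1 t p.2) := by
  induction t with
  | zero => exact measurable_fst
  | succ t ih =>
    have h : Measurable (fun p : ℝ × (Fin (t + 1) → ℝ) =>
        filter c KW Λ KZ p.1 t (fun i => p.2 i.castSucc)) :=
      ih.comp (f := fun p : ℝ × (Fin (t + 1) → ℝ) => (p.1, fun i : Fin t => p.2 i.castSucc))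
        (by fun_prop)
    simp only [filter]
    fun_prop

/-- The conditional law `X_{t+1} ∼ N(Λ_{t+1} (v_t - v̂_t), K_{Z_{t+1}})` given the past. -/
def filterKernel (c KW Λ KZ : ℕ → ℝ) (t : ℕ) : Kernel (ℝ × Hist t) ℝ where
  toFun := fun p => gaussianReal
    (Λ (t + 1) * (noiseAt p.1 p.2 - filter c KW Λ KZ p.1 t p.2.2)) (KZ (t + 1)).toNNReal
  measurable' := by
    have h1 := measurable_noiseAt t
    have h2 : Measurable (fun p : ℝ × Hist t => filter c KW Λ KZ p.1 t p.2.2) :=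
      (measurable_filter c KW Λ KZ t).comp
        (f := fun p : ℝ × Hist t => (p.1, p.2.2)) (by fun_prop)
    exact measurable_gaussianReal.comp
      (((h1.sub h2).const_mul (Λ (t + 1))).prodMk measurable_const)

theorem filterKernel_apply (c KW Λ KZ : ℕ → ℝ) (t : ℕ) (p : ℝ × Hist t) :
    filterKernel c KW Λ KZ t p = gaussianReal
      (Λ (t + 1) * (noiseAt p.1 p.2 - filter c KW Λ KZ p.1 t p.2.2)) (KZ (t + 1)).toNNReal := rfl

/-- The strategy with `X_t ∼ N(Λ_t (v_{t-1} - v̂_{t-1}), K_{Z_t})` given the past. -/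
def filterStrategy (c KW Λ KZ : ℕ → ℝ) : Strategy where
  kernel := filterKernel c KW Λ KZ
  markov t := ⟨fun p => by rw [filterKernel_apply]; infer_instance⟩

/-- Constraints on `(Λ_t, K_{Z_t})`: `K_{Z_t} ≥ 0`, `(1/n) ∑ (Λ_t² K_{t-1} + K_{Z_t}) ≤ κ`. -/
def ParamFeasible (c KW : ℕ → ℝ) (n : ℕ) (κ : ℝ) (Λ KZ : ℕ → ℝ) : Prop :=
  (∀ t < n, 0 ≤ KZ (t + 1)) ∧
  (1 / (n : ℝ)) * ∑ t ∈ Finset.range n,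
    (Λ (t + 1) ^ 2 * riccati c KW Λ KZ t + KZ (t + 1)) ≤ κ

/-- `½ ∑ log (((Λ_t + c_t)² K_{t-1} + K_{Z_t} + K_{W_t}) / K_{W_t})`. -/
def paramRate (c KW : ℕ → ℝ) (n : ℕ) (Λ KZ : ℕ → ℝ) : ℝ :=
  (1 / 2) * ∑ t ∈ Finset.range n,
    Real.log (((Λ (t + 1) + c (t + 1)) ^ 2 * riccati c KW Λ KZ t + KZ (t + 1) + KW (t + 1))
      / KW (t + 1))

/-- The rates of the feasible parameters. -/
def paramRates (c KW : ℕ → ℝ) (n : ℕ) (κ : ℝ) : Set ℝ :=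
  {r | ∃ Λ KZ : ℕ → ℝ, ParamFeasible c KW n κ Λ KZ ∧ r = paramRate c KW n Λ KZ}

/-- The σ-algebra generated by `Y_1, …, Y_t`. -/
abbrev outputSigma {Ω : Type*} (Y : ℕ → Ω → ℝ) (t : ℕ) : MeasurableSpace Ω :=
  MeasurableSpace.comap (fun ω (i : Fin t) => Y (i + 1) ω) inferInstance

/-- Conditional mean `E[U | Y^t]`. -/
def estimate {Ω : Type*} {mΩ : MeasurableSpace Ω} (μ : Measure Ω) (Y : ℕ → Ω → ℝ) (t : ℕ)
    (U : Ω → ℝ) : Ω → ℝ :=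
  condExp (outputSigma Y t) μ U

/-- The process driven by independent Gaussian `W_t ∼ N(0, K_{W_t})`, `Z_t ∼ N(0, K_{Z_t})`, with
`V_t = c_t V_{t-1} + W_t`, `V_0 = v₀`, `X_t = Λ_t (V_{t-1} - E[V_{t-1} | Y^{t-1}]) + Z_t` and
`Y_t = X_t + V_t`, for `1 ≤ t ≤ n`. -/
structure InnovationsProcess {Ω : Type*} {mΩ : MeasurableSpace Ω} (μ : Measure Ω) (n : ℕ)
    (c KW Λ KZ : ℕ → ℝ) (v₀ : ℝ) (W Z V X Y : ℕ → Ω → ℝ) : Prop where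
  measurable_X : ∀ t < n, Measurable (X (t + 1))
  measurable_W : ∀ t < n, Measurable (W (t + 1))
  measurable_Z : ∀ t < n, Measurable (Z (t + 1))
  law_W : ∀ t < n, μ.map (W (t + 1)) = gaussianReal 0 (KW (t + 1)).toNNReal
  law_Z : ∀ t < n, μ.map (Z (t + 1)) = gaussianReal 0 (KZ (t + 1)).toNNReal
  indep : iIndepFun (fun (j : Fin n ⊕ Fin n) =>
    Sum.elim (fun i : Fin n => W (i + 1)) (fun i : Fin n => Z (i + 1)) j) μ
  noise_zero : V 0 = fun _ => v₀
  noise_succ : ∀ t < n, V (t + 1) = fun ω => c (t + 1) * V t ω + W (t + 1) ω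
  input : ∀ t < n, X (t + 1) =ᵐ[μ]
    fun ω => Λ (t + 1) * (V t ω - estimate μ Y t (V t) ω) + Z (t + 1) ω
  output : ∀ t < n, Y (t + 1) = fun ω => X (t + 1) ω + V (t + 1) ω

end AGN

end

/-!
The theorem combines a converse, an achievability statement, and the attainment of a maximum. The
converse bounds the pay-off of an arbitrary strategy through second moments only.

Converse (`exists_paramRate_ge`). Let a strategy with square integrable inputs be given. In `L²`,
let `E_t` be the residual of `V_t`, and `U_t` that of `X_{t+1}`, after projection on the span of
`1` and the outputs up to time `t`. With the regression coefficient `Λ_{t+1}` of `U_t` on `E_t`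
and the residual variance `K_{Z_{t+1}}`, orthogonality of `W_{t+1}` to the past makes `‖E_t‖²` a
solution of the generalized Riccati equation, the prediction error of `Y_{t+1}` has the variance
`S_{t+1}`, and the power of the input is at least `Λ² K + K_Z` (`exists_params_of_orthogonal`).
Let `g` be the density of the Gaussian law with these linear predictors and variances (`triLaw`).
Gibbs' inequality bounds `H(Y^n)` by `-E log g(Y^n)`, which depends only on the prediction errors
and equals `∑ (½ log (2π S_t) + ½)`. The noise law is Gaussian of the same triangular form, so the
pay-off is at most the rate of `(Λ, K_Z)`. The same inequality, together with the boundedness of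
the output density (each output contains a fresh Gaussian variable, `exists_outputLaw_le`), shows
that the entropy integral converges (`entropy_le_of_density`).

Achievability. When the input is `Λ (V - v̂) + Z` with the filter estimate `v̂`, a pair of jointly
Gaussian variables that is uncorrelated is independent, so by induction the filter error is
Gaussian with the Riccati variance and independent of the past outputs
(`DrivenProcess.law_filterError`). Hence the filter is the conditional mean
(`DrivenProcess.estimate_V`), the outputs have the triangular Gaussian law with the filter as
predictor (`DrivenProcess.map_outVec`), and the pay-off is exactly the rate
(`payoff_filterStrategy`). Since the conditional mean in an innovations process is identified with
the filter step by step (`InnovationsProcess.filterInput`), every such process obeys the same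
equations.

Attainment (`exists_isGreatest_paramRates`). The power constraint does not bound `Λ_t` when
`K_{t-1}` is small, but it bounds `a_t = Λ_t √K_{t-1}`. In the parameters `(a, K_Z)` the feasible
set is compact and the rate is continuous. A pair `(a_t, z_t)` with `K_{t-1} = 0` has the same
effect as `Λ_t = 0`, `K_{Z_t} = z_t + a_t²`.
-/

namespace AGN

/-! ### Triangular Gaussian laws -/

/-- Appending a last coordinate preserves Lebesgue measure. -/
theorem measurePreserving_snoc (t : ℕ) :
    MeasurePreserving (fun q : (Fin t → ℝ) × ℝ => Fin.snoc (α := fun _ => ℝ) q.1 q.2)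
      (volume.prod volume) volume := by
  have h := (volume_preserving_piFinSuccAbove (fun _ : Fin (t + 1) => ℝ) (Fin.last t)).symm
  have h2 := h.comp (Measure.measurePreserving_swap
    (μ := (volume : Measure (Fin t → ℝ))) (ν := (volume : Measure ℝ)))
  convert! h2 using 2
  ext q : 1
  simp [MeasurableEquiv.piFinSuccAbove, Fin.insertNthEquiv, Fin.insertNth_last']

theorem measurable_snoc {t : ℕ} :
    Measurable (fun q : (Fin t → ℝ) × ℝ => Fin.snoc (α := fun _ => ℝ) q.1 q.2) :=
  (measurePreserving_snoc t).measurable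

/-- A shear `(a, x) ↦ (a, φ a + x)` preserves every product with Lebesgue measure. -/
theorem measurePreserving_shear {A : Type*} [MeasurableSpace A] (μ : Measure A) [SFinite μ]
    {φ : A → ℝ} (hφ : Measurable φ) :
    MeasurePreserving (fun q : A × ℝ => (q.1, φ q.1 + q.2)) (μ.prod volume) (μ.prod volume) := by
  refine (MeasurePreserving.id μ).skew_product (g := fun a x => φ a + x) ?_ ?_
  · exact (hφ.comp measurable_fst).add measurable_snd
  · exact Filter.Eventually.of_forall fun a => map_add_left_eq_self volume (φ a)

/-- The law of `(y_1, …, y_n)` when `y_{t+1} = φ_t(y_1, …, y_t) + i_{t+1}` with independent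
`i_{t+1} ∼ N(0, S_{t+1})`. -/
noncomputable def triLaw (φ : (t : ℕ) → (Fin t → ℝ) → ℝ) (S : ℕ → ℝ) :
    (n : ℕ) → Measure (Fin n → ℝ)
  | 0 => Measure.dirac Fin.elim0
  | t + 1 => ((triLaw φ S t).prod (gaussianReal 0 (S (t + 1)).toNNReal)).map
      (fun q => Fin.snoc (α := fun _ => ℝ) q.1 (φ t q.1 + q.2))

/-- The density of `triLaw`. -/
noncomputable def triDens (φ : (t : ℕ) → (Fin t → ℝ) → ℝ) (S : ℕ → ℝ) : (n : ℕ) → (Fin n → ℝ) → ℝ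
  | 0, _ => 1
  | t + 1, y => triDens φ S t (fun i => y i.castSucc)
      * gaussianPDFReal 0 (S (t + 1)).toNNReal (y (Fin.last t) - φ t (fun i => y i.castSucc))

section Tri

variable {φ : (t : ℕ) → (Fin t → ℝ) → ℝ} {S : ℕ → ℝ} {n : ℕ}

theorem measurable_snoc_shear (hφ : ∀ t, Measurable (φ t)) (t : ℕ) :
    Measurable (fun q : (Fin t → ℝ) × ℝ => Fin.snoc (α := fun _ => ℝ) q.1 (φ t q.1 + q.2)) :=
  measurable_snoc.comp (f := fun q : (Fin t → ℝ) × ℝ => (q.1, φ t q.1 + q.2))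
    (measurable_fst.prodMk (((hφ t).comp measurable_fst).add measurable_snd))

theorem isProbabilityMeasure_triLaw (hφ : ∀ t, Measurable (φ t)) (S : ℕ → ℝ) (n : ℕ) :
    IsProbabilityMeasure (triLaw φ S n) := by
  induction n with
  | zero => unfold triLaw; infer_instance
  | succ t ih =>
    unfold triLaw
    exact Measure.isProbabilityMeasure_map (measurable_snoc_shear hφ t).aemeasurable

theorem measurable_triDens (hφ : ∀ t, Measurable (φ t)) (S : ℕ → ℝ) (n : ℕ) :
    Measurable (triDens φ S n) := by
  induction n with
  | zero => exact measurable_const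
  | succ t ih =>
    have h1 : Measurable (fun (y : Fin (t + 1) → ℝ) (i : Fin t) => y i.castSucc) := by fun_prop
    exact (ih.comp h1).mul ((measurable_gaussianPDFReal _ _).comp
      ((measurable_pi_apply _).sub ((hφ t).comp h1)))

theorem triDens_pos (hS : ∀ t < n, 0 < S (t + 1)) (y : Fin n → ℝ) : 0 < triDens φ S n y := by
  induction n with
  | zero => exact one_pos
  | succ t ih =>
    exact mul_pos (ih (fun s hs => hS s (by omega)) _)
      (gaussianPDFReal_pos _ _ _ (by simpa using hS t (by omega)))

theorem triDens_snoc (t : ℕ) (y : Fin t → ℝ) (x : ℝ) :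
    triDens φ S (t + 1) (Fin.snoc (α := fun _ => ℝ) y x)
      = triDens φ S t y * gaussianPDFReal 0 (S (t + 1)).toNNReal (x - φ t y) := by
  simp [triDens]

theorem map_withDensity_comp {A B : Type*} [MeasurableSpace A] [MeasurableSpace B] (μ : Measure A)
    {T : A → B} (hT : Measurable T) {h : B → ENNReal} (hh : Measurable h) :
    (μ.withDensity (fun a => h (T a))).map T = (μ.map T).withDensity h := by
  ext s hs
  rw [Measure.map_apply hT hs, withDensity_apply _ (hT hs), withDensity_apply _ hs,
    setLIntegral_map hs hh hT]

theorem triLaw_eq_withDensity (hφ : ∀ t, Measurable (φ t)) (hS : ∀ t < n, 0 < S (t + 1)) :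
    triLaw φ S n = volume.withDensity (fun y => ENNReal.ofReal (triDens φ S n y)) := by
  induction n with
  | zero =>
    have : (volume : Measure (Fin 0 → ℝ)) = Measure.dirac Fin.elim0 := by
      rw [volume_pi, Measure.pi_of_empty _ Fin.elim0]
    simp [triLaw, triDens, this]
  | succ t ih =>
    have hpos : (S (t + 1)).toNNReal ≠ 0 := by simpa using hS t (by omega)
    have hmp : MeasurePreserving
        (fun q : (Fin t → ℝ) × ℝ => Fin.snoc (α := fun _ => ℝ) q.1 (φ t q.1 + q.2))
        (volume.prod volume) volume :=
      (measurePreserving_snoc t).comp (measurePreserving_shear volume (hφ t))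
    rw [triLaw, ih (fun s hs => hS s (by omega)), gaussianReal_of_var_ne_zero _ hpos,
      prod_withDensity (measurable_triDens hφ S t).ennreal_ofReal (measurable_gaussianPDF _ _)]
    have := map_withDensity_comp (volume.prod volume) hmp.measurable
      (measurable_triDens hφ S (t + 1)).ennreal_ofReal
    rw [hmp.map_eq] at this
    rw [← this]
    congr 2
    ext q
    rw [triDens_snoc, add_sub_cancel_left, ENNReal.ofReal_mul (triDens_pos
      (fun s hs => hS s (by omega)) _).le, gaussianPDF]

theorem log_gaussianPDFReal {v : ℝ} (hv : 0 < v) (x : ℝ) :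
    Real.log (gaussianPDFReal 0 v.toNNReal x)
      = -(1 / 2 * Real.log (2 * Real.pi * v)) - x ^ 2 / (2 * v) := by
  have h1 : 0 < 2 * Real.pi * v := by positivity
  rw [gaussianPDFReal, Real.coe_toNNReal _ hv.le, Real.log_mul (by positivity) (by positivity),
    Real.log_exp, Real.log_inv, Real.log_sqrt h1.le, sub_zero]
  ring

/-- The logarithm of the triangular Gaussian density along a sequence. -/
theorem log_triDens (hS : ∀ t < n, 0 < S (t + 1)) (y : ℕ → ℝ) :
    Real.log (triDens φ S n (fun i => y (i + 1)))
      = ∑ t ∈ Finset.range n, (-(1 / 2 * Real.log (2 * Real.pi * S (t + 1)))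
          - (y (t + 1) - φ t (fun i : Fin t => y (i + 1))) ^ 2 / (2 * S (t + 1))) := by
  induction n with
  | zero => simp [triDens]
  | succ t ih =>
    have h := fun s (hs : s < t) => hS s (by omega)
    rw [Finset.sum_range_succ, ← ih h, triDens, Real.log_mul (triDens_pos h _).ne'
      (gaussianPDFReal_pos _ _ _ (by simpa using hS t (by omega))).ne',
      log_gaussianPDFReal (hS t (by omega))]
    simp

/-- The mean of the logarithmic density of `triLaw`. -/
theorem integral_log_triDens (hφ : ∀ t, Measurable (φ t)) (hS : ∀ t < n, 0 < S (t + 1)) :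
    Integrable (fun y => Real.log (triDens φ S n y)) (triLaw φ S n) ∧
    ∫ y, Real.log (triDens φ S n y) ∂(triLaw φ S n)
      = -∑ t ∈ Finset.range n, (1 / 2 * Real.log (2 * Real.pi * S (t + 1)) + 1 / 2) := by
  induction n with
  | zero => simp [triDens, triLaw]
  | succ t ih =>
    have h := fun s (hs : s < t) => hS s (by omega)
    have hpos := hS t (by omega)
    obtain ⟨h1, h2⟩ := ih h
    have := isProbabilityMeasure_triLaw hφ S t
    have hm := (measurable_snoc_shear hφ t)
    have hlm : Measurable (fun y => Real.log (triDens φ S (t + 1) y)) :=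
      (measurable_triDens hφ S (t + 1)).log
    have hlog : ∀ q : (Fin t → ℝ) × ℝ,
        Real.log (triDens φ S (t + 1) (Fin.snoc (α := fun _ => ℝ) q.1 (φ t q.1 + q.2)))
          = Real.log (triDens φ S t q.1)
            + (-(1 / 2 * Real.log (2 * Real.pi * S (t + 1))) - q.2 ^ 2 / (2 * S (t + 1))) := by
      intro q
      rw [triDens_snoc, add_sub_cancel_left, Real.log_mul (triDens_pos h _).ne'
        (gaussianPDFReal_pos _ _ _ (by simpa using hpos)).ne', log_gaussianPDFReal hpos]
    have hsq : Integrable (fun x : ℝ => x ^ 2) (gaussianReal 0 (S (t + 1)).toNNReal) :=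
      (memLp_id_gaussianReal 2).integrable_sq
    have hsqv : ∫ x : ℝ, x ^ 2 ∂(gaussianReal 0 (S (t + 1)).toNNReal) = S (t + 1) := by
      have := variance_id_gaussianReal (μ := 0) (v := (S (t + 1)).toNNReal)
      rw [variance_of_integral_eq_zero (by fun_prop) (by simp)] at this
      simpa [hpos.le] using this
    have hg : Integrable (fun x : ℝ => -(1 / 2 * Real.log (2 * Real.pi * S (t + 1)))
        - x ^ 2 / (2 * S (t + 1))) (gaussianReal 0 (S (t + 1)).toNNReal) :=
      (integrable_const _).sub (hsq.div_const _)
    constructor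
    · rw [triLaw, integrable_map_measure hlm.aestronglyMeasurable hm.aemeasurable]
      refine Integrable.congr ((h1.comp_fst _).add (hg.comp_snd _))
        (Filter.Eventually.of_forall fun q => (hlog q).symm)
    · rw [triLaw, integral_map hm.aemeasurable hlm.aestronglyMeasurable]
      simp_rw [hlog]
      rw [integral_add (h1.comp_fst _) (hg.comp_snd _), integral_fun_fst
        (fun y => Real.log (triDens φ S t y)),
        integral_fun_snd (fun x : ℝ => -(1 / 2 * Real.log (2 * Real.pi * S (t + 1)))
        - x ^ 2 / (2 * S (t + 1))), h2, integral_sub (integrable_const _) (hsq.div_const _),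
        integral_div, hsqv, Finset.sum_range_succ]
      simp
      field_simp
      ring

end Tri

/-! ### Differential entropy of laws with bounded densities -/

/-- Gibbs' inequality. For a law with bounded density `f` and a probability density `g`, the
pointwise bounds `f log g + f - g ≤ f log f ≤ f log B` give both convergence of the entropy
integral and comparison with the cross entropy. -/
theorem entropy_le_of_density {n : ℕ} (ν : Measure (Fin n → ℝ)) [IsProbabilityMeasure ν]
    {B : NNReal} (hB : ν ≤ B • volume) {g : (Fin n → ℝ) → ℝ} (hg : Measurable g)
    (hg0 : ∀ y, 0 < g y)
    (hg1 : IsProbabilityMeasure (volume.withDensity (fun y => ENNReal.ofReal (g y))))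
    (hlog : Integrable (fun y => Real.log (g y)) ν) :
    HasFiniteEntropy ν ∧ differentialEntropy ν ≤ -∫ y, Real.log (g y) ∂ν := by
  have hac : ν ≪ volume := hB.absolutelyContinuous.trans
    (Measure.AbsolutelyContinuous.rfl.smul_left _)
  set f := fun y => (ν.rnDeriv volume y).toReal with hf
  have hfm : Measurable f := (Measure.measurable_rnDeriv _ _).ennreal_toReal
  have hf0 : ∀ y, 0 ≤ f y := fun y => ENNReal.toReal_nonneg
  have hfi : Integrable f volume := Measure.integrable_toReal_rnDeriv
  have hfint : ∫ y, f y = 1 := by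
    rw [Measure.integral_toReal_rnDeriv hac]; simp
  -- the domination of the measure is a bound on the density
  have hfB : ∀ᵐ y, f y ≤ B := by
    have h1 : ∀ᵐ y, ν.rnDeriv volume y ≤ B := by
      refine ae_le_of_forall_setLIntegral_le_of_sigmaFinite
        (Measure.measurable_rnDeriv _ _) fun s hs _ => ?_
      rw [Measure.setLIntegral_rnDeriv hac, setLIntegral_const]
      simpa using hB s
    filter_upwards [h1] with y hy
    exact ENNReal.toReal_le_of_le_ofReal B.2 (by simpa using hy)
  have hgi : Integrable g volume ∧ ∫ y, g y = 1 := by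
    have h1 : ∫⁻ y, ENNReal.ofReal (g y) = 1 := by
      have := hg1.measure_univ
      rwa [withDensity_apply _ MeasurableSet.univ, Measure.restrict_univ] at this
    have h2 : Integrable g volume :=
      (lintegral_ofReal_ne_top_iff_integrable hg.aestronglyMeasurable
        (Filter.Eventually.of_forall fun y => (hg0 y).le)).1 (by simp [h1])
    refine ⟨h2, ?_⟩
    rw [integral_eq_lintegral_of_nonneg_ae (Filter.Eventually.of_forall fun y => (hg0 y).le)
      hg.aestronglyMeasurable, h1]
    simp
  have hfl : Integrable (fun y => f y * Real.log (g y)) volume := by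
    have := (integrable_rnDeriv_smul_iff hac (f := fun y => Real.log (g y))).2 hlog
    simpa using this
  have hfli : ∫ y, f y * Real.log (g y) = ∫ y, Real.log (g y) ∂ν := by
    have := integral_rnDeriv_smul hac (f := fun y => Real.log (g y))
    simpa using this
  -- from `log x ≤ x - 1` at `x = g / f`
  have hlow : ∀ y, f y * Real.log (g y) + f y - g y ≤ f y * Real.log (f y) := by
    intro y
    rcases (hf0 y).eq_or_lt with h | h
    · rw [← h]; simp [(hg0 y).le]
    · have h1 := Real.log_le_sub_one_of_pos (div_pos (hg0 y) h)
      rw [Real.log_div (hg0 y).ne' h.ne'] at h1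
      have h2 := mul_le_mul_of_nonneg_left h1 h.le
      have h3 : f y * (g y / f y - 1) = g y - f y := by field_simp
      rw [h3] at h2
      linarith
  have hup : ∀ᵐ y, f y * Real.log (f y) ≤ f y * Real.log B := by
    filter_upwards [hfB] with y hy
    rcases (hf0 y).eq_or_lt with h | h
    · rw [← h]; simp
    · exact mul_le_mul_of_nonneg_left (Real.log_le_log h hy) h.le
  have hlowi : Integrable (fun y => f y * Real.log (g y) + f y - g y) volume :=
    (hfl.add hfi).sub hgi.1
  have hint : Integrable (fun y => f y * Real.log (f y)) volume :=
    integrable_of_le_of_le (hfm.mul hfm.log).aestronglyMeasurable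
      (Filter.Eventually.of_forall hlow) hup hlowi (hfi.mul_const _)
  have hneg : (fun y => Real.negMulLog (f y)) = fun y => -(f y * Real.log (f y)) := by
    ext y; simp [Real.negMulLog]
  refine ⟨⟨hac, ?_⟩, ?_⟩
  · change Integrable (fun y => Real.negMulLog (f y)) volume
    rw [hneg]
    exact hint.neg
  · change ∫ y, Real.negMulLog (f y) ≤ _
    rw [hneg, integral_neg, neg_le_neg_iff]
    have := integral_mono hlowi hint hlow
    have h1 : ∫ y, (f y * Real.log (g y) + f y - g y) = ∫ y, Real.log (g y) ∂ν := by
      rw [integral_sub (f := fun y => f y * Real.log (g y) + f y) (hfl.add hfi) hgi.1,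
        integral_add hfl hfi, hfint, hgi.2, hfli]
      ring
    rwa [h1] at this

/-- The entropy of a triangular Gaussian law. -/
theorem differentialEntropy_triLaw {φ : (t : ℕ) → (Fin t → ℝ) → ℝ} (hφ : ∀ t, Measurable (φ t))
    {S : ℕ → ℝ} {n : ℕ} (hS : ∀ t < n, 0 < S (t + 1)) :
    differentialEntropy (triLaw φ S n)
      = ∑ t ∈ Finset.range n, (1 / 2 * Real.log (2 * Real.pi * S (t + 1)) + 1 / 2) := by
  have hp := isProbabilityMeasure_triLaw hφ S n
  have heq := triLaw_eq_withDensity hφ hS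
  have hm := (measurable_triDens hφ S n)
  have hac : triLaw φ S n ≪ volume := by
    rw [heq]; exact withDensity_absolutelyContinuous _ _
  have hrn : (triLaw φ S n).rnDeriv volume =ᵐ[volume]
      fun y => ENNReal.ofReal (triDens φ S n y) := by
    rw [heq]; exact Measure.rnDeriv_withDensity _ hm.ennreal_ofReal
  have h := integral_rnDeriv_smul hac (f := fun y => Real.log (triDens φ S n y))
  rw [(integral_log_triDens hφ hS).2] at h
  rw [← neg_eq_iff_eq_neg] at h
  rw [← h, ← integral_neg]
  refine integral_congr_ae ?_
  filter_upwards [hrn] with y hy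
  simp [hy, Real.negMulLog, ENNReal.toReal_ofReal (triDens_pos hS y).le]

theorem gaussianPDFReal_le (v : NNReal) (x : ℝ) :
    gaussianPDFReal 0 v x ≤ (√(2 * Real.pi * v))⁻¹ := by
  refine mul_le_of_le_one_right (by positivity) (Real.exp_le_one_iff.2 ?_)
  rw [neg_div]
  exact neg_nonpos.2 (by positivity)

theorem withDensity_le_smul {A : Type*} [MeasurableSpace A] (μ : Measure A) {f : A → ℝ} {B : ℝ}
    (hf : ∀ a, f a ≤ B) :
    μ.withDensity (fun a => ENNReal.ofReal (f a)) ≤ B.toNNReal • μ := by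
  refine Measure.le_iff.2 fun s hs => ?_
  rw [withDensity_apply _ hs, Measure.smul_apply, ENNReal.smul_def, smul_eq_mul,
    ← setLIntegral_const]
  exact lintegral_mono fun x => ENNReal.ofReal_le_ofReal (hf x)

/-- A centred Gaussian law of positive variance is dominated by a multiple of Lebesgue measure. -/
theorem gaussianReal_le_smul_volume {v : ℝ} (hv : 0 < v) :
    ∃ B : NNReal, gaussianReal 0 v.toNNReal ≤ B • volume := by
  rw [gaussianReal_of_var_ne_zero _ (by simpa using hv)]
  exact ⟨_, withDensity_le_smul volume (gaussianPDFReal_le _)⟩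

theorem exists_triLaw_le {φ : (t : ℕ) → (Fin t → ℝ) → ℝ} (hφ : ∀ t, Measurable (φ t))
    {S : ℕ → ℝ} {n : ℕ} (hS : ∀ t < n, 0 < S (t + 1)) :
    ∃ B : NNReal, triLaw φ S n ≤ B • volume := by
  -- by convention the Gaussian density of variance `0` is `0`, within the bound
  obtain ⟨B, hB⟩ : ∃ B : ℝ, ∀ y, triDens φ S n y ≤ B := by
    clear hS
    induction n with
    | zero => exact ⟨1, fun _ => le_rfl⟩
    | succ t ih =>
      obtain ⟨B, hB⟩ := ih
      refine ⟨|B| * (√(2 * Real.pi * (S (t + 1)).toNNReal))⁻¹, fun y => ?_⟩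
      exact mul_le_mul ((hB _).trans (le_abs_self B)) (gaussianPDFReal_le _ _)
        (gaussianPDFReal_nonneg _ _ _) (abs_nonneg B)
  rw [triLaw_eq_withDensity hφ hS]
  exact ⟨_, withDensity_le_smul volume hB⟩

/-! ### The joint law of inputs and outputs -/

section JointLaw

/-- One step of the channel: the history `h`, the next input `x` and the next noise increment `w`
give the next history. -/
noncomputable def stepMap (a v₀ : ℝ) (t : ℕ) (q : (Hist t × ℝ) × ℝ) : Hist (t + 1) :=
  (Fin.snoc (α := fun _ => ℝ) q.1.1.1 q.1.2,
    Fin.snoc (α := fun _ => ℝ) q.1.1.2 (q.1.2 + (a * noiseAt v₀ q.1.1 + q.2)))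

theorem measurable_noiseAt_right (v₀ : ℝ) (t : ℕ) :
    Measurable (fun h : Hist t => noiseAt v₀ h) :=
  (measurable_noiseAt t).comp (f := fun h : Hist t => (v₀, h)) (by fun_prop)

theorem measurable_stepMap (a v₀ : ℝ) (t : ℕ) : Measurable (stepMap a v₀ t) := by
  have h := measurable_noiseAt_right v₀ t
  refine Measurable.prodMk ?_ ?_
  · exact measurable_snoc.comp (f := fun q : (Hist t × ℝ) × ℝ => (q.1.1.1, q.1.2)) (by fun_prop)
  · exact measurable_snoc.comp (f := fun q : (Hist t × ℝ) × ℝ =>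
      (q.1.1.2, q.1.2 + (a * noiseAt v₀ q.1.1 + q.2))) (by fun_prop)

variable (c KW : ℕ → ℝ) (P : Strategy) (v₀ : ℝ)

theorem jointLaw_succ (t : ℕ) : jointLaw c KW P v₀ (t + 1) =
    (((jointLaw c KW P v₀ t).compProd ((P.kernel t).sectR v₀)).prod
      (gaussianReal 0 (KW (t + 1)).toNNReal)).map (stepMap (c (t + 1)) v₀ t) := rfl

instance isMarkovKernel_sectR (t : ℕ) : IsMarkovKernel ((P.kernel t).sectR v₀) := by
  have := P.markov t
  infer_instance

instance isProbabilityMeasure_jointLaw (t : ℕ) :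
    IsProbabilityMeasure (jointLaw c KW P v₀ t) := by
  induction t with
  | zero => unfold jointLaw; infer_instance
  | succ t ih =>
    rw [jointLaw_succ]
    exact Measure.isProbabilityMeasure_map (measurable_stepMap _ _ _).aemeasurable

/-- The part of a history up to time `t`. -/
def truncHist {n t : ℕ} (ht : t ≤ n) (h : Hist n) : Hist t :=
  (fun i => h.1 (Fin.castLE ht i), fun i => h.2 (Fin.castLE ht i))

theorem measurable_truncHist {n t : ℕ} (ht : t ≤ n) : Measurable (truncHist ht) := by
  unfold truncHist; fun_prop

theorem map_truncHist {n t : ℕ} (ht : t ≤ n) :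
    (jointLaw c KW P v₀ n).map (truncHist ht) = jointLaw c KW P v₀ t := by
  induction n, ht using Nat.le_induction with
  | base => exact Measure.map_id
  | succ n hn ih =>
    have h1 : truncHist (hn.trans n.le_succ) ∘ stepMap (c (n + 1)) v₀ n
        = (truncHist hn ∘ Prod.fst) ∘ Prod.fst := by
      ext q i
      · exact Fin.snoc_castSucc (α := fun _ => ℝ) _ _ (Fin.castLE hn i)
      · exact Fin.snoc_castSucc (α := fun _ => ℝ) _ _ (Fin.castLE hn i)
    rw [jointLaw_succ, Measure.map_map (measurable_truncHist _) (measurable_stepMap _ _ _), h1,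
      ← Measure.map_map ((measurable_truncHist _).comp measurable_fst) measurable_fst,
      Measure.map_fst_prod, measure_univ, one_smul, ← Measure.map_map (measurable_truncHist _)
      measurable_fst, ← Measure.fst, Measure.fst_compProd, ih]

/-- The noise law is triangular Gaussian, whatever the strategy. -/
theorem noiseLaw_eq_triLaw (n : ℕ) :
    noiseLaw c KW P v₀ n
      = triLaw (fun t v => c (t + 1) * noiseAt v₀ ((0, v) : Hist t)) KW n := by
  induction n with
  | zero =>
    rw [noiseLaw, jointLaw, triLaw, Measure.map_dirac' (f := fun h : Hist 0 => h.2 - h.1)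
      (by fun_prop)]
    congr 1
    exact Subsingleton.elim _ _
  | succ t ih =>
    have hn : ∀ h : Hist t, noiseAt v₀ ((0, h.2 - h.1) : Hist t) = noiseAt v₀ h := by
      intro h
      cases t <;> simp [noiseAt]
    -- in one step of the channel the noise `v = y - x` becomes `(v, c v_t + w)`: the input cancels
    rw [triLaw, ← ih, noiseLaw, noiseLaw, jointLaw_succ, Measure.map_map (by fun_prop)
      (measurable_stepMap _ _ _)]
    have hmφ : Measurable (fun v : Fin t → ℝ => c (t + 1) * noiseAt v₀ ((0, v) : Hist t)) :=
      ((measurable_noiseAt_right v₀ t).comp (f := fun v : Fin t → ℝ => ((0, v) : Hist t))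
        (by fun_prop)).const_mul _
    have h1 : (jointLaw c KW P v₀ t).map (fun h => h.2 - h.1)
        = ((jointLaw c KW P v₀ t).compProd ((P.kernel t).sectR v₀)).map
          (fun q => q.1.2 - q.1.1) := by
      conv_lhs => rw [← Measure.fst_compProd (jointLaw c KW P v₀ t) ((P.kernel t).sectR v₀)]
      rw [Measure.fst, Measure.map_map (by fun_prop) measurable_fst]
      rfl
    have h2 : Measurable (fun q : (Fin t → ℝ) × ℝ => Fin.snoc (α := fun _ => ℝ) q.1
        (c (t + 1) * noiseAt v₀ ((0, q.1) : Hist t) + q.2)) :=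
      measurable_snoc.comp (f := fun q : (Fin t → ℝ) × ℝ =>
        (q.1, c (t + 1) * noiseAt v₀ ((0, q.1) : Hist t) + q.2))
        (measurable_fst.prodMk ((hmφ.comp measurable_fst).add measurable_snd))
    have h3 := Measure.map_prod_map
      ((jointLaw c KW P v₀ t).compProd ((P.kernel t).sectR v₀))
      (gaussianReal 0 (KW (t + 1)).toNNReal) (f := fun q => q.1.2 - q.1.1) (g := id)
      (by fun_prop) measurable_id
    rw [Measure.map_id] at h3
    rw [h1, h3, Measure.map_map h2 (by fun_prop)]
    congr 1
    ext q i
    refine Fin.lastCases ?_ (fun i => ?_) i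
    · simp [stepMap, hn]
    · simp [stepMap]

theorem isProbabilityMeasure_outputLaw (n : ℕ) :
    IsProbabilityMeasure (outputLaw c KW P v₀ n) :=
  Measure.isProbabilityMeasure_map (by fun_prop)

/-- Since each output contains a fresh Gaussian variable, the outputs have a bounded density,
whatever the strategy. -/
theorem exists_outputLaw_le {n : ℕ} (hKW : ∀ t < n, 0 < KW (t + 1)) :
    ∃ B : NNReal, outputLaw c KW P v₀ n ≤ B • volume := by
  induction n with
  | zero =>
    refine ⟨1, ?_⟩
    rw [outputLaw, jointLaw, Measure.map_dirac' (f := fun h : Hist 0 => h.2) (by fun_prop),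
      one_smul, volume_pi, Measure.pi_of_empty _ Fin.elim0]
  | succ t ih =>
    obtain ⟨B, hB⟩ := ih fun s hs => hKW s (by omega)
    obtain ⟨C, hC⟩ := gaussianReal_le_smul_volume (hKW t (by omega))
    refine ⟨C * B, ?_⟩
    have := isProbabilityMeasure_outputLaw c KW P v₀ t
    set ρ := (jointLaw c KW P v₀ t).compProd ((P.kernel t).sectR v₀) with hρ
    have hmn := measurable_noiseAt_right v₀ t
    have hψ : Measurable (fun p : Hist t × ℝ => p.2 + c (t + 1) * noiseAt v₀ p.1) := by fun_prop
    have hsn : Measurable (fun q : (Hist t × ℝ) × ℝ =>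
        Fin.snoc (α := fun _ => ℝ) q.1.1.2 q.2) :=
      measurable_snoc.comp (f := fun q : (Hist t × ℝ) × ℝ => (q.1.1.2, q.2)) (by fun_prop)
    have hsh := measurePreserving_shear ρ hψ
    have h1 : outputLaw c KW P v₀ (t + 1) = ((ρ.prod (gaussianReal 0 (KW (t + 1)).toNNReal)).map
        (fun q => (q.1, (q.1.2 + c (t + 1) * noiseAt v₀ q.1.1) + q.2))).map
        (fun q => Fin.snoc (α := fun _ => ℝ) q.1.1.2 q.2) := by
      rw [outputLaw, jointLaw_succ, Measure.map_map (by fun_prop) (measurable_stepMap _ _ _),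
        Measure.map_map hsn hsh.measurable]
      congr 1
      ext q : 1
      simp [stepMap, add_assoc]
    have h2 : outputLaw c KW P v₀ t = ρ.map (fun p => p.1.2) := by
      conv_lhs => rw [outputLaw, ← Measure.fst_compProd (jointLaw c KW P v₀ t)
        ((P.kernel t).sectR v₀)]
      rw [Measure.fst, Measure.map_map (by fun_prop) measurable_fst]
      rfl
    have h3 : (ρ.prod volume).map (fun q : (Hist t × ℝ) × ℝ =>
        Fin.snoc (α := fun _ => ℝ) q.1.1.2 q.2)
        = ((outputLaw c KW P v₀ t).prod volume).map
          (fun q => Fin.snoc (α := fun _ => ℝ) q.1 q.2) := by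
      have h4 := Measure.map_prod_map ρ (volume : Measure ℝ) (f := fun p => p.1.2) (g := id)
        (by fun_prop) measurable_id
      rw [Measure.map_id] at h4
      rw [h2, h4, Measure.map_map measurable_snoc (by fun_prop)]
      rfl
    -- the last output is a shear of a fresh Gaussian, so its law is dominated given the past
    calc outputLaw c KW P v₀ (t + 1)
        ≤ ((ρ.prod (C • volume)).map
          (fun q => (q.1, (q.1.2 + c (t + 1) * noiseAt v₀ q.1.1) + q.2))).map
          (fun q => Fin.snoc (α := fun _ => ℝ) q.1.1.2 q.2) := by
          rw [h1]
          exact Measure.map_mono (Measure.map_mono (Measure.prod_mono le_rfl hC) hsh.measurable)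
            hsn
      _ = C • ((outputLaw c KW P v₀ t).prod volume).map
          (fun q => Fin.snoc (α := fun _ => ℝ) q.1 q.2) := by
          rw [Measure.prod_smul_right, Measure.map_smul, hsh.map_eq, Measure.map_smul, h3]
      _ ≤ C • ((B • volume).prod volume).map (fun q => Fin.snoc (α := fun _ => ℝ) q.1 q.2) := by
          refine Measure.le_iff.2 fun s hs => ?_
          rw [Measure.smul_apply, Measure.smul_apply]
          refine smul_le_smul_of_nonneg_left (Measure.le_iff.1 ?_ s hs) bot_le
          exact Measure.map_mono (Measure.prod_mono hB le_rfl) measurable_snoc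
      _ = (C * B) • volume := by
          rw [Measure.prod_smul_left, Measure.map_smul, (measurePreserving_snoc t).map_eq,
            smul_smul]

end JointLaw

/-! ### Processes on a probability space -/

/-- A realization on a probability space of the channel driven by an arbitrary strategy:
`W_{t+1}` is independent of `(X^{t+1}, Y^t)`. -/
structure FeedbackProcess {Ω : Type*} {mΩ : MeasurableSpace Ω} (μ : Measure Ω) (n : ℕ)
    (c KW : ℕ → ℝ) (v₀ : ℝ) (W V X Y : ℕ → Ω → ℝ) : Prop where
  measurable_X : ∀ t < n, Measurable (X (t + 1))
  measurable_W : ∀ t < n, Measurable (W (t + 1))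
  law_W : ∀ t < n, μ.map (W (t + 1)) = gaussianReal 0 (KW (t + 1)).toNNReal
  indep : ∀ t < n, IndepFun (W (t + 1))
    (fun ω => ((fun i : Fin (t + 1) => X (i + 1) ω), (fun i : Fin t => Y (i + 1) ω))) μ
  noise_zero : V 0 = fun _ => v₀
  noise_succ : ∀ t < n, V (t + 1) = fun ω => c (t + 1) * V t ω + W (t + 1) ω
  output : ∀ t < n, Y (t + 1) = fun ω => X (t + 1) ω + V (t + 1) ω

theorem indepFun_map {Ω Ω' β β' : Type*} [MeasurableSpace Ω] [MeasurableSpace Ω']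
    [MeasurableSpace β] [MeasurableSpace β'] {μ : Measure Ω} [IsProbabilityMeasure μ] {T : Ω → Ω'}
    (hT : Measurable T) {f : Ω' → β} {g : Ω' → β'} (hf : Measurable f) (hg : Measurable g) :
    IndepFun f g (μ.map T) ↔ IndepFun (f ∘ T) (g ∘ T) μ := by
  have := Measure.isProbabilityMeasure_map (μ := μ) hT.aemeasurable
  rw [indepFun_iff_map_prod_eq_prod_map_map hf.aemeasurable hg.aemeasurable,
    indepFun_iff_map_prod_eq_prod_map_map (hf.comp hT).aemeasurable (hg.comp hT).aemeasurable,
    Measure.map_map (hf.prodMk hg) hT, Measure.map_map hf hT, Measure.map_map hg hT]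
  rfl

/-- The coordinate of index `t`, counted from `1`, of a vector; zero outside the range. -/
def coordAt {n : ℕ} (t : ℕ) (x : Fin n → ℝ) : ℝ := if ht : t - 1 < n then x ⟨t - 1, ht⟩ else 0

theorem coordAt_succ {n t : ℕ} (ht : t < n) (x : Fin n → ℝ) : coordAt (t + 1) x = x ⟨t, ht⟩ := by
  simp [coordAt, ht]

/-- The noise path on the space of histories. -/
def noisePath (v₀ : ℝ) (n t : ℕ) (h : Hist n) : ℝ :=
  if t = 0 then v₀ else coordAt t h.2 - coordAt t h.1

/-- The coordinates of a history realize the channel under the joint law. -/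
theorem feedbackProcess_jointLaw (c KW : ℕ → ℝ) (P : Strategy) (v₀ : ℝ) (n : ℕ) :
    FeedbackProcess (jointLaw c KW P v₀ n) n c KW v₀
      (fun t h => noisePath v₀ n t h - c t * noisePath v₀ n (t - 1) h) (noisePath v₀ n)
      (fun t h => coordAt t h.1) (fun t h => coordAt t h.2) := by
  -- the noise increment is a function of the history up to time `t + 1`, and it recovers the
  -- variable `w` fed to the channel
  have hw : ∀ t (ht : t < n), ∃ w : Hist (t + 1) → ℝ, Measurable w ∧
      (fun h : Hist n => noisePath v₀ n (t + 1) h - c (t + 1) * noisePath v₀ n (t + 1 - 1) h)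
        = w ∘ truncHist (Nat.succ_le_of_lt ht) ∧
      ∀ q, w (stepMap (c (t + 1)) v₀ t q) = q.2 := by
    intro t ht
    refine ⟨fun h => noiseAt v₀ h - c (t + 1) * noiseAt v₀ (truncHist t.le_succ h),
      (measurable_noiseAt_right _ _).sub (((measurable_noiseAt_right _ _).comp
        (measurable_truncHist _)).const_mul _), ?_, ?_⟩
    · ext h
      have h1 : ∀ s (hs : s ≤ n), noisePath v₀ n s h = noiseAt v₀ (truncHist hs h) := by
        intro s hs
        cases s with
        | zero => simp [noisePath, noiseAt]
        | succ s =>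
          rw [noisePath, if_neg (by omega), coordAt_succ hs, coordAt_succ hs]
          rfl
      rw [h1 (t + 1) ht, add_tsub_cancel_right, h1 t ht.le]
      rfl
    · intro q
      have h1 : truncHist t.le_succ (stepMap (c (t + 1)) v₀ t q) = q.1.1 := by
        ext i
        · exact Fin.snoc_castSucc (α := fun _ => ℝ) _ _ i
        · exact Fin.snoc_castSucc (α := fun _ => ℝ) _ _ i
      simp only [h1]
      simp [noiseAt, stepMap]
  refine ⟨?_, ?_, ?_, ?_, ?_, ?_, ?_⟩
  · intro t ht
    simp only [coordAt_succ ht]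
    fun_prop
  · intro t ht
    obtain ⟨w, hwm, hw1, -⟩ := hw t ht
    rw [hw1]
    exact hwm.comp (measurable_truncHist _)
  · intro t ht
    obtain ⟨w, hwm, hw1, hw2⟩ := hw t ht
    rw [hw1, ← Measure.map_map hwm (measurable_truncHist _), map_truncHist, jointLaw_succ,
      Measure.map_map hwm (measurable_stepMap _ _ _)]
    have : w ∘ stepMap (c (t + 1)) v₀ t = Prod.snd := funext hw2
    rw [this, Measure.map_snd_prod, measure_univ, one_smul]
  · intro t ht
    obtain ⟨w, hwm, hw1, hw2⟩ := hw t ht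
    let g : Hist (t + 1) → (Fin (t + 1) → ℝ) × (Fin t → ℝ) := fun h =>
      (h.1, fun i => h.2 i.castSucc)
    have hg : Measurable g := by fun_prop
    have hgeq : (fun h : Hist n => ((fun i : Fin (t + 1) => coordAt (i + 1) h.1),
        (fun i : Fin t => coordAt (i + 1) h.2))) = g ∘ truncHist (Nat.succ_le_of_lt ht) := by
      ext h i
      · simp only [coordAt_succ (show (i : ℕ) < n by omega)]; rfl
      · simp only [coordAt_succ (show (i : ℕ) < n by omega)]; rfl
    have hgs : g ∘ stepMap (c (t + 1)) v₀ t
        = (fun p => (Fin.snoc (α := fun _ => ℝ) p.1.1 p.2, p.1.2)) ∘ Prod.fst := by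
      ext q i <;> simp [g, stepMap]
    change IndepFun (fun h : Hist n =>
      noisePath v₀ n (t + 1) h - c (t + 1) * noisePath v₀ n (t + 1 - 1) h) _ _
    rw [hw1, hgeq, ← indepFun_map (measurable_truncHist _) hwm hg, map_truncHist, jointLaw_succ,
      indepFun_map (measurable_stepMap _ _ _) hwm hg, hgs]
    have : w ∘ stepMap (c (t + 1)) v₀ t = id ∘ Prod.snd := funext hw2
    rw [this]
    exact (indepFun_prod ((measurable_snoc.comp (f := fun p : Hist t × ℝ => (p.1.1, p.2))
      (by fun_prop)).prodMk (g := fun p : Hist t × ℝ => p.1.2) (by fun_prop)) measurable_id).symm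
  · ext; simp [noisePath]
  · intro t _
    ext h
    simp
  · intro t _
    ext h
    simp [noisePath]

/-! ### The generalized Riccati equation -/

theorem riccati_succ (c KW Λ KZ : ℕ → ℝ) (t : ℕ) : riccati c KW Λ KZ (t + 1) =
    c (t + 1) ^ 2 * riccati c KW Λ KZ t + KW (t + 1)
      - (KW (t + 1) + c (t + 1) * riccati c KW Λ KZ t * (Λ (t + 1) + c (t + 1))) ^ 2
        / innovVar (c (t + 1)) (KW (t + 1)) (riccati c KW Λ KZ t) (Λ (t + 1)) (KZ (t + 1)) := rfl

theorem innovVar_pos {c KW K Λ KZ : ℝ} (hKW : 0 < KW) (hK : 0 ≤ K) (hKZ : 0 ≤ KZ) :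
    0 < innovVar c KW K Λ KZ := by
  unfold innovVar; positivity

/-- The Riccati map is `((c² K + K_W) K_Z + K_W K Λ²) / S`. -/
theorem riccati_nonneg {c KW Λ KZ : ℕ → ℝ} {n : ℕ} (hKW : ∀ t < n, 0 < KW (t + 1))
    (hKZ : ∀ t < n, 0 ≤ KZ (t + 1)) : ∀ t ≤ n, 0 ≤ riccati c KW Λ KZ t := by
  intro t
  induction t with
  | zero => intro _; exact le_rfl
  | succ t ih =>
    intro ht
    have hK := ih (by omega)
    have hW := hKW t ht
    have hZ := hKZ t ht
    have hS := innovVar_pos (c := c (t + 1)) (Λ := Λ (t + 1)) hW hK hZ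
    rw [riccati_succ, sub_nonneg, div_le_iff₀ hS, ← sub_nonneg]
    set K := riccati c KW Λ KZ t
    have h : (c (t + 1) ^ 2 * K + KW (t + 1))
          * innovVar (c (t + 1)) (KW (t + 1)) K (Λ (t + 1)) (KZ (t + 1))
        - (KW (t + 1) + c (t + 1) * K * (Λ (t + 1) + c (t + 1))) ^ 2
        = (c (t + 1) ^ 2 * K + KW (t + 1)) * KZ (t + 1) + KW (t + 1) * K * Λ (t + 1) ^ 2 := by
      unfold innovVar; ring
    rw [h]
    positivity

/-- The rate of the parameters as a difference of Gaussian entropies. -/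
theorem sum_log_sub_eq_paramRate {c KW Λ KZ : ℕ → ℝ} {n : ℕ} (hKW : ∀ t < n, 0 < KW (t + 1))
    (hKZ : ∀ t < n, 0 ≤ KZ (t + 1)) :
    ∑ t ∈ Finset.range n, (1 / 2 * Real.log (2 * Real.pi * innovVar (c (t + 1)) (KW (t + 1))
        (riccati c KW Λ KZ t) (Λ (t + 1)) (KZ (t + 1))) + 1 / 2)
      - ∑ t ∈ Finset.range n, (1 / 2 * Real.log (2 * Real.pi * KW (t + 1)) + 1 / 2)
      = paramRate c KW n Λ KZ := by
  rw [paramRate, ← Finset.sum_sub_distrib, Finset.mul_sum]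
  refine Finset.sum_congr rfl fun t ht => ?_
  have ht' := Finset.mem_range.1 ht
  have hW := hKW t ht'
  have hS := innovVar_pos (c := c (t + 1)) (Λ := Λ (t + 1)) hW
    (riccati_nonneg (c := c) (Λ := Λ) hKW hKZ t ht'.le) (hKZ t ht')
  have h : (Λ (t + 1) + c (t + 1)) ^ 2 * riccati c KW Λ KZ t + KZ (t + 1) + KW (t + 1)
      = innovVar (c (t + 1)) (KW (t + 1)) (riccati c KW Λ KZ t) (Λ (t + 1)) (KZ (t + 1)) := by
    unfold innovVar; ring
  rw [h, Real.log_div hS.ne' hW.ne', Real.log_mul (by positivity) hS.ne',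
    Real.log_mul (by positivity) hW.ne']
  ring

/-! ### Linear prediction with feedback -/

section Hilbert

open scoped InnerProductSpace

variable {H : Type*} [NormedAddCommGroup H] [InnerProductSpace ℝ H]

/-- The span of the constants and of the outputs up to time `t`. -/
def outputSpan (one : H) (Y : ℕ → H) (t : ℕ) : Submodule ℝ H :=
  Submodule.span ℝ (insert one (Set.range fun i : Fin t => Y (i + 1)))

instance finiteDimensional_outputSpan (one : H) (Y : ℕ → H) (t : ℕ) :
    FiniteDimensional ℝ (outputSpan one Y t) :=
  FiniteDimensional.span_of_finite ℝ ((Set.finite_range _).insert _)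

/-- The second order form of the converse. The regression coefficient `Λ_{t+1}` of the prediction
error of `X_{t+1}` on that of `V_t`, and the residual variance `K_{Z_{t+1}}`, both given the linear
span of the past outputs, satisfy the generalized Riccati equation, whatever the inputs are. -/
theorem exists_params_of_orthogonal {n : ℕ} {c KW : ℕ → ℝ} (hKW : ∀ t < n, 0 < KW (t + 1))
    (one : H) (X Y V W : ℕ → H) (hV0 : V 0 ∈ Submodule.span ℝ {one})
    (hV : ∀ t < n, V (t + 1) = c (t + 1) • V t + W (t + 1))
    (hY : ∀ t < n, Y (t + 1) = X (t + 1) + V (t + 1))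
    (hW1 : ∀ t < n, ⟪W (t + 1), one⟫_ℝ = 0)
    (hWX : ∀ t < n, ∀ s ≤ t, ⟪W (t + 1), X (s + 1)⟫_ℝ = 0)
    (hWY : ∀ t < n, ∀ s < t, ⟪W (t + 1), Y (s + 1)⟫_ℝ = 0)
    (hWW : ∀ t < n, ⟪W (t + 1), W (t + 1)⟫_ℝ = KW (t + 1)) :
    ∃ Λ KZ : ℕ → ℝ, (∀ t < n, 0 ≤ KZ (t + 1)) ∧
      (∀ t < n, Λ (t + 1) ^ 2 * riccati c KW Λ KZ t + KZ (t + 1) ≤ ⟪X (t + 1), X (t + 1)⟫_ℝ) ∧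
      ∀ t < n, ∃ p ∈ outputSpan one Y t, ⟪Y (t + 1) - p, Y (t + 1) - p⟫_ℝ
        = innovVar (c (t + 1)) (KW (t + 1)) (riccati c KW Λ KZ t) (Λ (t + 1)) (KZ (t + 1)) := by
  set P := outputSpan one Y with hP
  have hone : ∀ t, one ∈ P t := fun t => Submodule.subset_span (Set.mem_insert _ _)
  have hYmem : ∀ t, ∀ s < t, Y (s + 1) ∈ P t := fun t s hs =>
    Submodule.subset_span (Set.mem_insert_of_mem _ ⟨⟨s, hs⟩, rfl⟩)
  have hPle : ∀ t (K : Submodule ℝ H), one ∈ K → (∀ s < t, Y (s + 1) ∈ K) → P t ≤ K := by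
    intro t K h1 h2
    refine Submodule.span_le.2 (Set.insert_subset h1 ?_)
    rintro _ ⟨i, rfl⟩
    exact h2 i i.2
  have hmono : ∀ t, P t ≤ P (t + 1) := fun t =>
    hPle t _ (hone _) fun s hs => hYmem _ s (by omega)
  have hWP : ∀ t < n, ∀ p ∈ P t, ⟪W (t + 1), p⟫_ℝ = 0 := by
    intro t ht p hp
    have : P t ≤ (ℝ ∙ W (t + 1))ᗮ := by
      refine hPle t _ ?_ fun s hs => ?_
      · exact Submodule.mem_orthogonal_singleton_iff_inner_right.2 (hW1 t ht)
      · exact Submodule.mem_orthogonal_singleton_iff_inner_right.2 (hWY t ht s hs)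
    exact Submodule.mem_orthogonal_singleton_iff_inner_right.1 (this hp)
  have hWV : ∀ t < n, ⟪W (t + 1), V t⟫_ℝ = 0 := by
    intro t ht
    cases t with
    | zero =>
      obtain ⟨a, ha⟩ := Submodule.mem_span_singleton.1 hV0
      rw [← ha, inner_smul_right, hW1 0 ht, mul_zero]
    | succ t =>
      have h : V (t + 1) = Y (t + 1) - X (t + 1) := by rw [hY t (by omega)]; abel
      rw [h, inner_sub_right, hWY _ ht t (by omega), hWX _ ht t (by omega), sub_zero]
  set E : ℕ → H := fun t => V t - (P t).starProjection (V t) with hE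
  set U : ℕ → H := fun t => X (t + 1) - (P t).starProjection (X (t + 1)) with hU
  have hEP : ∀ t, ∀ p ∈ P t, ⟪E t, p⟫_ℝ = 0 := fun t p hp =>
    (P t).starProjection_inner_eq_zero (V t) p hp
  have hUP : ∀ t, ∀ p ∈ P t, ⟪U t, p⟫_ℝ = 0 := fun t p hp =>
    (P t).starProjection_inner_eq_zero (X (t + 1)) p hp
  have hWE : ∀ t < n, ⟪W (t + 1), E t⟫_ℝ = 0 := by
    intro t ht
    rw [hE, inner_sub_right, hWV t ht, hWP t ht _ (Submodule.starProjection_apply_mem _ _),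
      sub_zero]
  have hWU : ∀ t < n, ⟪W (t + 1), U t⟫_ℝ = 0 := by
    intro t ht
    rw [hU, inner_sub_right, hWX t ht t le_rfl,
      hWP t ht _ (Submodule.starProjection_apply_mem _ _), sub_zero]
  set K : ℕ → ℝ := fun t => ⟪E t, E t⟫_ℝ with hK
  -- if the error vanishes, the quotient is `0`, and so is the covariance it represents
  set Λ : ℕ → ℝ := fun t => ⟪U (t - 1), E (t - 1)⟫_ℝ / K (t - 1) with hΛ
  have hΛK : ∀ t, Λ (t + 1) * K t = ⟪U t, E t⟫_ℝ := by
    intro t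
    simp only [hΛ, add_tsub_cancel_right]
    by_cases h : K t = 0
    · have : E t = 0 := inner_self_eq_zero.1 h
      rw [h, this, mul_zero, inner_zero_right]
    · exact div_mul_cancel₀ _ h
  set KZ : ℕ → ℝ := fun t => ⟪U (t - 1), U (t - 1)⟫_ℝ - Λ t ^ 2 * K (t - 1) with hKZdef
  have hUU : ∀ t, ⟪U t, U t⟫_ℝ = Λ (t + 1) ^ 2 * K t + KZ (t + 1) := by
    intro t; simp [hKZdef]
  have hKZ0 : ∀ t, 0 ≤ KZ (t + 1) := by
    intro t
    have h : KZ (t + 1) = ⟪U t - Λ (t + 1) • E t, U t - Λ (t + 1) • E t⟫_ℝ := by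
      simp only [inner_sub_left, inner_sub_right, inner_smul_left, inner_smul_right,
        real_inner_comm (U t) (E t), hUU, ← hΛK, RCLike.conj_to_real]
      change _ = _ - _ * (_ - Λ (t + 1) * K t)
      ring
    rw [h]
    exact real_inner_self_nonneg
  have hK0 : ∀ t, 0 ≤ K t := fun t => real_inner_self_nonneg
  -- the innovation at time `t + 1` is `U t + c (t + 1) • E t + W (t + 1)`
  set p : ℕ → H := fun t =>
    (P t).starProjection (X (t + 1)) + c (t + 1) • (P t).starProjection (V t) with hp
  have hpP : ∀ t, p t ∈ P t := fun t => Submodule.add_mem _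
    (Submodule.starProjection_apply_mem _ _)
    (Submodule.smul_mem _ _ (Submodule.starProjection_apply_mem _ _))
  set I : ℕ → H := fun t => U t + c (t + 1) • E t + W (t + 1) with hI
  have hYI : ∀ t < n, Y (t + 1) - p t = I t := by
    intro t ht
    rw [hY t ht, hV t ht, hp, hI, hU, hE]
    simp only [smul_sub]
    abel
  have hEW : ∀ t < n, ⟪E t, W (t + 1)⟫_ℝ = 0 := fun t ht => by
    rw [real_inner_comm]; exact hWE t ht
  have hUW : ∀ t < n, ⟪U t, W (t + 1)⟫_ℝ = 0 := fun t ht => by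
    rw [real_inner_comm]; exact hWU t ht
  have hUE : ∀ t, ⟪U t, E t⟫_ℝ = Λ (t + 1) * K t := fun t => (hΛK t).symm
  have hEU : ∀ t, ⟪E t, U t⟫_ℝ = Λ (t + 1) * K t := fun t => by
    rw [real_inner_comm]; exact hUE t
  have hEE : ∀ t, ⟪E t, E t⟫_ℝ = K t := fun t => rfl
  have hEI : ∀ t < n, ⟪E t, I t⟫_ℝ = (Λ (t + 1) + c (t + 1)) * K t := by
    intro t ht
    simp only [hI, inner_add_right, inner_smul_right, hEU, hEW t ht, hEE]
    ring
  have hWI : ∀ t < n, ⟪W (t + 1), I t⟫_ℝ = KW (t + 1) := by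
    intro t ht
    simp only [hI, inner_add_right, inner_smul_right, hWU t ht, hWE t ht, hWW t ht]
    ring
  have hII : ∀ t < n, ⟪I t, I t⟫_ℝ
      = innovVar (c (t + 1)) (KW (t + 1)) (K t) (Λ (t + 1)) (KZ (t + 1)) := by
    intro t ht
    have h : ⟪U t, I t⟫_ℝ = Λ (t + 1) ^ 2 * K t + KZ (t + 1) + c (t + 1) * (Λ (t + 1) * K t) := by
      simp only [hI, inner_add_right, inner_smul_right, hUU, hUE, hUW t ht]
      ring
    have h2 : ⟪I t, I t⟫_ℝ
        = ⟪U t, I t⟫_ℝ + c (t + 1) * ⟪E t, I t⟫_ℝ + ⟪W (t + 1), I t⟫_ℝ := by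
      conv_lhs => rw [hI]
      simp only [inner_add_left, inner_smul_left, RCLike.conj_to_real]
      rfl
    rw [h2, h, hEI t ht, hWI t ht]
    unfold innovVar
    ring
  have hric : ∀ t ≤ n, riccati c KW Λ KZ t = K t := by
    intro t
    induction t with
    | zero =>
      intro _
      have h0 : V 0 ∈ P 0 := by
        refine (Submodule.span_le.2 ?_) hV0
        simpa using hone 0
      have : E 0 = 0 := by
        rw [hE]
        simp only
        rw [Submodule.starProjection_eq_self_iff.2 h0, sub_self]
      rw [← hEE, this, inner_zero_left]
      rfl
    | succ t ih =>
      intro ht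
      have ht' : t < n := ht
      rw [riccati_succ, ih ht'.le]
      set S := innovVar (c (t + 1)) (KW (t + 1)) (K t) (Λ (t + 1)) (KZ (t + 1)) with hS
      have hSpos : 0 < S := innovVar_pos (hKW t ht') (hK0 t) (hKZ0 t)
      set M := (KW (t + 1) + c (t + 1) * K t * (Λ (t + 1) + c (t + 1))) / S with hM
      have hMS : M * S = KW (t + 1) + c (t + 1) * K t * (Λ (t + 1) + c (t + 1)) :=
        div_mul_cancel₀ _ hSpos.ne'
      -- the residual of `V (t + 1)` on the span of the outputs up to time `t + 1`
      set E' : H := c (t + 1) • E t + W (t + 1) - M • I t with hE'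
      have hE'P : ∀ q ∈ P t, ⟪E', q⟫_ℝ = 0 := by
        intro q hq
        simp only [hE', hI, inner_sub_left, inner_add_left, inner_smul_left, hEP t q hq,
          hWP t ht' q hq, hUP t q hq]
        ring
      have hE'I : ⟪E', I t⟫_ℝ = 0 := by
        simp only [hE', inner_sub_left, inner_add_left, inner_smul_left, hEI t ht', hWI t ht',
          hII t ht', RCLike.conj_to_real, ← hS]
        rw [hMS]
        ring
      have hYmem' : Y (t + 1) ∈ P (t + 1) := hYmem _ t (by omega)
      have hImem : I t ∈ P (t + 1) := by
        rw [← hYI t ht']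
        exact Submodule.sub_mem _ hYmem' (hmono t (hpP t))
      have hEeq : E (t + 1) = E' := by
        have h1 : V (t + 1) - E' ∈ P (t + 1) := by
          have h2 : V (t + 1) - E' = c (t + 1) • (P t).starProjection (V t) + M • I t := by
            rw [hV t ht', hE', hE]
            simp only [smul_sub]
            abel
          rw [h2]
          exact Submodule.add_mem _ (Submodule.smul_mem _ _
            (hmono t (Submodule.starProjection_apply_mem _ _))) (Submodule.smul_mem _ _ hImem)
        have h2 : E' ∈ (P (t + 1))ᗮ := by
          have h3 : P (t + 1) ≤ (ℝ ∙ E')ᗮ := by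
            refine hPle _ _ ?_ fun s hs => ?_
            · exact Submodule.mem_orthogonal_singleton_iff_inner_right.2 (hE'P _ (hone t))
            · refine Submodule.mem_orthogonal_singleton_iff_inner_right.2 ?_
              rcases Nat.lt_succ_iff_lt_or_eq.1 hs with hs | rfl
              · exact hE'P _ (hYmem t s hs)
              · have : Y (s + 1) = I s + p s := by rw [← hYI s ht']; abel
                rw [this, inner_add_right, hE'I, hE'P _ (hpP s), add_zero]
          refine (Submodule.mem_orthogonal' _ _).2 fun q hq => ?_
          exact Submodule.mem_orthogonal_singleton_iff_inner_right.1 (h3 hq)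
        have h4 : (P (t + 1)).starProjection (V (t + 1)) = V (t + 1) - E' :=
          Submodule.eq_starProjection_of_mem_orthogonal h1 (by simpa using h2)
        rw [hE]
        simp only
        rw [h4]
        abel
      rw [← hEE (t + 1), hEeq]
      have h5 : ⟪E', E'⟫_ℝ = c (t + 1) * ⟪E', E t⟫_ℝ + ⟪E', W (t + 1)⟫_ℝ := by
        conv_lhs => rw [hE', inner_sub_right, inner_add_right, inner_smul_right, inner_smul_right,
          ← hE', hE'I]
        ring
      have h6 : ⟪E', E t⟫_ℝ = c (t + 1) * K t - M * ((Λ (t + 1) + c (t + 1)) * K t) := by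
        rw [hE', inner_sub_left, inner_add_left, inner_smul_left, inner_smul_left, hWE t ht',
          real_inner_comm, real_inner_comm (E t) (I t), hEI t ht', hEE]
        simp
      have h7 : ⟪E', W (t + 1)⟫_ℝ = KW (t + 1) - M * KW (t + 1) := by
        rw [hE', inner_sub_left, inner_add_left, inner_smul_left, inner_smul_left, hEW t ht',
          hWW t ht', real_inner_comm (W (t + 1)) (I t), hWI t ht']
        simp
      rw [h5, h6, h7]
      have h8 : (KW (t + 1) + c (t + 1) * K t * (Λ (t + 1) + c (t + 1))) ^ 2 / S
          = M * (KW (t + 1) + c (t + 1) * K t * (Λ (t + 1) + c (t + 1))) := by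
        rw [hM]; ring
      rw [h8]
      ring
  refine ⟨Λ, KZ, fun t _ => hKZ0 t, fun t ht => ?_, fun t ht => ⟨p t, hpP t, ?_⟩⟩
  · rw [hric t ht.le, ← hUU]
    have h1 : ⟪X (t + 1), X (t + 1)⟫_ℝ = ⟪U t, U t⟫_ℝ
        + ⟪(P t).starProjection (X (t + 1)), (P t).starProjection (X (t + 1))⟫_ℝ := by
      have h2 : X (t + 1) = U t + (P t).starProjection (X (t + 1)) := by simp [hU]
      have h3 := hUP t _ (Submodule.starProjection_apply_mem (P t) (X (t + 1)))
      conv_lhs => rw [h2]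
      rw [inner_add_left, inner_add_right, inner_add_right, h3,
        real_inner_comm (U t) ((P t).starProjection (X (t + 1))), h3]
      ring
    rw [h1]
    exact le_add_of_nonneg_right real_inner_self_nonneg
  · rw [hric t ht.le, hYI t ht, hII t ht]

end Hilbert

/-! ### The converse for processes -/

section Converse

open scoped InnerProductSpace

variable {Ω : Type*} {mΩ : MeasurableSpace Ω} {μ : Measure Ω}

open Classical in
/-- The class in `L²` of a square integrable function; zero for other functions. -/
noncomputable def toL2 (μ : Measure Ω) (f : Ω → ℝ) : Lp ℝ 2 μ :=
  if h : MemLp f 2 μ then h.toLp f else 0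

theorem toL2_of_memLp {f : Ω → ℝ} (h : MemLp f 2 μ) : toL2 μ f = h.toLp f := dif_pos h

theorem inner_toL2 {f g : Ω → ℝ} (hf : MemLp f 2 μ) (hg : MemLp g 2 μ) :
    ⟪toL2 μ f, toL2 μ g⟫_ℝ = ∫ ω, f ω * g ω ∂μ := by
  rw [toL2_of_memLp hf, toL2_of_memLp hg, L2.inner_def]
  refine integral_congr_ae ?_
  filter_upwards [hf.coeFn_toLp, hg.coeFn_toLp] with ω h1 h2
  rw [h1, h2]
  simp [mul_comm]

theorem toL2_add {f g : Ω → ℝ} (hf : MemLp f 2 μ) (hg : MemLp g 2 μ) :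
    toL2 μ (fun ω => f ω + g ω) = toL2 μ f + toL2 μ g := by
  rw [toL2_of_memLp hf, toL2_of_memLp hg, toL2_of_memLp (f := fun ω => f ω + g ω) (hf.add hg)]
  exact MemLp.toLp_add hf hg

theorem toL2_const_mul (a : ℝ) {f : Ω → ℝ} (hf : MemLp f 2 μ) :
    toL2 μ (fun ω => a * f ω) = a • toL2 μ f := by
  rw [toL2_of_memLp hf, toL2_of_memLp (hf.const_mul a)]
  exact MemLp.toLp_const_smul a hf

theorem toL2_sum {ι : Type*} (s : Finset ι) {f : ι → Ω → ℝ} (hf : ∀ i ∈ s, MemLp (f i) 2 μ) :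
    toL2 μ (fun ω => ∑ i ∈ s, f i ω) = ∑ i ∈ s, toL2 μ (f i) := by
  classical
  induction s using Finset.induction_on with
  | empty =>
    simp only [Finset.sum_empty]
    rw [toL2_of_memLp MemLp.zero']
    exact MemLp.toLp_zero _
  | insert i s hi ih =>
    have h1 := fun j (hj : j ∈ s) => hf j (Finset.mem_insert_of_mem hj)
    simp only [Finset.sum_insert hi]
    rw [← ih h1]
    exact toL2_add (hf i (Finset.mem_insert_self i s)) (memLp_finsetSum s h1)

namespace FeedbackProcess

variable {n : ℕ} {c KW : ℕ → ℝ} {v₀ : ℝ} {W V X Y : ℕ → Ω → ℝ}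

theorem measurable_V (h : FeedbackProcess μ n c KW v₀ W V X Y) :
    ∀ t ≤ n, Measurable (V t) := by
  intro t
  induction t with
  | zero => intro _; rw [h.noise_zero]; exact measurable_const
  | succ t ih =>
    intro ht
    rw [h.noise_succ t ht]
    exact ((ih (by omega)).const_mul _).add (h.measurable_W t ht)

theorem measurable_Y (h : FeedbackProcess μ n c KW v₀ W V X Y) :
    ∀ t < n, Measurable (Y (t + 1)) := by
  intro t ht
  rw [h.output t ht]
  exact (h.measurable_X t ht).add (h.measurable_V (t + 1) ht)

theorem memLp_W (h : FeedbackProcess μ n c KW v₀ W V X Y) :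
    ∀ t < n, MemLp (W (t + 1)) 2 μ := by
  intro t ht
  have h1 : MemLp id 2 (μ.map (W (t + 1))) := by
    rw [h.law_W t ht]; exact memLp_id_gaussianReal 2
  exact (memLp_map_measure_iff (by fun_prop) (h.measurable_W t ht).aemeasurable).1 h1

theorem memLp_V [IsProbabilityMeasure μ] (h : FeedbackProcess μ n c KW v₀ W V X Y) :
    ∀ t ≤ n, MemLp (V t) 2 μ := by
  intro t
  induction t with
  | zero => intro _; rw [h.noise_zero]; exact memLp_const v₀
  | succ t ih =>
    intro ht
    rw [h.noise_succ t ht]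
    exact ((ih (by omega)).const_mul _).add (h.memLp_W t ht)

theorem integral_W (h : FeedbackProcess μ n c KW v₀ W V X Y) :
    ∀ t < n, ∫ ω, W (t + 1) ω ∂μ = 0 := by
  intro t ht
  have h1 := integral_map (h.measurable_W t ht).aemeasurable (μ := μ)
    (aestronglyMeasurable_id (α := ℝ))
  rw [h.law_W t ht] at h1
  simpa using h1.symm

theorem integral_W_sq (h : FeedbackProcess μ n c KW v₀ W V X Y) (hKW : ∀ t < n, 0 < KW (t + 1)) :
    ∀ t < n, ∫ ω, W (t + 1) ω * W (t + 1) ω ∂μ = KW (t + 1) := by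
  intro t ht
  have h1 := integral_map (h.measurable_W t ht).aemeasurable (μ := μ)
    (f := fun x : ℝ => x * x) (by fun_prop)
  rw [← h1, h.law_W t ht]
  have h2 := variance_id_gaussianReal (μ := 0) (v := (KW (t + 1)).toNNReal)
  rw [variance_of_integral_eq_zero (by fun_prop) (by simp)] at h2
  simpa [(hKW t ht).le, sq] using h2

/-- The noise increment is orthogonal to every function of the inputs up to the same time and of
the past outputs. -/
theorem integral_W_mul (h : FeedbackProcess μ n c KW v₀ W V X Y) {t : ℕ} (ht : t < n)
    {g : (Fin (t + 1) → ℝ) × (Fin t → ℝ) → ℝ} (hg : Measurable g) :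
    ∫ ω, W (t + 1) ω
      * g ((fun i : Fin (t + 1) => X (i + 1) ω), (fun i : Fin t => Y (i + 1) ω)) ∂μ = 0 := by
  have hm : Measurable (fun ω => ((fun i : Fin (t + 1) => X (i + 1) ω),
      (fun i : Fin t => Y (i + 1) ω))) :=
    (measurable_pi_lambda _ fun i : Fin (t + 1) => h.measurable_X i (by omega)).prodMk
      (measurable_pi_lambda _ fun i : Fin t => h.measurable_Y i (by omega))
  have h1 := (h.indep t ht).comp measurable_id hg
  have h2 := h1.integral_fun_mul_eq_mul_integral
    (h.measurable_W t ht).aestronglyMeasurable (hg.comp hm).aestronglyMeasurable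
  simp only [Function.comp_def, id] at h2
  rw [h2, h.integral_W t ht, zero_mul]

/-- Every feedback process with square integrable inputs has the second order characteristics of a
feasible choice of parameters: the powers are at least as large, and the outputs have affine
predictors whose mean square errors are the innovations variances. -/
theorem exists_params [IsProbabilityMeasure μ] (h : FeedbackProcess μ n c KW v₀ W V X Y)
    (hKW : ∀ t < n, 0 < KW (t + 1)) (hX : ∀ t < n, MemLp (X (t + 1)) 2 μ) :
    ∃ Λ KZ : ℕ → ℝ, (∀ t < n, 0 ≤ KZ (t + 1)) ∧
      (∀ t < n, Λ (t + 1) ^ 2 * riccati c KW Λ KZ t + KZ (t + 1) ≤ ∫ ω, X (t + 1) ω ^ 2 ∂μ) ∧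
      ∃ φ : (t : ℕ) → (Fin t → ℝ) → ℝ, (∀ t, Measurable (φ t)) ∧ ∀ t < n,
        MemLp (fun ω => Y (t + 1) ω - φ t (fun i : Fin t => Y (i + 1) ω)) 2 μ ∧
        ∫ ω, (Y (t + 1) ω - φ t (fun i : Fin t => Y (i + 1) ω)) ^ 2 ∂μ
        = innovVar (c (t + 1)) (KW (t + 1)) (riccati c KW Λ KZ t) (Λ (t + 1)) (KZ (t + 1)) := by
  have hV := h.memLp_V
  have hW := h.memLp_W
  have hY : ∀ t < n, MemLp (Y (t + 1)) 2 μ := by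
    intro t ht
    rw [h.output t ht]
    exact (hX t ht).add (hV (t + 1) ht)
  have hone : MemLp (fun _ : Ω => (1 : ℝ)) 2 μ := memLp_const 1
  obtain ⟨Λ, KZ, h1, h2, h3⟩ := exists_params_of_orthogonal (n := n) (c := c) hKW
    (toL2 μ fun _ => 1) (fun t => toL2 μ (X t)) (fun t => toL2 μ (Y t)) (fun t => toL2 μ (V t))
    (fun t => toL2 μ (W t))
    (by
      refine Submodule.mem_span_singleton.2 ⟨v₀, ?_⟩
      rw [← toL2_const_mul v₀ hone, h.noise_zero]
      simp)
    (fun t ht => by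
      rw [h.noise_succ t ht, toL2_add ((hV t ht.le).const_mul _) (hW t ht),
        toL2_const_mul _ (hV t ht.le)])
    (fun t ht => by rw [h.output t ht, toL2_add (hX t ht) (hV (t + 1) ht)])
    (fun t ht => by
      rw [inner_toL2 (hW t ht) hone]
      exact h.integral_W_mul ht (g := fun _ => 1) measurable_const)
    (fun t ht s hs => by
      rw [inner_toL2 (hW t ht) (hX s (by omega))]
      exact h.integral_W_mul ht (g := fun p => p.1 ⟨s, by omega⟩) (by fun_prop))
    (fun t ht s hs => by
      rw [inner_toL2 (hW t ht) (hY s (by omega))]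
      exact h.integral_W_mul ht (g := fun p => p.2 ⟨s, hs⟩) (by fun_prop))
    (fun t ht => by rw [inner_toL2 (hW t ht) (hW t ht), h.integral_W_sq hKW t ht])
  refine ⟨Λ, KZ, h1, fun t ht => ?_, ?_⟩
  · have := h2 t ht
    rw [inner_toL2 (hX t ht) (hX t ht)] at this
    simpa only [sq] using this
  have h4 : ∀ t, ∃ φ : (Fin t → ℝ) → ℝ, Measurable φ ∧ (t < n →
      MemLp (fun ω => Y (t + 1) ω - φ (fun i : Fin t => Y (i + 1) ω)) 2 μ ∧
      ∫ ω, (Y (t + 1) ω - φ (fun i : Fin t => Y (i + 1) ω)) ^ 2 ∂μ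
      = innovVar (c (t + 1)) (KW (t + 1)) (riccati c KW Λ KZ t) (Λ (t + 1)) (KZ (t + 1))) := by
    intro t
    by_cases ht : t < n
    swap
    · exact ⟨fun _ => 0, measurable_const, fun h => absurd h ht⟩
    obtain ⟨p, hp, hpe⟩ := h3 t ht
    obtain ⟨a₀, z, hz, rfl⟩ := Submodule.mem_span_insert.1 hp
    obtain ⟨a, rfl⟩ := (Submodule.mem_span_range_iff_exists_fun ℝ).1 hz
    have hYi : ∀ i : Fin t, MemLp (Y (i + 1)) 2 μ := fun i => hY i (by omega)
    have hs : MemLp (fun ω => ∑ i : Fin t, a i * Y (i + 1) ω) 2 μ :=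
      memLp_finsetSum _ fun i _ => (hYi i).const_mul (a i)
    have hp' : MemLp (fun ω => a₀ * 1 + ∑ i : Fin t, a i * Y (i + 1) ω) 2 μ :=
      (hone.const_mul a₀).add hs
    have hr : MemLp (fun ω => Y (t + 1) ω - (a₀ * 1 + ∑ i : Fin t, a i * Y (i + 1) ω)) 2 μ :=
      (hY t ht).sub hp'
    have hpeq : toL2 μ (fun ω => a₀ * 1 + ∑ i : Fin t, a i * Y (i + 1) ω)
        = a₀ • toL2 μ (fun _ => 1) + ∑ i : Fin t, a i • toL2 μ (Y (i + 1)) := by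
      rw [toL2_add (hone.const_mul a₀) hs, toL2_const_mul a₀ hone,
        toL2_sum _ fun i _ => (hYi i).const_mul (a i)]
      congr 1
      exact Finset.sum_congr rfl fun i _ => toL2_const_mul (a i) (hYi i)
    have hreq : toL2 μ (fun ω => Y (t + 1) ω - (a₀ * 1 + ∑ i : Fin t, a i * Y (i + 1) ω))
        = toL2 μ (Y (t + 1))
          - toL2 μ (fun ω => a₀ * 1 + ∑ i : Fin t, a i * Y (i + 1) ω) := by
      rw [eq_sub_iff_add_eq, ← toL2_add hr hp']
      simp
    rw [← hpeq, ← hreq, inner_toL2 hr hr] at hpe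
    refine ⟨fun y => a₀ * 1 + ∑ i : Fin t, a i * y i, by fun_prop, fun _ => ⟨hr, ?_⟩⟩
    simpa only [sq] using hpe
  choose φ hφ hφ2 using h4
  exact ⟨φ, hφ, hφ2⟩

end FeedbackProcess

variable {n : ℕ} {c KW : ℕ → ℝ} {κ : ℝ}

/-- The entropy of the noise does not depend on the strategy. -/
theorem entropy_noiseLaw (hKW : ∀ t < n, 0 < KW (t + 1)) (P : Strategy) (v₀ : ℝ) :
    HasFiniteEntropy (noiseLaw c KW P v₀ n) ∧ differentialEntropy (noiseLaw c KW P v₀ n)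
      = ∑ t ∈ Finset.range n, (1 / 2 * Real.log (2 * Real.pi * KW (t + 1)) + 1 / 2) := by
  have hφ : ∀ t, Measurable
      (fun v : Fin t → ℝ => c (t + 1) * noiseAt v₀ ((0, v) : Hist t)) := fun t =>
    ((measurable_noiseAt_right v₀ t).comp (f := fun v : Fin t → ℝ => ((0, v) : Hist t))
      (by fun_prop)).const_mul _
  rw [noiseLaw_eq_triLaw]
  have := isProbabilityMeasure_triLaw hφ KW n
  refine ⟨?_, differentialEntropy_triLaw hφ hKW⟩
  obtain ⟨B, hB⟩ := exists_triLaw_le hφ hKW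
  refine (entropy_le_of_density _ hB (measurable_triDens hφ KW n) (triDens_pos hKW) ?_
    (integral_log_triDens hφ hKW).1).1
  rw [← triLaw_eq_withDensity hφ hKW]
  exact this

/-- The converse: the pay-off of an admissible strategy is at most the rate of some feasible
parameters. -/
theorem exists_paramRate_ge (hKW : ∀ t < n, 0 < KW (t + 1)) {P : Strategy} {v₀ : ℝ}
    (hP : PowerAdmissible c KW P v₀ n κ) :
    HasFiniteEntropy (outputLaw c KW P v₀ n) ∧
    ∃ Λ KZ : ℕ → ℝ, ParamFeasible c KW n κ Λ KZ ∧
      payoff c KW P v₀ n ≤ paramRate c KW n Λ KZ := by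
  have hproc := feedbackProcess_jointLaw c KW P v₀ n
  have hX : ∀ t < n, MemLp (fun h : Hist n => coordAt (t + 1) h.1) 2 (jointLaw c KW P v₀ n) := by
    intro t ht
    simp only [coordAt_succ ht]
    exact (memLp_two_iff_integrable_sq (by fun_prop)).2 (hP.1 ⟨t, ht⟩)
  obtain ⟨Λ, KZ, hKZ, hpow, φ, hφ, hI⟩ := hproc.exists_params hKW hX
  set S : ℕ → ℝ := fun t => innovVar (c t) (KW t) (riccati c KW Λ KZ (t - 1)) (Λ t) (KZ t) with hSd
  have hS : ∀ t < n, 0 < S (t + 1) := fun t ht =>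
    innovVar_pos (hKW t ht) (riccati_nonneg hKW hKZ t ht.le) (hKZ t ht)
  have hlog : ∀ h : Hist n, Real.log (triDens φ S n h.2)
      = ∑ t ∈ Finset.range n, (-(1 / 2 * Real.log (2 * Real.pi * S (t + 1)))
          - (coordAt (t + 1) h.2 - φ t (fun i : Fin t => coordAt (i + 1) h.2)) ^ 2
            / (2 * S (t + 1))) := by
    intro h
    rw [← log_triDens hS fun t => coordAt t h.2]
    congr 2
    ext i
    rw [coordAt_succ i.2]
  have hint : ∀ t ∈ Finset.range n, Integrable (fun h : Hist n =>
      -(1 / 2 * Real.log (2 * Real.pi * S (t + 1)))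
          - (coordAt (t + 1) h.2 - φ t (fun i : Fin t => coordAt (i + 1) h.2)) ^ 2
            / (2 * S (t + 1))) (jointLaw c KW P v₀ n) := by
    intro t ht
    exact (integrable_const _).sub ((hI t (Finset.mem_range.1 ht)).1.integrable_sq.div_const _)
  have hprob := isProbabilityMeasure_outputLaw c KW P v₀ n
  have hmlog : Measurable (fun y => Real.log (triDens φ S n y)) := (measurable_triDens hφ S n).log
  -- Gibbs' inequality against the Gaussian law with the affine predictors `φ` and the variances `S`
  obtain ⟨B, hB⟩ := exists_outputLaw_le c KW P v₀ hKW
  have hent := entropy_le_of_density _ hB (measurable_triDens hφ S n) (triDens_pos hS)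
    (by rw [← triLaw_eq_withDensity hφ hS]; exact isProbabilityMeasure_triLaw hφ S n)
    (by
      rw [outputLaw, integrable_map_measure hmlog.aestronglyMeasurable (by fun_prop)]
      refine (integrable_finsetSum _ hint).congr (Filter.Eventually.of_forall fun h => ?_)
      exact (hlog h).symm)
  refine ⟨hent.1, Λ, KZ, ⟨hKZ, ?_⟩, ?_⟩
  · refine le_trans ?_ hP.2
    refine mul_le_mul_of_nonneg_left ?_ (by positivity)
    rw [← Fin.sum_univ_eq_sum_range
      (fun t => Λ (t + 1) ^ 2 * riccati c KW Λ KZ t + KZ (t + 1)) n]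
    refine Finset.sum_le_sum fun i _ => (hpow i i.2).trans_eq ?_
    simp only [coordAt_succ i.2]
  · have h1 : -∫ y, Real.log (triDens φ S n y) ∂(outputLaw c KW P v₀ n)
        = ∑ t ∈ Finset.range n, (1 / 2 * Real.log (2 * Real.pi * S (t + 1)) + 1 / 2) := by
      rw [outputLaw, integral_map (by fun_prop) hmlog.aestronglyMeasurable]
      simp_rw [hlog]
      rw [integral_finsetSum _ hint, ← Finset.sum_neg_distrib]
      refine Finset.sum_congr rfl fun t ht => ?_
      have ht' := Finset.mem_range.1 ht
      rw [integral_sub (integrable_const _) ((hI t ht').1.integrable_sq.div_const _),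
        integral_div, (hI t ht').2]
      have hSt : innovVar (c (t + 1)) (KW (t + 1)) (riccati c KW Λ KZ t) (Λ (t + 1)) (KZ (t + 1))
        = S (t + 1) := rfl
      have hpos := hS t ht'
      rw [hSt]
      simp
      field_simp
      ring
    have h2 := hent.2
    rw [h1] at h2
    rw [payoff, (entropy_noiseLaw hKW P v₀).2, ← sum_log_sub_eq_paramRate hKW hKZ]
    exact sub_le_sub_right h2 _

end Converse

/-! ### Independence, conditional expectations and Gaussian laws -/

section Probability

variable {Ω : Type*} {mΩ : MeasurableSpace Ω} {μ : Measure Ω}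

/-- If `A ⟂ B` and `(A, B) ⟂ C` then `A ⟂ (B, C)`. -/
theorem indepFun_prodMk_of_prodMk {α β γ : Type*} [MeasurableSpace α] [MeasurableSpace β]
    [MeasurableSpace γ] [IsProbabilityMeasure μ] {A : Ω → α} {B : Ω → β} {C : Ω → γ}
    (hA : AEMeasurable A μ) (hB : AEMeasurable B μ) (hC : AEMeasurable C μ)
    (hAB : IndepFun A B μ) (h : IndepFun (fun ω => (A ω, B ω)) C μ) :
    IndepFun A (fun ω => (B ω, C ω)) μ := by
  have := Measure.isProbabilityMeasure_map hA
  have := Measure.isProbabilityMeasure_map hB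
  have := Measure.isProbabilityMeasure_map hC
  have hBC : IndepFun B C μ := h.comp measurable_snd measurable_id
  rw [indepFun_iff_map_prod_eq_prod_map_map hA (hB.prodMk hC), hBC.map_prod_eq_prod_map_map hB hC,
    ← Measure.prodAssoc_prod, ← hAB.map_prod_eq_prod_map_map hA hB,
    ← h.map_prod_eq_prod_map_map (hA.prodMk hB) hC,
    AEMeasurable.map_map_of_aemeasurable (by fun_prop) ((hA.prodMk hB).prodMk hC)]
  rfl

/-- The conditional mean of `f(Y) + R` given `Y`, for `R` centred and independent of `Y`. -/
theorem condExp_comap_eq_of_indepFun {β : Type*} [MeasurableSpace β] [IsProbabilityMeasure μ]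
    {Y : Ω → β} (hY : Measurable Y) {U R : Ω → ℝ} {f : β → ℝ} (hf : Measurable f)
    (hU : Integrable U μ) (hRi : Integrable R μ) (hR : Measurable R)
    (hUeq : U =ᵐ[μ] fun ω => f (Y ω) + R ω) (hR0 : ∫ ω, R ω ∂μ = 0) (hind : IndepFun R Y μ) :
    condExp (MeasurableSpace.comap Y inferInstance) μ U =ᵐ[μ] fun ω => f (Y ω) := by
  have hle : MeasurableSpace.comap Y inferInstance ≤ mΩ := hY.comap_le
  have hfi : Integrable (fun ω => f (Y ω)) μ := by
    refine (hU.sub hRi).congr ?_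
    filter_upwards [hUeq] with ω h
    simp [h]
  have h1 := condExp_congr_ae (m := MeasurableSpace.comap Y inferInstance) hUeq
  have h2 := condExp_add hfi hRi (MeasurableSpace.comap Y inferInstance)
  have h3 : condExp (MeasurableSpace.comap Y inferInstance) μ (fun ω => f (Y ω))
      = fun ω => f (Y ω) :=
    condExp_of_stronglyMeasurable hle
      (hf.comp (comap_measurable Y)).stronglyMeasurable hfi
  have h4 := condExp_indep_eq (μ := μ) (f := R) hR.comap_le hle
    (comap_measurable R).stronglyMeasurable ((IndepFun_iff_Indep _ _ _).1 hind)
  filter_upwards [h1, h2, h4] with ω e1 e2 e4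
  rw [e1]
  change condExp _ μ ((fun ω => f (Y ω)) + R) ω = _
  rw [e2, Pi.add_apply, h3, e4, hR0, add_zero]

theorem memLp_two_of_law {X : Ω → ℝ} {v : NNReal} (hX : AEMeasurable X μ)
    (h : μ.map X = gaussianReal 0 v) : MemLp X 2 μ := by
  refine (memLp_map_measure_iff (g := id) (by fun_prop) hX).1 ?_
  rw [h]; exact memLp_id_gaussianReal 2

theorem integral_of_law {X : Ω → ℝ} {v : NNReal} (hX : AEMeasurable X μ)
    (h : μ.map X = gaussianReal 0 v) : ∫ ω, X ω ∂μ = 0 := by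
  have h1 := integral_map hX (aestronglyMeasurable_id (α := ℝ))
  rw [h] at h1
  simpa using h1.symm

theorem integral_sq_of_law {X : Ω → ℝ} {v : ℝ} (hv : 0 ≤ v) (hX : AEMeasurable X μ)
    (h : μ.map X = gaussianReal 0 v.toNNReal) : ∫ ω, X ω ^ 2 ∂μ = v := by
  have h1 := integral_map (μ := μ) hX (f := fun x : ℝ => x ^ 2) (by fun_prop)
  rw [← h1, h]
  have h2 := variance_id_gaussianReal (μ := 0) (v := v.toNNReal)
  rw [variance_of_integral_eq_zero (by fun_prop) (by simp)] at h2
  simpa [hv] using h2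

theorem hasGaussianLaw_of_law {X : Ω → ℝ} {v : NNReal} (h : μ.map X = gaussianReal 0 v) :
    HasGaussianLaw X μ := ⟨by rw [h]; infer_instance⟩

theorem covariance_self_of_law {X : Ω → ℝ} {v : ℝ} (hv : 0 ≤ v) (hX : AEMeasurable X μ)
    (h : μ.map X = gaussianReal 0 v.toNNReal) : cov[X, X; μ] = v := by
  rw [covariance_self hX, variance_of_integral_eq_zero hX (integral_of_law hX h),
    integral_sq_of_law hv hX h]

/-- One step of the Kalman filter for scalar Gaussian variables: with `I = (Λ + c) E + Z + W` and
the gain `M`, the variable `c E + W - M I` is uncorrelated with `I`, hence independent of it,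
and its variance is given by the Riccati map. -/
theorem gaussian_update [IsProbabilityMeasure μ] {E Z W : Ω → ℝ} {K KZ KW : ℝ} (hK : 0 ≤ K)
    (hKZ : 0 ≤ KZ) (hKW : 0 < KW) (hEm : AEMeasurable E μ) (hZm : AEMeasurable Z μ)
    (hWm : AEMeasurable W μ) (hE : μ.map E = gaussianReal 0 K.toNNReal)
    (hZ : μ.map Z = gaussianReal 0 KZ.toNNReal) (hW : μ.map W = gaussianReal 0 KW.toNNReal)
    (hEZW : IndepFun E (fun ω => (Z ω, W ω)) μ) (hZW : IndepFun Z W μ) (c Λ : ℝ) :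
    let I := fun ω => (Λ + c) * E ω + Z ω + W ω
    let E' := fun ω => c * E ω + W ω - gainM c KW K Λ KZ * I ω
    IndepFun E' I μ ∧ μ.map I = gaussianReal 0 (innovVar c KW K Λ KZ).toNNReal ∧
      μ.map E' = gaussianReal 0 (c ^ 2 * K + KW
        - (KW + c * K * (Λ + c)) ^ 2 / innovVar c KW K Λ KZ).toNNReal := by
  intro I E'
  set M := gainM c KW K Λ KZ with hM
  have hS : 0 < innovVar c KW K Λ KZ := innovVar_pos hKW hK hKZ
  have hMS : M * innovVar c KW K Λ KZ = KW + c * K * (Λ + c) := by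
    rw [hM, gainM, mul_assoc, inv_mul_cancel₀ hS.ne', mul_one]
  have hG := hEZW.hasGaussianLaw (hasGaussianLaw_of_law hE)
    (hZW.hasGaussianLaw (hasGaussianLaw_of_law hZ) (hasGaussianLaw_of_law hW))
  let e : ℝ × ℝ × ℝ →L[ℝ] ℝ := ContinuousLinearMap.fst ℝ ℝ (ℝ × ℝ)
  let z : ℝ × ℝ × ℝ →L[ℝ] ℝ := (ContinuousLinearMap.fst ℝ ℝ ℝ).comp
    (ContinuousLinearMap.snd ℝ ℝ (ℝ × ℝ))
  let w : ℝ × ℝ × ℝ →L[ℝ] ℝ := (ContinuousLinearMap.snd ℝ ℝ ℝ).comp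
    (ContinuousLinearMap.snd ℝ ℝ (ℝ × ℝ))
  have hG2 : HasGaussianLaw (fun ω => (E' ω, I ω)) μ := by
    have h := hG.map_fun ((c • e + w - M • ((Λ + c) • e + z + w)).prod ((Λ + c) • e + z + w))
    refine h.congr (Filter.Eventually.of_forall fun ω => ?_)
    simp [e, z, w, E', I, ← hM]
    ring
  have lE := memLp_two_of_law hEm hE
  have lZ := memLp_two_of_law hZm hZ
  have lW := memLp_two_of_law hWm hW
  have hEZ : cov[E, Z; μ] = 0 :=
    (hEZW.comp measurable_id measurable_fst).covariance_eq_zero lE lZ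
  have hEW : cov[E, W; μ] = 0 :=
    (hEZW.comp measurable_id measurable_snd).covariance_eq_zero lE lW
  have hZW0 : cov[Z, W; μ] = 0 := hZW.covariance_eq_zero lZ lW
  have cE := covariance_self_of_law hK hEm hE
  have cZ := covariance_self_of_law hKZ hZm hZ
  have cW := covariance_self_of_law hKW.le hWm hW
  have l1 : MemLp (fun ω => (Λ + c) * E ω) 2 μ := lE.const_mul _
  have l2 : MemLp ((fun ω => (Λ + c) * E ω) + Z) 2 μ := l1.add lZ
  have lc : MemLp (fun ω => c * E ω) 2 μ := lE.const_mul _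
  have hIeq : I = (fun ω => (Λ + c) * E ω) + Z + W := rfl
  have lI : MemLp I 2 μ := l2.add lW
  have lMI : MemLp (fun ω => M * I ω) 2 μ := lI.const_mul _
  have hE'eq : E' = (fun ω => c * E ω) + W - (fun ω => M * I ω) := rfl
  have lE' : MemLp E' 2 μ := (lc.add lW).sub lMI
  have cEI : cov[E, I; μ] = (Λ + c) * K := by
    rw [hIeq, covariance_add_right lE l2 lW, covariance_add_right lE l1 lZ,
      covariance_const_mul_right, cE, hEZ, hEW]
    ring
  have cZI : cov[Z, I; μ] = KZ := by
    rw [hIeq, covariance_add_right lZ l2 lW, covariance_add_right lZ l1 lZ,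
      covariance_const_mul_right, cZ, covariance_comm Z E, hEZ, hZW0]
    ring
  have cWI : cov[W, I; μ] = KW := by
    rw [hIeq, covariance_add_right lW l2 lW, covariance_add_right lW l1 lZ,
      covariance_const_mul_right, cW, covariance_comm W E, hEW, covariance_comm W Z, hZW0]
    ring
  have cII : cov[I, I; μ] = innovVar c KW K Λ KZ := by
    conv_lhs => enter [1]; rw [hIeq]
    rw [covariance_add_left l2 lW lI, covariance_add_left l1 lZ lI, covariance_const_mul_left, cEI,
      cZI, cWI, innovVar]
    ring
  have cE'I : cov[E', I; μ] = 0 := by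
    rw [hE'eq, covariance_sub_left (lc.add lW) lMI lI, covariance_add_left lc lW lI,
      covariance_const_mul_left, covariance_const_mul_left, cEI, cWI, cII, hMS]
    ring
  have cE'E : cov[E', E; μ] = c * K - M * ((Λ + c) * K) := by
    rw [hE'eq, covariance_sub_left (lc.add lW) lMI lE, covariance_add_left lc lW lE,
      covariance_const_mul_left, covariance_const_mul_left, cE, covariance_comm W E, hEW,
      covariance_comm I E, cEI]
    ring
  have cE'W : cov[E', W; μ] = KW - M * KW := by
    rw [hE'eq, covariance_sub_left (lc.add lW) lMI lW, covariance_add_left lc lW lW,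
      covariance_const_mul_left, covariance_const_mul_left, cW, hEW, covariance_comm I W, cWI]
    ring
  have cE'E' : cov[E', E'; μ] = c ^ 2 * K + KW
      - (KW + c * K * (Λ + c)) ^ 2 / innovVar c KW K Λ KZ := by
    conv_lhs => enter [2]; rw [hE'eq]
    rw [covariance_sub_right lE' (lc.add lW) lMI, covariance_add_right lE' lc lW,
      covariance_const_mul_right, covariance_const_mul_right, cE'E, cE'W, cE'I]
    have h8 : (KW + c * K * (Λ + c)) ^ 2 / innovVar c KW K Λ KZ
        = M * (KW + c * K * (Λ + c)) := by
      rw [hM, gainM]; ring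
    rw [h8]
    ring
  have iE := integral_of_law hEm hE
  have iZ := integral_of_law hZm hZ
  have iW := integral_of_law hWm hW
  have iI : ∫ ω, I ω ∂μ = 0 := by
    have h1 : ∫ ω, ((Λ + c) * E ω + Z ω) ∂μ = 0 := by
      rw [integral_add (l1.integrable one_le_two) (lZ.integrable one_le_two), integral_const_mul,
        iE, iZ]
      simp
    have h2 : ∫ ω, I ω ∂μ = ∫ ω, ((Λ + c) * E ω + Z ω) ∂μ + ∫ ω, W ω ∂μ :=
      integral_add (l2.integrable one_le_two) (lW.integrable one_le_two)
    rw [h2, h1, iW, add_zero]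
  have iE' : ∫ ω, E' ω ∂μ = 0 := by
    have h1 : ∫ ω, E' ω ∂μ = ∫ ω, (c * E ω + W ω) ∂μ - ∫ ω, M * I ω ∂μ :=
      integral_sub ((lc.add lW).integrable one_le_two) (lMI.integrable one_le_two)
    rw [h1, integral_add (lc.integrable one_le_two) (lW.integrable one_le_two),
      integral_const_mul, integral_const_mul, iE, iW, iI]
    simp
  refine ⟨hG2.indepFun_of_covariance_eq_zero cE'I, ?_, ?_⟩
  · rw [hG2.snd.map_eq_gaussianReal, iI, ← covariance_self lI.aemeasurable, cII]
  · rw [hG2.fst.map_eq_gaussianReal, iE', ← covariance_self lE'.aemeasurable, cE'E']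

/-- Affine maps between real vector spaces. -/
def IsAffine {E F : Type*} [AddCommGroup E] [Module ℝ E] [AddCommGroup F] [Module ℝ F]
    (f : E → F) : Prop :=
  ∃ (L : E →ₗ[ℝ] F) (b : F), ∀ x, f x = L x + b

namespace IsAffine

variable {E F G : Type*} [AddCommGroup E] [Module ℝ E] [AddCommGroup F] [Module ℝ F]
  [AddCommGroup G] [Module ℝ G]

theorem const (b : F) : IsAffine (fun _ : E => b) := ⟨0, b, fun x => by simp⟩

theorem linear (L : E →ₗ[ℝ] F) : IsAffine (fun x => L x) := ⟨L, 0, fun x => by simp⟩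

theorem add {f g : E → F} (hf : IsAffine f) (hg : IsAffine g) : IsAffine (fun x => f x + g x) := by
  obtain ⟨L, b, h⟩ := hf
  obtain ⟨L', b', h'⟩ := hg
  exact ⟨L + L', b + b', fun x => by simp only [h, h', LinearMap.add_apply]; abel⟩

theorem const_mul {f : E → ℝ} (a : ℝ) (hf : IsAffine f) : IsAffine (fun x => a * f x) := by
  obtain ⟨L, b, h⟩ := hf
  exact ⟨a • L, a * b, fun x => by simp only [h, LinearMap.smul_apply, smul_eq_mul, mul_add]⟩

theorem sub {f g : E → ℝ} (hf : IsAffine f) (hg : IsAffine g) : IsAffine (fun x => f x - g x) := by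
  have h := hf.add (hg.const_mul (-1))
  simpa [sub_eq_add_neg] using h

theorem comp_linear {f : F → G} (hf : IsAffine f) (L : E →ₗ[ℝ] F) :
    IsAffine (fun x => f (L x)) := by
  obtain ⟨L', b, h⟩ := hf
  exact ⟨L' ∘ₗ L, b, fun x => by simp only [h]; rfl⟩

theorem prodMk {f : E → F} {g : E → G} (hf : IsAffine f) (hg : IsAffine g) :
    IsAffine (fun x => (f x, g x)) := by
  obtain ⟨L, b, h⟩ := hf
  obtain ⟨L', b', h'⟩ := hg
  exact ⟨L.prod L', (b, b'), fun x => by simp only [h, h']; rfl⟩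

theorem pi {ι : Type*} {f : E → ι → ℝ} (hf : ∀ i, IsAffine (fun x => f x i)) : IsAffine f := by
  choose L b h using hf
  exact ⟨LinearMap.pi L, b, fun x => by ext i; simp [h i x]⟩

end IsAffine

theorem hasGaussianLaw_map_isAffine {E F : Type*} [NormedAddCommGroup E]
    [NormedSpace ℝ E] [FiniteDimensional ℝ E] [MeasurableSpace E] [BorelSpace E]
    [NormedAddCommGroup F] [NormedSpace ℝ F] [MeasurableSpace F] [BorelSpace F]
    [SecondCountableTopology F] {X : Ω → E} (hX : HasGaussianLaw X μ) {f : E → F}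
    (hf : IsAffine f) : HasGaussianLaw (fun ω => f (X ω)) μ := by
  obtain ⟨L, b, h⟩ := hf
  set L' : E →L[ℝ] F := LinearMap.toContinuousLinearMap L with hL'
  have hfeq : ∀ x, f x = L' x + b := h
  have hXm := hX.aemeasurable
  refine ⟨isGaussian_of_map_eq_gaussianReal fun l => ?_⟩
  have h1 := (hX.map_fun (l.comp L')).map_eq_gaussianReal
  refine ⟨μ[fun ω => (l.comp L') (X ω)] + l b,
    Var[fun ω => (l.comp L') (X ω); μ].toNNReal, ?_⟩
  rw [← gaussianReal_map_add_const, ← h1,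
    AEMeasurable.map_map_of_aemeasurable (by fun_prop) (by simp_rw [hfeq]; fun_prop),
    AEMeasurable.map_map_of_aemeasurable (by fun_prop) (by fun_prop)]
  congr 1
  ext ω
  simp [hfeq]

end Probability

/-! ### Channels whose input is fed by the Kalman filter -/

/-- One step of the channel with the input `Λ (v_t - v̂_t) + z`, for the filter estimate `v̂_t`; the
second component of the argument is `(z, w)`. -/
noncomputable def filterStep (c KW Λ KZ : ℕ → ℝ) (v₀ : ℝ) (t : ℕ) (q : Hist t × ℝ × ℝ) :
    Hist (t + 1) :=
  stepMap (c (t + 1)) v₀ t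
    ((q.1, Λ (t + 1) * (noiseAt v₀ q.1 - filter c KW Λ KZ v₀ t q.1.2) + q.2.1), q.2.2)

theorem measurable_filter_right (c KW Λ KZ : ℕ → ℝ) (v₀ : ℝ) (t : ℕ) :
    Measurable (fun y : Fin t → ℝ => filter c KW Λ KZ v₀ t y) :=
  (measurable_filter c KW Λ KZ t).comp (f := fun y : Fin t → ℝ => (v₀, y)) (by fun_prop)

theorem measurable_filterMean (c KW Λ KZ : ℕ → ℝ) (v₀ : ℝ) (t : ℕ) :
    Measurable (fun h : Hist t =>
      Λ (t + 1) * (noiseAt v₀ h - filter c KW Λ KZ v₀ t h.2)) :=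
  ((measurable_noiseAt_right v₀ t).sub
    ((measurable_filter_right c KW Λ KZ v₀ t).comp measurable_snd)).const_mul _

theorem measurable_filterStep (c KW Λ KZ : ℕ → ℝ) (v₀ : ℝ) (t : ℕ) :
    Measurable (filterStep c KW Λ KZ v₀ t) := by
  have h := measurable_filterMean c KW Λ KZ v₀ t
  exact (measurable_stepMap _ _ _).comp (f := fun q : Hist t × ℝ × ℝ =>
    ((q.1, Λ (t + 1) * (noiseAt v₀ q.1 - filter c KW Λ KZ v₀ t q.1.2) + q.2.1), q.2.2))
    ((measurable_fst.prodMk ((h.comp measurable_fst).add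
      (measurable_fst.comp measurable_snd))).prodMk (measurable_snd.comp measurable_snd))

theorem isAffine_noiseAt (v₀ : ℝ) (t : ℕ) : IsAffine (fun h : Hist t => noiseAt v₀ h) := by
  cases t with
  | zero => exact IsAffine.const v₀
  | succ t =>
    exact (IsAffine.linear ((LinearMap.proj (Fin.last t)).comp
      (LinearMap.snd ℝ (Fin (t + 1) → ℝ) (Fin (t + 1) → ℝ)))).sub
      (IsAffine.linear ((LinearMap.proj (Fin.last t)).comp
      (LinearMap.fst ℝ (Fin (t + 1) → ℝ) (Fin (t + 1) → ℝ))))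

theorem isAffine_filter (c KW Λ KZ : ℕ → ℝ) (v₀ : ℝ) (t : ℕ) :
    IsAffine (fun y : Fin t → ℝ => filter c KW Λ KZ v₀ t y) := by
  induction t with
  | zero => exact IsAffine.const v₀
  | succ t ih =>
    have h : IsAffine (fun y : Fin (t + 1) → ℝ =>
        c (t + 1) * filter c KW Λ KZ v₀ t (fun i => y i.castSucc)) :=
      (ih.comp_linear (LinearMap.funLeft ℝ ℝ (Fin.castSucc (n := t)))).const_mul _
    exact h.add (((IsAffine.linear (LinearMap.proj (Fin.last t))).sub h).const_mul _)

theorem isAffine_filterStep (c KW Λ KZ : ℕ → ℝ) (v₀ : ℝ) (t : ℕ) :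
    IsAffine (filterStep c KW Λ KZ v₀ t) := by
  let H : Hist t × ℝ × ℝ →ₗ[ℝ] Hist t := LinearMap.fst ℝ (Hist t) (ℝ × ℝ)
  let x : Hist t × ℝ × ℝ →ₗ[ℝ] (Fin t → ℝ) := (LinearMap.fst ℝ _ _).comp H
  let y : Hist t × ℝ × ℝ →ₗ[ℝ] (Fin t → ℝ) := (LinearMap.snd ℝ _ _).comp H
  let z : Hist t × ℝ × ℝ →ₗ[ℝ] ℝ :=
    (LinearMap.fst ℝ ℝ ℝ).comp (LinearMap.snd ℝ (Hist t) (ℝ × ℝ))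
  let w : Hist t × ℝ × ℝ →ₗ[ℝ] ℝ :=
    (LinearMap.snd ℝ ℝ ℝ).comp (LinearMap.snd ℝ (Hist t) (ℝ × ℝ))
  have hn : IsAffine (fun q : Hist t × ℝ × ℝ => noiseAt v₀ q.1) :=
    (isAffine_noiseAt v₀ t).comp_linear H
  have hx : IsAffine (fun q : Hist t × ℝ × ℝ =>
      Λ (t + 1) * (noiseAt v₀ q.1 - filter c KW Λ KZ v₀ t q.1.2) + q.2.1) :=
    ((hn.sub ((isAffine_filter c KW Λ KZ v₀ t).comp_linear y)).const_mul _).add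
      (IsAffine.linear z)
  have hy : IsAffine (fun q : Hist t × ℝ × ℝ =>
      (Λ (t + 1) * (noiseAt v₀ q.1 - filter c KW Λ KZ v₀ t q.1.2) + q.2.1)
        + (c (t + 1) * noiseAt v₀ q.1 + q.2.2)) :=
    hx.add ((hn.const_mul _).add (IsAffine.linear w))
  refine IsAffine.prodMk (IsAffine.pi fun i => ?_) (IsAffine.pi fun i => ?_)
  · refine Fin.lastCases ?_ (fun i => ?_) i
    · simpa using hx
    · simpa [x, H] using IsAffine.linear ((LinearMap.proj i).comp x)
  · refine Fin.lastCases ?_ (fun i => ?_) i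
    · simpa using hy
    · simpa [y, H] using IsAffine.linear ((LinearMap.proj i).comp y)

/-- One step of the joint law under the filter strategy, in terms of independent `z` and `w`. -/
theorem jointLaw_filterStrategy_succ (c KW Λ KZ : ℕ → ℝ) (v₀ : ℝ) (t : ℕ) :
    jointLaw c KW (filterStrategy c KW Λ KZ) v₀ (t + 1)
      = ((jointLaw c KW (filterStrategy c KW Λ KZ) v₀ t).prod
          ((gaussianReal 0 (KZ (t + 1)).toNNReal).prod
            (gaussianReal 0 (KW (t + 1)).toNNReal))).map (filterStep c KW Λ KZ v₀ t) := by
  set J := jointLaw c KW (filterStrategy c KW Λ KZ) v₀ t with hJ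
  set NZ := gaussianReal 0 (KZ (t + 1)).toNNReal with hNZ
  set NW := gaussianReal 0 (KW (t + 1)).toNNReal with hNW
  have hmean := measurable_filterMean c KW Λ KZ v₀ t
  have hg : Measurable (fun q : Hist t × ℝ =>
      (q.1, Λ (t + 1) * (noiseAt v₀ q.1 - filter c KW Λ KZ v₀ t q.1.2) + q.2)) :=
    measurable_fst.prodMk ((hmean.comp measurable_fst).add measurable_snd)
  have h1 : J.compProd (((filterStrategy c KW Λ KZ).kernel t).sectR v₀)
      = (J.prod NZ).map (fun q =>
        (q.1, Λ (t + 1) * (noiseAt v₀ q.1 - filter c KW Λ KZ v₀ t q.1.2) + q.2)) := by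
    ext s hs
    rw [Measure.compProd_apply hs, Measure.map_apply hg hs, Measure.prod_apply (hg hs)]
    refine lintegral_congr fun h => ?_
    have h2 : ((filterStrategy c KW Λ KZ).kernel t).sectR v₀ h
        = NZ.map (fun z => Λ (t + 1) * (noiseAt v₀ h - filter c KW Λ KZ v₀ t h.2) + z) := by
      rw [Kernel.sectR_apply, hNZ, gaussianReal_map_const_add, zero_add]
      rfl
    rw [h2, Measure.map_apply (by fun_prop) (measurable_prodMk_left hs)]
    rfl
  have h3 := Measure.map_prod_map (J.prod NZ) NW hg measurable_id
  rw [Measure.map_id] at h3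
  rw [jointLaw_succ, h1, h3, Measure.map_map (measurable_stepMap _ _ _)
    (hg.prodMap measurable_id),
    ← Measure.prodAssoc_prod, Measure.map_map (measurable_filterStep _ _ _ _ _ _)
    MeasurableEquiv.prodAssoc.measurable]
  rfl

/-- The channel driven by independent Gaussian variables `W_t` and `Z_t`, with inputs yet to be
specified. -/
structure DrivenProcess {Ω : Type*} {mΩ : MeasurableSpace Ω} (μ : Measure Ω) (n : ℕ)
    (c KW KZ : ℕ → ℝ) (v₀ : ℝ) (W Z V X Y : ℕ → Ω → ℝ) : Prop where
  measurable_X : ∀ t < n, Measurable (X (t + 1))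
  measurable_W : ∀ t < n, Measurable (W (t + 1))
  measurable_Z : ∀ t < n, Measurable (Z (t + 1))
  law_W : ∀ t < n, μ.map (W (t + 1)) = gaussianReal 0 (KW (t + 1)).toNNReal
  law_Z : ∀ t < n, μ.map (Z (t + 1)) = gaussianReal 0 (KZ (t + 1)).toNNReal
  indep : iIndepFun (fun (j : Fin n ⊕ Fin n) =>
    Sum.elim (fun i : Fin n => W (i + 1)) (fun i : Fin n => Z (i + 1)) j) μ
  noise_zero : V 0 = fun _ => v₀
  noise_succ : ∀ t < n, V (t + 1) = fun ω => c (t + 1) * V t ω + W (t + 1) ω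
  output : ∀ t < n, Y (t + 1) = fun ω => X (t + 1) ω + V (t + 1) ω

section Driven

variable {Ω : Type*} {mΩ : MeasurableSpace Ω} {μ : Measure Ω}

/-- The outputs up to time `t`. -/
abbrev outVec (Y : ℕ → Ω → ℝ) (t : ℕ) (ω : Ω) : Fin t → ℝ := fun i => Y (i + 1) ω

theorem outVec_succ (Y : ℕ → Ω → ℝ) (t : ℕ) (ω : Ω) :
    outVec Y (t + 1) ω = Fin.snoc (α := fun _ => ℝ) (outVec Y t ω) (Y (t + 1) ω) := by
  ext i
  refine Fin.lastCases ?_ (fun i => ?_) i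
  · rw [Fin.snoc_last]; rfl
  · rw [Fin.snoc_castSucc]; rfl

/-- The history up to time `t`. -/
abbrev histOf (X Y : ℕ → Ω → ℝ) (t : ℕ) (ω : Ω) : Hist t :=
  (fun i => X (i + 1) ω, fun i => Y (i + 1) ω)

/-- The error of the filter. -/
noncomputable def filterError (c KW Λ KZ : ℕ → ℝ) (v₀ : ℝ) (V Y : ℕ → Ω → ℝ) (t : ℕ) (ω : Ω) : ℝ :=
  V t ω - filter c KW Λ KZ v₀ t (outVec Y t ω)

/-- The innovation, as a function of the filter error and of the driving variables. -/
noncomputable def filterInnov (c KW Λ KZ : ℕ → ℝ) (v₀ : ℝ) (W Z V Y : ℕ → Ω → ℝ) (t : ℕ)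
    (ω : Ω) : ℝ :=
  (Λ (t + 1) + c (t + 1)) * filterError c KW Λ KZ v₀ V Y t ω + Z (t + 1) ω + W (t + 1) ω

/-- The input at time `t + 1` uses the filter estimate of the noise. -/
def FilterInput (μ : Measure Ω) (c KW Λ KZ : ℕ → ℝ) (v₀ : ℝ) (Z V X Y : ℕ → Ω → ℝ) (t : ℕ) : Prop :=
  X (t + 1) =ᵐ[μ] fun ω => Λ (t + 1) * filterError c KW Λ KZ v₀ V Y t ω + Z (t + 1) ω

namespace DrivenProcess

variable {n : ℕ} {c KW Λ KZ : ℕ → ℝ} {v₀ : ℝ} {W Z V X Y : ℕ → Ω → ℝ}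

theorem measurable_V (h : DrivenProcess μ n c KW KZ v₀ W Z V X Y) :
    ∀ t ≤ n, Measurable (V t) := by
  intro t
  induction t with
  | zero => intro _; rw [h.noise_zero]; exact measurable_const
  | succ t ih =>
    intro ht
    rw [h.noise_succ t ht]
    exact ((ih (by omega)).const_mul _).add (h.measurable_W t ht)

theorem measurable_Y (h : DrivenProcess μ n c KW KZ v₀ W Z V X Y) :
    ∀ t < n, Measurable (Y (t + 1)) := by
  intro t ht
  rw [h.output t ht]
  exact (h.measurable_X t ht).add (h.measurable_V (t + 1) ht)

theorem measurable_outVec (h : DrivenProcess μ n c KW KZ v₀ W Z V X Y) {t : ℕ} (ht : t ≤ n) :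
    Measurable (outVec Y t) :=
  measurable_pi_lambda _ fun i : Fin t => h.measurable_Y i (by omega)

theorem measurable_histOf (h : DrivenProcess μ n c KW KZ v₀ W Z V X Y) {t : ℕ} (ht : t ≤ n) :
    Measurable (histOf X Y t) :=
  (measurable_pi_lambda _ fun i : Fin t => h.measurable_X i (by omega)).prodMk
    (h.measurable_outVec ht)

theorem measurable_filterError (h : DrivenProcess μ n c KW KZ v₀ W Z V X Y) {t : ℕ} (ht : t ≤ n) :
    Measurable (filterError c KW Λ KZ v₀ V Y t) :=
  (h.measurable_V t ht).sub ((measurable_filter_right c KW Λ KZ v₀ t).comp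
    (h.measurable_outVec ht))

theorem measurable_filterInnov (h : DrivenProcess μ n c KW KZ v₀ W Z V X Y) {t : ℕ} (ht : t < n) :
    Measurable (filterInnov c KW Λ KZ v₀ W Z V Y t) :=
  (((h.measurable_filterError ht.le).const_mul _).add (h.measurable_Z t ht)).add
    (h.measurable_W t ht)

theorem noiseAt_histOf (h : DrivenProcess μ n c KW KZ v₀ W Z V X Y) {t : ℕ} (ht : t ≤ n) (ω : Ω) :
    noiseAt v₀ (histOf X Y t ω) = V t ω := by
  cases t with
  | zero => rw [h.noise_zero]; rfl
  | succ t => simp [noiseAt, h.output t ht]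

theorem histOf_succ (h : DrivenProcess μ n c KW KZ v₀ W Z V X Y) {t : ℕ} (ht : t < n) (ω : Ω) :
    histOf X Y (t + 1) ω
      = stepMap (c (t + 1)) v₀ t ((histOf X Y t ω, X (t + 1) ω), W (t + 1) ω) := by
  ext i
  · refine Fin.lastCases ?_ (fun i => ?_) i <;> simp [stepMap]
  · refine Fin.lastCases ?_ (fun i => ?_) i
    · simp only [stepMap, h.noiseAt_histOf ht.le ω]
      simp [h.output t ht, h.noise_succ t ht]
    · simp [stepMap]

theorem histOf_succ_ae (h : DrivenProcess μ n c KW KZ v₀ W Z V X Y) {t : ℕ} (ht : t < n)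
    (hin : FilterInput μ c KW Λ KZ v₀ Z V X Y t) :
    histOf X Y (t + 1) =ᵐ[μ] fun ω => filterStep c KW Λ KZ v₀ t
      (histOf X Y t ω, Z (t + 1) ω, W (t + 1) ω) := by
  filter_upwards [hin] with ω hω
  rw [h.histOf_succ ht, hω, filterStep, h.noiseAt_histOf ht.le]
  rfl

/-- The driving variables at time `t + 1` are independent of the previous ones. -/
theorem indepFun_driving (h : DrivenProcess μ n c KW KZ v₀ W Z V X Y) {t : ℕ} (ht : t < n) :
    IndepFun (fun ω (i : Fin t) => (Z (i + 1) ω, W (i + 1) ω))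
      (fun ω => (Z (t + 1) ω, W (t + 1) ω)) μ := by
  classical
  let S : Finset (Fin n ⊕ Fin n) :=
    Finset.univ.filter fun j => Sum.elim (fun i : Fin n => (i : ℕ)) (fun i : Fin n => (i : ℕ)) j < t
  let T : Finset (Fin n ⊕ Fin n) :=
    Finset.univ.filter fun j => Sum.elim (fun i : Fin n => (i : ℕ)) (fun i : Fin n => (i : ℕ)) j = t
  have hST : Disjoint S T := by
    rw [Finset.disjoint_filter]
    intro j _ h1 h2
    omega
  have hm : ∀ j : Fin n ⊕ Fin n, Measurable
      (Sum.elim (fun i : Fin n => W (i + 1)) (fun i : Fin n => Z (i + 1)) j) := by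
    rintro (i | i)
    · exact h.measurable_W i i.2
    · exact h.measurable_Z i i.2
  have h1 := h.indep.indepFun_finset S T hST hm
  let f : (S → ℝ) → (Fin t → ℝ × ℝ) := fun p i =>
    (p ⟨Sum.inr ⟨i, by omega⟩, by simp [S]⟩, p ⟨Sum.inl ⟨i, by omega⟩, by simp [S]⟩)
  let g : (T → ℝ) → ℝ × ℝ := fun p =>
    (p ⟨Sum.inr ⟨t, ht⟩, by simp [T]⟩, p ⟨Sum.inl ⟨t, ht⟩, by simp [T]⟩)
  exact h1.comp (φ := f) (ψ := g) (by fun_prop) (by fun_prop)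

theorem indepFun_Z_W (h : DrivenProcess μ n c KW KZ v₀ W Z V X Y) {t : ℕ} (ht : t < n) :
    IndepFun (Z (t + 1)) (W (t + 1)) μ :=
  h.indep.indepFun (i := Sum.inr ⟨t, ht⟩) (j := Sum.inl ⟨t, ht⟩) (by simp)

theorem map_Z_W [IsProbabilityMeasure μ] (h : DrivenProcess μ n c KW KZ v₀ W Z V X Y) {t : ℕ}
    (ht : t < n) : μ.map (fun ω => (Z (t + 1) ω, W (t + 1) ω))
      = (gaussianReal 0 (KZ (t + 1)).toNNReal).prod (gaussianReal 0 (KW (t + 1)).toNNReal) := by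
  rw [(h.indepFun_Z_W ht).map_prod_eq_prod_map_map (h.measurable_Z t ht).aemeasurable
    (h.measurable_W t ht).aemeasurable, h.law_Z t ht, h.law_W t ht]

/-- The history up to time `t` is a function of the driving variables up to time `t`. -/
theorem exists_histOf_eq (h : DrivenProcess μ n c KW KZ v₀ W Z V X Y) {t : ℕ} (ht : t ≤ n)
    (hin : ∀ s < t, FilterInput μ c KW Λ KZ v₀ Z V X Y s) :
    ∃ G : (Fin t → ℝ × ℝ) → Hist t, Measurable G ∧
      histOf X Y t =ᵐ[μ] fun ω => G (fun i => (Z (i + 1) ω, W (i + 1) ω)) := by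
  induction t with
  | zero => exact ⟨fun _ => 0, measurable_const,
      Filter.Eventually.of_forall fun ω => Subsingleton.elim _ _⟩
  | succ t ih =>
    obtain ⟨G, hG, hGeq⟩ := ih (by omega) fun s hs => hin s (by omega)
    refine ⟨fun p => filterStep c KW Λ KZ v₀ t (G (fun i => p i.castSucc), p (Fin.last t)),
      (measurable_filterStep _ _ _ _ _ _).comp (f := fun p : Fin (t + 1) → ℝ × ℝ =>
        (G (fun i => p i.castSucc), p (Fin.last t)))
        ((hG.comp (by fun_prop)).prodMk (by fun_prop)), ?_⟩
    filter_upwards [h.histOf_succ_ae ht (hin t (by omega)), hGeq] with ω h1 h2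
    rw [h1, h2]
    rfl

theorem indepFun_histOf (h : DrivenProcess μ n c KW KZ v₀ W Z V X Y) {t : ℕ} (ht : t < n)
    (hin : ∀ s < t, FilterInput μ c KW Λ KZ v₀ Z V X Y s) :
    IndepFun (histOf X Y t) (fun ω => (Z (t + 1) ω, W (t + 1) ω)) μ := by
  obtain ⟨G, hG, hGeq⟩ := h.exists_histOf_eq ht.le hin
  exact ((h.indepFun_driving ht).comp hG measurable_id).congr hGeq.symm Filter.EventuallyEq.rfl

/-- The process has the joint law of the filter strategy. -/
theorem map_histOf [IsProbabilityMeasure μ] (h : DrivenProcess μ n c KW KZ v₀ W Z V X Y) {t : ℕ}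
    (ht : t ≤ n) (hin : ∀ s < t, FilterInput μ c KW Λ KZ v₀ Z V X Y s) :
    μ.map (histOf X Y t) = jointLaw c KW (filterStrategy c KW Λ KZ) v₀ t := by
  induction t with
  | zero =>
    have : histOf X Y 0 = fun _ => (Fin.elim0, Fin.elim0) := by
      ext ω : 1; exact Subsingleton.elim _ _
    rw [this, Measure.map_const, measure_univ, one_smul]
    rfl
  | succ t ih =>
    have hm := h.measurable_histOf (t := t) (by omega)
    have hm2 := (h.measurable_Z t ht).prodMk (h.measurable_W t ht)
    rw [Measure.map_congr (h.histOf_succ_ae ht (hin t (by omega))), jointLaw_filterStrategy_succ,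
      ← ih (by omega) fun s hs => hin s (by omega), ← h.map_Z_W ht,
      ← (h.indepFun_histOf ht fun s hs => hin s (by omega)).map_prod_eq_prod_map_map
        hm.aemeasurable hm2.aemeasurable,
      Measure.map_map (measurable_filterStep _ _ _ _ _ _) (hm.prodMk hm2)]
    rfl

theorem hasGaussianLaw_histOf [IsProbabilityMeasure μ]
    (h : DrivenProcess μ n c KW KZ v₀ W Z V X Y) {t : ℕ} (ht : t ≤ n)
    (hin : ∀ s < t, FilterInput μ c KW Λ KZ v₀ Z V X Y s) :
    HasGaussianLaw (histOf X Y t) μ := by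
  induction t with
  | zero => exact HasGaussianLaw.of_subsingleton
  | succ t ih =>
    have hin' := fun s (hs : s < t) => hin s (by omega)
    have h1 := (h.indepFun_Z_W ht).hasGaussianLaw (hasGaussianLaw_of_law (h.law_Z t ht))
      (hasGaussianLaw_of_law (h.law_W t ht))
    have h2 := (h.indepFun_histOf ht hin').hasGaussianLaw (ih (by omega) hin') h1
    exact (hasGaussianLaw_map_isAffine h2 (isAffine_filterStep c KW Λ KZ v₀ t)).congr
      (h.histOf_succ_ae ht (hin t (by omega))).symm

/-- The output in terms of the filter and of the innovation. -/
theorem output_ae (h : DrivenProcess μ n c KW KZ v₀ W Z V X Y) {t : ℕ} (ht : t < n)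
    (hin : FilterInput μ c KW Λ KZ v₀ Z V X Y t) :
    Y (t + 1) =ᵐ[μ] fun ω => c (t + 1) * filter c KW Λ KZ v₀ t (outVec Y t ω)
      + filterInnov c KW Λ KZ v₀ W Z V Y t ω := by
  filter_upwards [hin] with ω hω
  simp only [h.output t ht, hω, h.noise_succ t ht, filterInnov, filterError]
  ring

theorem filter_outVec_succ_ae (h : DrivenProcess μ n c KW KZ v₀ W Z V X Y) {t : ℕ} (ht : t < n)
    (hin : FilterInput μ c KW Λ KZ v₀ Z V X Y t) :
    (fun ω => filter c KW Λ KZ v₀ (t + 1) (outVec Y (t + 1) ω)) =ᵐ[μ] fun ω =>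
      c (t + 1) * filter c KW Λ KZ v₀ t (outVec Y t ω)
        + gainM (c (t + 1)) (KW (t + 1)) (riccati c KW Λ KZ t) (Λ (t + 1)) (KZ (t + 1))
          * filterInnov c KW Λ KZ v₀ W Z V Y t ω := by
  filter_upwards [h.output_ae ht hin] with ω hω
  have h1 : outVec Y (t + 1) ω (Fin.last t) = Y (t + 1) ω := rfl
  rw [filter, h1, hω]
  change c (t + 1) * filter c KW Λ KZ v₀ t (outVec Y t ω) + gain c KW Λ KZ (t + 1)
    * (c (t + 1) * filter c KW Λ KZ v₀ t (outVec Y t ω) + filterInnov c KW Λ KZ v₀ W Z V Y t ω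
      - c (t + 1) * filter c KW Λ KZ v₀ t (outVec Y t ω)) = _
  rw [add_sub_cancel_left]
  rfl

theorem filterError_succ_ae (h : DrivenProcess μ n c KW KZ v₀ W Z V X Y) {t : ℕ} (ht : t < n)
    (hin : FilterInput μ c KW Λ KZ v₀ Z V X Y t) :
    filterError c KW Λ KZ v₀ V Y (t + 1) =ᵐ[μ] fun ω =>
      c (t + 1) * filterError c KW Λ KZ v₀ V Y t ω + W (t + 1) ω
        - gainM (c (t + 1)) (KW (t + 1)) (riccati c KW Λ KZ t) (Λ (t + 1)) (KZ (t + 1))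
          * filterInnov c KW Λ KZ v₀ W Z V Y t ω := by
  filter_upwards [h.filter_outVec_succ_ae ht hin] with ω hω
  rw [filterError, hω, h.noise_succ t ht, filterError]
  ring

theorem indepFun_outVec_filterError (h : DrivenProcess μ n c KW KZ v₀ W Z V X Y) {t : ℕ}
    (ht : t < n) (hin : ∀ s < t, FilterInput μ c KW Λ KZ v₀ Z V X Y s) :
    IndepFun (fun ω => (outVec Y t ω, filterError c KW Λ KZ v₀ V Y t ω))
      (fun ω => (Z (t + 1) ω, W (t + 1) ω)) μ := by
  have h1 := (h.indepFun_histOf ht hin).comp (φ := fun q : Hist t =>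
    (q.2, noiseAt v₀ q - filter c KW Λ KZ v₀ t q.2)) (ψ := id)
    (measurable_snd.prodMk ((measurable_noiseAt_right v₀ t).sub
      ((measurable_filter_right c KW Λ KZ v₀ t).comp measurable_snd))) measurable_id
  refine h1.congr (Filter.Eventually.of_forall fun ω => ?_) Filter.EventuallyEq.rfl
  simp only [Function.comp, h.noiseAt_histOf ht.le]
  rfl

variable [IsProbabilityMeasure μ]

/-- One step of the filter: if the filter error is Gaussian with the Riccati variance and
independent of the past outputs, so are the innovation and the next error, which is
moreover independent of the innovation. -/
theorem filter_step (h : DrivenProcess μ n c KW KZ v₀ W Z V X Y)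
    (hKW : ∀ t < n, 0 < KW (t + 1)) (hKZ : ∀ t < n, 0 ≤ KZ (t + 1)) {t : ℕ} (ht : t < n)
    (hin : ∀ s < t, FilterInput μ c KW Λ KZ v₀ Z V X Y s)
    (hE : μ.map (filterError c KW Λ KZ v₀ V Y t) = gaussianReal 0 (riccati c KW Λ KZ t).toNNReal)
    (hEY : IndepFun (filterError c KW Λ KZ v₀ V Y t) (outVec Y t) μ) :
    let E' := fun ω => c (t + 1) * filterError c KW Λ KZ v₀ V Y t ω + W (t + 1) ω
        - gainM (c (t + 1)) (KW (t + 1)) (riccati c KW Λ KZ t) (Λ (t + 1)) (KZ (t + 1))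
          * filterInnov c KW Λ KZ v₀ W Z V Y t ω
    μ.map (filterInnov c KW Λ KZ v₀ W Z V Y t) = gaussianReal 0
        (innovVar (c (t + 1)) (KW (t + 1)) (riccati c KW Λ KZ t) (Λ (t + 1))
          (KZ (t + 1))).toNNReal ∧
      IndepFun (filterInnov c KW Λ KZ v₀ W Z V Y t) (outVec Y t) μ ∧
      μ.map E' = gaussianReal 0 (riccati c KW Λ KZ (t + 1)).toNNReal ∧
      IndepFun E' (fun ω => (filterInnov c KW Λ KZ v₀ W Z V Y t ω, outVec Y t ω)) μ := by
  intro E'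
  have hEm := h.measurable_filterError (Λ := Λ) ht.le
  have hIm := h.measurable_filterInnov (Λ := Λ) ht
  have hYm := h.measurable_outVec ht.le
  have hZm := h.measurable_Z t ht
  have hWm := h.measurable_W t ht
  have hE'm : Measurable E' := ((hEm.const_mul _).add hWm).sub (hIm.const_mul _)
  have hYE := h.indepFun_outVec_filterError (Λ := Λ) ht hin
  have hEZW : IndepFun (filterError c KW Λ KZ v₀ V Y t) (fun ω => (Z (t + 1) ω, W (t + 1) ω)) μ :=
    hYE.comp measurable_snd measurable_id
  obtain ⟨hE'I, hI, hE'⟩ := gaussian_update (riccati_nonneg hKW hKZ t ht.le) (hKZ t ht) (hKW t ht)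
    hEm.aemeasurable hZm.aemeasurable hWm.aemeasurable hE (h.law_Z t ht) (h.law_W t ht) hEZW
    (h.indepFun_Z_W ht) (c (t + 1)) (Λ (t + 1))
  have hY3 := indepFun_prodMk_of_prodMk hYm.aemeasurable hEm.aemeasurable
    (hZm.prodMk hWm).aemeasurable hEY.symm hYE
  have hYE'I : IndepFun (outVec Y t)
      (fun ω => (E' ω, filterInnov c KW Λ KZ v₀ W Z V Y t ω)) μ :=
    hY3.comp (φ := id) (ψ := fun p : ℝ × ℝ × ℝ =>
      (c (t + 1) * p.1 + p.2.2
        - gainM (c (t + 1)) (KW (t + 1)) (riccati c KW Λ KZ t) (Λ (t + 1)) (KZ (t + 1))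
          * ((Λ (t + 1) + c (t + 1)) * p.1 + p.2.1 + p.2.2),
        (Λ (t + 1) + c (t + 1)) * p.1 + p.2.1 + p.2.2)) measurable_id (by fun_prop)
  exact ⟨hI, (hYE'I.comp measurable_id measurable_snd).symm, hE',
    indepFun_prodMk_of_prodMk hE'm.aemeasurable hIm.aemeasurable hYm.aemeasurable hE'I hYE'I.symm⟩

/-- The filter error is Gaussian with the variance of the Riccati recursion, and is independent of
the past outputs. -/
theorem law_filterError (h : DrivenProcess μ n c KW KZ v₀ W Z V X Y)
    (hKW : ∀ t < n, 0 < KW (t + 1)) (hKZ : ∀ t < n, 0 ≤ KZ (t + 1)) {t : ℕ} (ht : t ≤ n)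
    (hin : ∀ s < t, FilterInput μ c KW Λ KZ v₀ Z V X Y s) :
    μ.map (filterError c KW Λ KZ v₀ V Y t)
        = gaussianReal 0 (riccati c KW Λ KZ t).toNNReal ∧
      IndepFun (filterError c KW Λ KZ v₀ V Y t) (outVec Y t) μ := by
  induction t with
  | zero =>
    have h0 : filterError c KW Λ KZ v₀ V Y 0 = fun _ => 0 := by
      ext ω; simp [filterError, filter, h.noise_zero]
    rw [h0]
    refine ⟨?_, indepFun_const_left _ _⟩
    rw [Measure.map_const, measure_univ, one_smul]
    simp [riccati]
  | succ t ih =>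
    have hin' := fun s (hs : s < t) => hin s (by omega)
    obtain ⟨hE, hEY⟩ := ih (by omega) hin'
    obtain ⟨-, -, h3, h4⟩ := h.filter_step hKW hKZ ht hin' hE hEY
    have heq := h.filterError_succ_ae ht (hin t (by omega))
    refine ⟨by rw [Measure.map_congr heq, h3], ?_⟩
    have hm : Measurable (fun p : ℝ × (Fin t → ℝ) => (Fin.snoc (α := fun _ => ℝ) p.2
        (c (t + 1) * filter c KW Λ KZ v₀ t p.2 + p.1) : Fin (t + 1) → ℝ)) :=
      measurable_snoc.comp (f := fun p : ℝ × (Fin t → ℝ) =>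
        (p.2, c (t + 1) * filter c KW Λ KZ v₀ t p.2 + p.1))
        (measurable_snd.prodMk ((((measurable_filter_right c KW Λ KZ v₀ t).comp
          measurable_snd).const_mul _).add measurable_fst))
    refine (h4.comp measurable_id hm).congr heq.symm ?_
    filter_upwards [h.output_ae ht (hin t (by omega))] with ω hω
    rw [outVec_succ, hω]
    rfl

theorem law_filterInnov (h : DrivenProcess μ n c KW KZ v₀ W Z V X Y)
    (hKW : ∀ t < n, 0 < KW (t + 1)) (hKZ : ∀ t < n, 0 ≤ KZ (t + 1)) {t : ℕ} (ht : t < n)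
    (hin : ∀ s < t, FilterInput μ c KW Λ KZ v₀ Z V X Y s) :
    μ.map (filterInnov c KW Λ KZ v₀ W Z V Y t) = gaussianReal 0
        (innovVar (c (t + 1)) (KW (t + 1)) (riccati c KW Λ KZ t) (Λ (t + 1))
          (KZ (t + 1))).toNNReal ∧
      IndepFun (filterInnov c KW Λ KZ v₀ W Z V Y t) (outVec Y t) μ := by
  obtain ⟨hE, hEY⟩ := h.law_filterError hKW hKZ ht.le hin
  obtain ⟨h1, h2, -, -⟩ := h.filter_step hKW hKZ ht hin hE hEY
  exact ⟨h1, h2⟩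

/-- The outputs have a triangular Gaussian law, with the filter as predictor. -/
theorem map_outVec (h : DrivenProcess μ n c KW KZ v₀ W Z V X Y)
    (hKW : ∀ t < n, 0 < KW (t + 1)) (hKZ : ∀ t < n, 0 ≤ KZ (t + 1)) {t : ℕ} (ht : t ≤ n)
    (hin : ∀ s < t, FilterInput μ c KW Λ KZ v₀ Z V X Y s) :
    μ.map (outVec Y t) = triLaw (fun t y => c (t + 1) * filter c KW Λ KZ v₀ t y)
      (fun t => innovVar (c t) (KW t) (riccati c KW Λ KZ (t - 1)) (Λ t) (KZ t)) t := by
  induction t with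
  | zero =>
    have : outVec Y 0 = fun _ => Fin.elim0 := by ext ω i; exact i.elim0
    rw [this, Measure.map_const, measure_univ, one_smul]
    rfl
  | succ t ih =>
    have hin' := fun s (hs : s < t) => hin s (by omega)
    obtain ⟨h1, h2⟩ := h.law_filterInnov hKW hKZ ht hin'
    have hYm := h.measurable_outVec (t := t) (by omega)
    have hIm := h.measurable_filterInnov (Λ := Λ) ht
    have hφ : ∀ t, Measurable (fun y : Fin t → ℝ => c (t + 1) * filter c KW Λ KZ v₀ t y) :=
      fun t => (measurable_filter_right c KW Λ KZ v₀ t).const_mul _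
    have heq : outVec Y (t + 1) =ᵐ[μ] fun ω => Fin.snoc (α := fun _ => ℝ) (outVec Y t ω)
        (c (t + 1) * filter c KW Λ KZ v₀ t (outVec Y t ω)
          + filterInnov c KW Λ KZ v₀ W Z V Y t ω) := by
      filter_upwards [h.output_ae ht (hin t (by omega))] with ω hω
      rw [outVec_succ, hω]
    rw [Measure.map_congr heq, triLaw, ← ih (by omega) hin', add_tsub_cancel_right, ← h1,
      ← h2.symm.map_prod_eq_prod_map_map hYm.aemeasurable hIm.aemeasurable,
      Measure.map_map (measurable_snoc_shear hφ t) (hYm.prodMk hIm)]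
    rfl

theorem memLp_V (h : DrivenProcess μ n c KW KZ v₀ W Z V X Y) :
    ∀ t ≤ n, MemLp (V t) 2 μ := by
  intro t
  induction t with
  | zero => intro _; rw [h.noise_zero]; exact memLp_const v₀
  | succ t ih =>
    intro ht
    rw [h.noise_succ t ht]
    exact ((ih (by omega)).const_mul _).add
      (memLp_two_of_law (h.measurable_W t ht).aemeasurable (h.law_W t ht))

/-- The filter computes the conditional mean. -/
theorem estimate_V (h : DrivenProcess μ n c KW KZ v₀ W Z V X Y)
    (hKW : ∀ t < n, 0 < KW (t + 1)) (hKZ : ∀ t < n, 0 ≤ KZ (t + 1)) {t : ℕ} (ht : t ≤ n)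
    (hin : ∀ s < t, FilterInput μ c KW Λ KZ v₀ Z V X Y s) :
    estimate μ Y t (V t) =ᵐ[μ] fun ω => filter c KW Λ KZ v₀ t (outVec Y t ω) := by
  obtain ⟨h1, h2⟩ := h.law_filterError hKW hKZ ht hin
  have hEm := h.measurable_filterError (Λ := Λ) (KW := KW) ht
  refine condExp_comap_eq_of_indepFun (h.measurable_outVec ht)
    (measurable_filter_right c KW Λ KZ v₀ t) ((h.memLp_V t ht).integrable one_le_two)
    ((memLp_two_of_law hEm.aemeasurable h1).integrable one_le_two) hEm
    (Filter.Eventually.of_forall fun ω => ?_) (integral_of_law hEm.aemeasurable h1) h2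
  simp [filterError]

end DrivenProcess

end Driven

section DrivenProcesses

variable {Ω : Type*} {mΩ : MeasurableSpace Ω} {μ : Measure Ω}
  {n : ℕ} {c KW Λ KZ : ℕ → ℝ} {v₀ : ℝ} {W Z V X Y : ℕ → Ω → ℝ}

/-! ### Second moments, innovations and estimates of the filter process -/

namespace InnovationsProcess

theorem toDriven (h : InnovationsProcess μ n c KW Λ KZ v₀ W Z V X Y) :
    DrivenProcess μ n c KW KZ v₀ W Z V X Y :=
  ⟨h.measurable_X, h.measurable_W, h.measurable_Z, h.law_W, h.law_Z, h.indep, h.noise_zero,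
    h.noise_succ, h.output⟩

end InnovationsProcess

namespace DrivenProcess

/-- The noise path is a function of the driving variables `W` alone. -/
theorem indepFun_Z_V (h : DrivenProcess μ n c KW KZ v₀ W Z V X Y) :
    IndepFun (fun ω (i : Fin n) => Z (i + 1) ω) (fun ω (i : Fin n) => V (i + 1) ω) μ := by
  classical
  have hV : ∀ t ≤ n, ∃ F : (Fin n → ℝ) → ℝ, Measurable F ∧
      ∀ ω, V t ω = F (fun i => W (i + 1) ω) := by
    intro t
    induction t with
    | zero => exact fun _ => ⟨fun _ => v₀, measurable_const, fun ω => by rw [h.noise_zero]⟩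
    | succ t ih =>
      intro ht
      obtain ⟨F, hF, hFe⟩ := ih (by omega)
      refine ⟨fun w => c (t + 1) * F w + w ⟨t, ht⟩, (hF.const_mul _).add (measurable_pi_apply _),
        fun ω => ?_⟩
      rw [h.noise_succ t ht]
      simp only [hFe]
  choose! F hF hFe using hV
  let S : Finset (Fin n ⊕ Fin n) := Finset.univ.filter fun j => j.isRight
  let T : Finset (Fin n ⊕ Fin n) := Finset.univ.filter fun j => j.isLeft
  have hST : Disjoint S T := by
    rw [Finset.disjoint_filter]
    rintro (j | j) _ h1 h2 <;> simp at h1 h2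
  have hm : ∀ j : Fin n ⊕ Fin n, Measurable
      (Sum.elim (fun i : Fin n => W (i + 1)) (fun i : Fin n => Z (i + 1)) j) := by
    rintro (i | i)
    · exact h.measurable_W i i.2
    · exact h.measurable_Z i i.2
  have h1 := h.indep.indepFun_finset S T hST hm
  let f : (S → ℝ) → (Fin n → ℝ) := fun p i => p ⟨Sum.inr i, by simp [S]⟩
  let g : (T → ℝ) → (Fin n → ℝ) := fun p i => F (i + 1) fun i => p ⟨Sum.inl i, by simp [T]⟩
  have hg : Measurable g := measurable_pi_lambda _ fun i =>
    (hF (i + 1) i.2).comp (by fun_prop)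
  refine (h1.comp (φ := f) (ψ := g) (by fun_prop) hg).congr Filter.EventuallyEq.rfl
    (Filter.Eventually.of_forall fun ω => ?_)
  ext i
  exact (hFe (i + 1) i.2 ω).symm

theorem X_one_ae (h : DrivenProcess μ n c KW KZ v₀ W Z V X Y)
    (hin : FilterInput μ c KW Λ KZ v₀ Z V X Y 0) : X 1 =ᵐ[μ] Z 1 := by
  filter_upwards [hin] with ω hω
  simpa [filterError, filter, h.noise_zero] using hω

theorem Y_one_ae (h : DrivenProcess μ n c KW KZ v₀ W Z V X Y) (hn : 0 < n)
    (hin : FilterInput μ c KW Λ KZ v₀ Z V X Y 0) :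
    Y 1 =ᵐ[μ] fun ω => Z 1 ω + c 1 * v₀ + W 1 ω := by
  filter_upwards [h.X_one_ae hin] with ω hω
  have h1 := congrFun (h.output 0 hn) ω
  have h2 := congrFun (h.noise_succ 0 hn) ω
  simp only [zero_add, h.noise_zero] at h1 h2
  rw [h1, h2, hω]
  ring

/-- The history is a function of the earlier driving variables. -/
theorem indepFun_Z_history (h : DrivenProcess μ n c KW KZ v₀ W Z V X Y) {t : ℕ} (ht : t < n)
    (hin : ∀ s < t, FilterInput μ c KW Λ KZ v₀ Z V X Y s) :
    IndepFun (Z (t + 1)) (fun ω => (((fun i : Fin t => V (i + 1) ω),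
      (fun i : Fin t => X (i + 1) ω)), (fun i : Fin t => Y (i + 1) ω))) μ := by
  refine ((h.indepFun_histOf ht hin).symm.comp (φ := Prod.fst)
    (ψ := fun q : Hist t => ((q.2 - q.1, q.1), q.2)) measurable_fst (by fun_prop)).congr
    Filter.EventuallyEq.rfl (Filter.Eventually.of_forall fun ω => ?_)
  have hV : ∀ i : Fin t, V (i + 1) ω = Y (i + 1) ω - X (i + 1) ω := fun i => by
    rw [h.output i (by omega)]
    ring
  simp only [hV]
  rfl

variable [IsProbabilityMeasure μ]

/-- The power is `Λ² K + K_Z` because the filter error is independent of `Z`. -/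
theorem integral_X_sq (h : DrivenProcess μ n c KW KZ v₀ W Z V X Y)
    (hKW : ∀ t < n, 0 < KW (t + 1)) (hKZ : ∀ t < n, 0 ≤ KZ (t + 1))
    (hin : ∀ s < n, FilterInput μ c KW Λ KZ v₀ Z V X Y s) {t : ℕ} (ht : t < n) :
    MemLp (X (t + 1)) 2 μ ∧
      ∫ ω, X (t + 1) ω ^ 2 ∂μ = Λ (t + 1) ^ 2 * riccati c KW Λ KZ t + KZ (t + 1) := by
  have hin' := fun s (hs : s < t) => hin s (hs.trans ht)
  have hEm := (h.measurable_filterError (Λ := Λ) (KW := KW) ht.le).aemeasurable (μ := μ)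
  have hZm := (h.measurable_Z t ht).aemeasurable (μ := μ)
  have hE := (h.law_filterError hKW hKZ ht.le hin').1
  have lE := memLp_two_of_law hEm hE
  have lZ := memLp_two_of_law hZm (h.law_Z t ht)
  have lΛE : MemLp (fun ω => Λ (t + 1) * filterError c KW Λ KZ v₀ V Y t ω) 2 μ := lE.const_mul _
  have hEZ : IndepFun (filterError c KW Λ KZ v₀ V Y t) (Z (t + 1)) μ :=
    (h.indepFun_outVec_filterError ht hin').comp measurable_snd measurable_fst
  have hEZ0 : ∫ ω, filterError c KW Λ KZ v₀ V Y t ω * Z (t + 1) ω ∂μ = 0 := by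
    rw [hEZ.integral_fun_mul_eq_mul_integral hEm.aestronglyMeasurable hZm.aestronglyMeasurable,
      integral_of_law hEm hE, zero_mul]
  have hi : Integrable (fun ω => filterError c KW Λ KZ v₀ V Y t ω * Z (t + 1) ω) μ :=
    lE.integrable_mul lZ
  refine ⟨(lΛE.add lZ).ae_eq (hin t ht).symm, ?_⟩
  have h1 : (fun ω => X (t + 1) ω ^ 2) =ᵐ[μ] fun ω =>
      (Λ (t + 1) ^ 2 * filterError c KW Λ KZ v₀ V Y t ω ^ 2
        + 2 * Λ (t + 1) * (filterError c KW Λ KZ v₀ V Y t ω * Z (t + 1) ω))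
        + Z (t + 1) ω ^ 2 := by
    filter_upwards [hin t ht] with ω hω
    rw [hω]; ring
  have h2 : Integrable (fun ω => Λ (t + 1) ^ 2 * filterError c KW Λ KZ v₀ V Y t ω ^ 2) μ :=
    lE.integrable_sq.const_mul _
  have h3 : Integrable (fun ω => Λ (t + 1) ^ 2 * filterError c KW Λ KZ v₀ V Y t ω ^ 2
      + 2 * Λ (t + 1) * (filterError c KW Λ KZ v₀ V Y t ω * Z (t + 1) ω)) μ :=
    h2.add (hi.const_mul _)
  rw [integral_congr_ae h1, integral_add h3 lZ.integrable_sq, integral_add h2 (hi.const_mul _),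
    integral_const_mul, integral_const_mul, hEZ0,
    integral_sq_of_law (riccati_nonneg hKW hKZ t ht.le) hEm hE,
    integral_sq_of_law (hKZ t ht) hZm (h.law_Z t ht)]
  ring

theorem estimate_X (h : DrivenProcess μ n c KW KZ v₀ W Z V X Y)
    (hKW : ∀ t < n, 0 < KW (t + 1)) (hKZ : ∀ t < n, 0 ≤ KZ (t + 1))
    (hin : ∀ s < n, FilterInput μ c KW Λ KZ v₀ Z V X Y s) {t : ℕ} (ht : t < n) :
    estimate μ Y (t + 1) (X (t + 1)) =ᵐ[μ] fun ω =>
      Y (t + 1) ω - filter c KW Λ KZ v₀ (t + 1) (outVec Y (t + 1) ω) := by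
  obtain ⟨h1, h2⟩ := h.law_filterError hKW hKZ (t := t + 1) ht fun s hs => hin s (by omega)
  have hEm := h.measurable_filterError (Λ := Λ) (KW := KW) (t := t + 1) ht
  refine condExp_comap_eq_of_indepFun (h.measurable_outVec ht)
    (f := fun y => y (Fin.last t) - filter c KW Λ KZ v₀ (t + 1) y)
    (R := fun ω => -filterError c KW Λ KZ v₀ V Y (t + 1) ω)
    ((measurable_pi_apply _).sub (measurable_filter_right c KW Λ KZ v₀ (t + 1)))
    ((h.integral_X_sq hKW hKZ hin ht).1.integrable one_le_two)
    ((memLp_two_of_law hEm.aemeasurable h1).integrable one_le_two).neg hEm.neg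
    (Filter.Eventually.of_forall fun ω => ?_) ?_ (h2.comp measurable_neg measurable_id)
  · change X (t + 1) ω = Y (t + 1) ω - filter c KW Λ KZ v₀ (t + 1) (outVec Y (t + 1) ω)
      + -filterError c KW Λ KZ v₀ V Y (t + 1) ω
    rw [filterError, h.output t ht]
    ring
  · rw [integral_neg, integral_of_law hEm.aemeasurable h1, neg_zero]

theorem estimate_Y (h : DrivenProcess μ n c KW KZ v₀ W Z V X Y)
    (hKW : ∀ t < n, 0 < KW (t + 1)) (hKZ : ∀ t < n, 0 ≤ KZ (t + 1))
    (hin : ∀ s < n, FilterInput μ c KW Λ KZ v₀ Z V X Y s) {t : ℕ} (ht : t < n) :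
    estimate μ Y t (Y (t + 1)) =ᵐ[μ] fun ω =>
      c (t + 1) * filter c KW Λ KZ v₀ t (outVec Y t ω) := by
  obtain ⟨h1, h2⟩ := h.law_filterInnov hKW hKZ ht fun s hs => hin s (hs.trans ht)
  have hIm := h.measurable_filterInnov (Λ := Λ) ht
  have hY : MemLp (Y (t + 1)) 2 μ := by
    rw [h.output t ht]
    exact (h.integral_X_sq hKW hKZ hin ht).1.add (h.memLp_V (t + 1) ht)
  exact condExp_comap_eq_of_indepFun (h.measurable_outVec ht.le)
    ((measurable_filter_right c KW Λ KZ v₀ t).const_mul _) (hY.integrable one_le_two)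
    ((memLp_two_of_law hIm.aemeasurable h1).integrable one_le_two) hIm
    (h.output_ae ht (hin t ht)) (integral_of_law hIm.aemeasurable h1) h2

/-- The probabilistic innovation `Y - E[Y | past]` is the innovation of the filter. -/
theorem innovation_ae (h : DrivenProcess μ n c KW KZ v₀ W Z V X Y)
    (hKW : ∀ t < n, 0 < KW (t + 1)) (hKZ : ∀ t < n, 0 ≤ KZ (t + 1))
    (hin : ∀ s < n, FilterInput μ c KW Λ KZ v₀ Z V X Y s) {t : ℕ} (ht : t < n) :
    (fun ω => Y (t + 1) ω - estimate μ Y t (Y (t + 1)) ω) =ᵐ[μ]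
      filterInnov c KW Λ KZ v₀ W Z V Y t := by
  filter_upwards [h.estimate_Y hKW hKZ hin ht, h.output_ae ht (hin t ht)] with ω h1 h2
  rw [h1, h2]
  ring

/-- An earlier innovation is a function of the past outputs, of which a later one is independent. -/
theorem integral_innov_mul (h : DrivenProcess μ n c KW KZ v₀ W Z V X Y)
    (hKW : ∀ t < n, 0 < KW (t + 1)) (hKZ : ∀ t < n, 0 ≤ KZ (t + 1))
    (hin : ∀ s < n, FilterInput μ c KW Λ KZ v₀ Z V X Y s) {s t : ℕ} (hst : s < t) (ht : t < n) :
    ∫ ω, filterInnov c KW Λ KZ v₀ W Z V Y s ω * filterInnov c KW Λ KZ v₀ W Z V Y t ω ∂μ = 0 := by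
  obtain ⟨h1, h2⟩ := h.law_filterInnov hKW hKZ ht fun s hs => hin s (hs.trans ht)
  have hIm := (h.measurable_filterInnov (Λ := Λ) ht).aemeasurable (μ := μ)
  let g : (Fin t → ℝ) → ℝ := fun y => y ⟨s, hst⟩
    - c (s + 1) * filter c KW Λ KZ v₀ s (fun i => y (Fin.castLE hst.le i))
  have hg : Measurable g := (measurable_pi_apply _).sub
    (((measurable_filter_right c KW Λ KZ v₀ s).comp (by fun_prop)).const_mul _)
  have hs : filterInnov c KW Λ KZ v₀ W Z V Y s =ᵐ[μ] fun ω => g (outVec Y t ω) := by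
    filter_upwards [h.output_ae (hst.trans ht) (hin s (hst.trans ht))] with ω hω
    change _ = Y (s + 1) ω - c (s + 1) * filter c KW Λ KZ v₀ s (outVec Y s ω)
    rw [hω]; ring
  have h3 : ∫ ω, g (outVec Y t ω) * filterInnov c KW Λ KZ v₀ W Z V Y t ω ∂μ = 0 := by
    have h4 := h2.symm.comp hg measurable_id
    have h5 := h4.integral_fun_mul_eq_mul_integral
      (hg.comp (h.measurable_outVec ht.le)).aestronglyMeasurable hIm.aestronglyMeasurable
    simp only [Function.comp_def, id] at h5
    rw [h5, integral_of_law hIm h1, mul_zero]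
  rw [← h3]
  refine integral_congr_ae ?_
  filter_upwards [hs] with ω hω
  rw [hω]

theorem integral_sq_sub_estimate_V (h : DrivenProcess μ n c KW KZ v₀ W Z V X Y)
    (hKW : ∀ t < n, 0 < KW (t + 1)) (hKZ : ∀ t < n, 0 ≤ KZ (t + 1)) {t : ℕ} (ht : t ≤ n)
    (hin : ∀ s < t, FilterInput μ c KW Λ KZ v₀ Z V X Y s) :
    ∫ ω, (V t ω - estimate μ Y t (V t) ω) ^ 2 ∂μ = riccati c KW Λ KZ t := by
  rw [← integral_sq_of_law (riccati_nonneg hKW hKZ t ht)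
    (h.measurable_filterError ht).aemeasurable (h.law_filterError hKW hKZ ht hin).1]
  refine integral_congr_ae ?_
  filter_upwards [h.estimate_V hKW hKZ ht hin] with ω hω
  rw [hω, filterError]

/-- The outputs determine the sum `X + V`, so the estimation errors of `X` and `V` are opposite. -/
theorem sub_estimate_X_ae (h : DrivenProcess μ n c KW KZ v₀ W Z V X Y)
    (hKW : ∀ t < n, 0 < KW (t + 1)) (hKZ : ∀ t < n, 0 ≤ KZ (t + 1))
    (hin : ∀ s < n, FilterInput μ c KW Λ KZ v₀ Z V X Y s) {t : ℕ} (ht : t < n) :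
    (fun ω => X (t + 1) ω - estimate μ Y (t + 1) (X (t + 1)) ω) =ᵐ[μ]
      fun ω => -(V (t + 1) ω - estimate μ Y (t + 1) (V (t + 1)) ω) := by
  filter_upwards [h.estimate_X hKW hKZ hin ht,
    h.estimate_V hKW hKZ (t := t + 1) ht fun s hs => hin s (by omega)] with ω h1 h2
  rw [h1, h2, h.output t ht]
  ring

theorem integral_sq_sub_estimate_X (h : DrivenProcess μ n c KW KZ v₀ W Z V X Y)
    (hKW : ∀ t < n, 0 < KW (t + 1)) (hKZ : ∀ t < n, 0 ≤ KZ (t + 1))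
    (hin : ∀ s < n, FilterInput μ c KW Λ KZ v₀ Z V X Y s) {t : ℕ} (ht : t < n) :
    ∫ ω, (X (t + 1) ω - estimate μ Y (t + 1) (X (t + 1)) ω) ^ 2 ∂μ
      = riccati c KW Λ KZ (t + 1) := by
  rw [← h.integral_sq_sub_estimate_V hKW hKZ (t := t + 1) ht fun s hs => hin s (by omega)]
  refine integral_congr_ae ?_
  filter_upwards [h.sub_estimate_X_ae hKW hKZ hin ht] with ω hω
  rw [hω, neg_sq]

end DrivenProcess

variable [IsProbabilityMeasure μ]

namespace InnovationsProcess

/-- In an innovations process the conditional mean of the noise is the filter, so that the input is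
the one fed by the filter. -/
theorem filterInput (h : InnovationsProcess μ n c KW Λ KZ v₀ W Z V X Y)
    (hKW : ∀ t < n, 0 < KW (t + 1)) (hKZ : ∀ t < n, 0 ≤ KZ (t + 1)) :
    ∀ t < n, FilterInput μ c KW Λ KZ v₀ Z V X Y t := by
  intro t
  induction t using Nat.strong_induction_on with
  | _ t ih =>
    intro ht
    filter_upwards [h.input t ht, h.toDriven.estimate_V hKW hKZ ht.le
      fun s hs => ih s hs (hs.trans ht)] with ω h1 h2
    rw [h1, h2]
    rfl

end InnovationsProcess

/-- Conversely, the input fed by the filter defines an innovations process. -/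
theorem DrivenProcess.toInnovations (h : DrivenProcess μ n c KW KZ v₀ W Z V X Y)
    (hKW : ∀ t < n, 0 < KW (t + 1)) (hKZ : ∀ t < n, 0 ≤ KZ (t + 1))
    (hin : ∀ s < n, FilterInput μ c KW Λ KZ v₀ Z V X Y s) :
    InnovationsProcess μ n c KW Λ KZ v₀ W Z V X Y := by
  refine ⟨h.measurable_X, h.measurable_W, h.measurable_Z, h.law_W, h.law_Z, h.indep, h.noise_zero,
    h.noise_succ, fun t ht => ?_, h.output⟩
  filter_upwards [hin t ht, h.estimate_V hKW hKZ ht.le fun s hs => hin s (hs.trans ht)] with ω h1 h2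
  rw [h1, h2]
  rfl

end DrivenProcesses

/-! ### Existence of the process -/

/-- The pair `(v_t, v̂_t)` of the noise and of its filter estimate, along driving sequences `w` and
`z`. -/
noncomputable def kalmanState (c KW Λ KZ : ℕ → ℝ) (v₀ : ℝ) (w z : ℕ → ℝ) : ℕ → ℝ × ℝ
  | 0 => (v₀, v₀)
  | t + 1 =>
    let s := kalmanState c KW Λ KZ v₀ w z t
    let v := c (t + 1) * s.1 + w (t + 1)
    let y := Λ (t + 1) * (s.1 - s.2) + z (t + 1) + v
    (v, c (t + 1) * s.2 + gain c KW Λ KZ (t + 1) * (y - c (t + 1) * s.2))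

theorem exists_drivenProcess (n : ℕ) (c KW Λ KZ : ℕ → ℝ) (v₀ : ℝ) :
    ∃ (Ω : Type) (_ : MeasurableSpace Ω) (μ : Measure Ω) (_ : IsProbabilityMeasure μ)
      (W Z V X Y : ℕ → Ω → ℝ), DrivenProcess μ n c KW KZ v₀ W Z V X Y ∧
        ∀ t < n, FilterInput μ c KW Λ KZ v₀ Z V X Y t := by
  -- the canonical space of the driving variables, `W` on the left and `Z` on the right
  let Ω := Fin n ⊕ Fin n → ℝ
  let m : Fin n ⊕ Fin n → Measure ℝ := Sum.elim
    (fun i => gaussianReal 0 (KW (i + 1)).toNNReal) (fun i => gaussianReal 0 (KZ (i + 1)).toNNReal)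
  have hm : ∀ j, IsProbabilityMeasure (m j) := by
    rintro (i | i) <;> (simp only [m, Sum.elim_inl, Sum.elim_inr]; infer_instance)
  let μ : Measure Ω := Measure.pi m
  let W : ℕ → Ω → ℝ := fun t ω => coordAt t (fun i => ω (Sum.inl i))
  let Z : ℕ → Ω → ℝ := fun t ω => coordAt t (fun i => ω (Sum.inr i))
  let s : ℕ → Ω → ℝ × ℝ := fun t ω =>
    kalmanState c KW Λ KZ v₀ (fun t => W t ω) (fun t => Z t ω) t
  let V : ℕ → Ω → ℝ := fun t ω => (s t ω).1
  let X : ℕ → Ω → ℝ := fun t ω => Λ t * ((s (t - 1) ω).1 - (s (t - 1) ω).2) + Z t ω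
  let Y : ℕ → Ω → ℝ := fun t ω => X t ω + V t ω
  have hW : ∀ t (ht : t < n), W (t + 1) = fun ω => ω (Sum.inl ⟨t, ht⟩) := fun t ht => by
    ext ω; exact coordAt_succ ht _
  have hZ : ∀ t (ht : t < n), Z (t + 1) = fun ω => ω (Sum.inr ⟨t, ht⟩) := fun t ht => by
    ext ω; exact coordAt_succ ht _
  have hWm : ∀ t < n, Measurable (W (t + 1)) := fun t ht => by rw [hW t ht]; fun_prop
  have hZm : ∀ t < n, Measurable (Z (t + 1)) := fun t ht => by rw [hZ t ht]; fun_prop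
  have hs : ∀ t ≤ n, Measurable (s t) := by
    intro t
    induction t with
    | zero => exact fun _ => measurable_const
    | succ t ih =>
      intro ht
      have h1 := ih (by omega)
      have h2 := hWm t ht
      have h3 := hZm t ht
      have h4 : Measurable fun ω => (s t ω).1 := measurable_fst.comp h1
      have h5 : Measurable fun ω => (s t ω).2 := measurable_snd.comp h1
      have h6 : Measurable fun ω => c (t + 1) * (s t ω).1 + W (t + 1) ω := by fun_prop
      have h7 : Measurable fun ω => Λ (t + 1) * ((s t ω).1 - (s t ω).2) + Z (t + 1) ω
        + (c (t + 1) * (s t ω).1 + W (t + 1) ω) := by fun_prop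
      exact h6.prodMk ((h5.const_mul _).add ((h7.sub (h5.const_mul _)).const_mul _))
  have hfilter : ∀ t ω, filter c KW Λ KZ v₀ t (outVec Y t ω) = (s t ω).2 := by
    intro t ω
    induction t with
    | zero => rfl
    | succ t ih =>
      change c (t + 1) * filter c KW Λ KZ v₀ t (outVec Y t ω) + gain c KW Λ KZ (t + 1)
        * (Y (t + 1) ω - c (t + 1) * filter c KW Λ KZ v₀ t (outVec Y t ω)) = _
      rw [ih]
      rfl
  have hindep : iIndepFun (fun (j : Fin n ⊕ Fin n) (ω : Ω) => ω j) μ :=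
    iIndepFun_pi (X := fun _ x => x) (fun j => aemeasurable_id)
  refine ⟨Ω, inferInstance, μ, inferInstance, W, Z, V, X, Y,
    ⟨fun t ht => ?_, hWm, hZm, fun t ht => ?_, fun t ht => ?_, ?_, rfl, fun t _ => rfl,
      fun t _ => rfl⟩, fun t ht => ?_⟩
  · have h1 := hs t ht.le
    have h3 := hZm t ht
    have h4 : Measurable fun ω => (s t ω).1 := measurable_fst.comp h1
    have h5 : Measurable fun ω => (s t ω).2 := measurable_snd.comp h1
    exact ((h4.sub h5).const_mul _).add h3
  · rw [hW t ht]
    exact (measurePreserving_eval m (Sum.inl ⟨t, ht⟩)).map_eq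
  · rw [hZ t ht]
    exact (measurePreserving_eval m (Sum.inr ⟨t, ht⟩)).map_eq
  · convert! hindep using 2 with j
    rcases j with i | i
    · exact hW i i.2
    · exact hZ i i.2
  · refine Filter.Eventually.of_forall fun ω => ?_
    simp only [filterError, hfilter]
    rfl

/-! ### The strategy fed by the filter -/

section Strategy

variable {n : ℕ} {c KW Λ KZ : ℕ → ℝ}

/-- The joint law is an affine image of the Gaussian law of the driving variables. -/
theorem gaussianStrategy_filterStrategy (v₀ : ℝ) :
    GaussianStrategy c KW (filterStrategy c KW Λ KZ) v₀ n := by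
  refine ⟨fun t _ => Filter.Eventually.of_forall fun h => ?_, ?_⟩
  · change IsGaussian (filterKernel c KW Λ KZ t (v₀, h))
    rw [filterKernel_apply]
    infer_instance
  · obtain ⟨Ω, _, μ, _, W, Z, V, X, Y, h, hin⟩ := exists_drivenProcess n c KW Λ KZ v₀
    rw [← h.map_histOf le_rfl hin]
    exact (h.hasGaussianLaw_histOf le_rfl hin).isGaussian_map

/-- The output law is triangular Gaussian with the innovations variances, which gives both entropies
in closed form. -/
theorem payoff_filterStrategy (hKW : ∀ t < n, 0 < KW (t + 1)) (hKZ : ∀ t < n, 0 ≤ KZ (t + 1))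
    (v₀ : ℝ) : payoff c KW (filterStrategy c KW Λ KZ) v₀ n = paramRate c KW n Λ KZ := by
  obtain ⟨Ω, _, μ, _, W, Z, V, X, Y, h, hin⟩ := exists_drivenProcess n c KW Λ KZ v₀
  have h1 : outputLaw c KW (filterStrategy c KW Λ KZ) v₀ n = μ.map (outVec Y n) := by
    rw [outputLaw, ← h.map_histOf le_rfl hin, Measure.map_map measurable_snd
      (h.measurable_histOf le_rfl)]
    rfl
  rw [payoff, h1, h.map_outVec hKW hKZ le_rfl hin, (entropy_noiseLaw hKW _ v₀).2,
    differentialEntropy_triLaw (fun t => (measurable_filter_right c KW Λ KZ v₀ t).const_mul _)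
      (fun t ht => innovVar_pos (hKW t ht) (riccati_nonneg hKW hKZ t ht.le) (hKZ t ht)),
    ← sum_log_sub_eq_paramRate hKW hKZ]
  rfl

theorem powerAdmissible_filterStrategy {κ : ℝ} (hKW : ∀ t < n, 0 < KW (t + 1))
    (hf : ParamFeasible c KW n κ Λ KZ) (v₀ : ℝ) :
    PowerAdmissible c KW (filterStrategy c KW Λ KZ) v₀ n κ := by
  obtain ⟨Ω, _, μ, _, W, Z, V, X, Y, h, hin⟩ := exists_drivenProcess n c KW Λ KZ v₀
  have hm := (h.measurable_histOf le_rfl).aemeasurable (μ := μ)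
  rw [PowerAdmissible, ← h.map_histOf le_rfl hin]
  have hX := fun t (ht : t < n) => h.integral_X_sq hKW hf.1 hin ht
  refine ⟨fun i => ?_, ?_⟩
  · rw [integrable_map_measure (by fun_prop) hm]
    exact (hX i i.2).1.integrable_sq
  · refine le_of_eq_of_le ?_ hf.2
    congr 1
    rw [← Fin.sum_univ_eq_sum_range
      (fun t => Λ (t + 1) ^ 2 * riccati c KW Λ KZ t + KZ (t + 1)) n]
    refine Finset.sum_congr rfl fun i _ => ?_
    rw [integral_map hm (by fun_prop), ← (hX i i.2).2]

theorem dependsOnNoiseAndOutputs_filterStrategy :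
    DependsOnNoiseAndOutputs (filterStrategy c KW Λ KZ) := by
  intro t
  refine ⟨⟨fun p => gaussianReal (Λ (t + 1) * (p.2.1 - filter c KW Λ KZ p.1 t p.2.2))
    (KZ (t + 1)).toNNReal, ?_⟩, fun v₀ h => rfl⟩
  have h1 : Measurable (fun p : ℝ × ℝ × (Fin t → ℝ) => filter c KW Λ KZ p.1 t p.2.2) :=
    (measurable_filter c KW Λ KZ t).comp
      (f := fun p : ℝ × ℝ × (Fin t → ℝ) => (p.1, p.2.2)) (by fun_prop)
  exact measurable_gaussianReal.comp
    ((((measurable_fst.comp measurable_snd).sub h1).const_mul (Λ (t + 1))).prodMk measurable_const)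

end Strategy

/-! ### Attainment of the maximal rate -/

section Attainment

/-- The Riccati recursion in the rescaled parameters `a = Λ √K`, `z = K_Z`; `p t = (a, z)` are those
of time `t + 1`. Unlike in the parameters `(Λ, K_Z)`, the power constraint bounds `(a, z)`. -/
noncomputable def scaledRiccati (c KW : ℕ → ℝ) (p : ℕ → ℝ × ℝ) : ℕ → ℝ
  | 0 => 0
  | t + 1 =>
    c (t + 1) ^ 2 * scaledRiccati c KW p t + KW (t + 1)
      - (KW (t + 1) + c (t + 1) * √(scaledRiccati c KW p t)
          * ((p t).1 + c (t + 1) * √(scaledRiccati c KW p t))) ^ 2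
        / ((p t).2 + KW (t + 1) + ((p t).1 + c (t + 1) * √(scaledRiccati c KW p t)) ^ 2)

/-- The rate in the rescaled parameters. -/
noncomputable def scaledRate (c KW : ℕ → ℝ) (n : ℕ) (p : ℕ → ℝ × ℝ) : ℝ :=
  (1 / 2) * ∑ t ∈ Finset.range n,
    Real.log ((((p t).1 + c (t + 1) * √(scaledRiccati c KW p t)) ^ 2 + (p t).2 + KW (t + 1))
      / KW (t + 1))

/-- The rescaled parameters within the power constraint. The constraint gives `|a| ≤ √(n κ)` and
`z ≤ n κ` at the times `t < n`, hence the bounds `n κ + 1`; imposing them at all times confines the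
other entries too, and makes the set compact in the space of sequences. -/
def scaledFeasible (n : ℕ) (κ : ℝ) : Set (ℕ → ℝ × ℝ) :=
  (Set.univ.pi fun _ => Set.Icc (-(n * κ + 1)) (n * κ + 1) ×ˢ Set.Icc 0 (n * κ + 1)) ∩
    {p | (1 / (n : ℝ)) * ∑ t ∈ Finset.range n, ((p t).1 ^ 2 + (p t).2) ≤ κ}

theorem isCompact_scaledFeasible (n : ℕ) (κ : ℝ) : IsCompact (scaledFeasible n κ) := by
  refine (isCompact_univ_pi fun _ => isCompact_Icc.prod isCompact_Icc).inter_right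
    (isClosed_le ?_ continuous_const)
  fun_prop

variable {n : ℕ} {c KW Λ KZ : ℕ → ℝ} {κ : ℝ} {p : ℕ → ℝ × ℝ}

theorem continuousOn_scaledRiccati (hKW : ∀ t < n, 0 < KW (t + 1)) :
    ∀ t ≤ n, ContinuousOn (fun p => scaledRiccati c KW p t) {p | ∀ t, 0 ≤ (p t).2} := by
  intro t
  induction t with
  | zero => exact fun _ => continuousOn_const
  | succ t ih =>
    intro ht
    have h1 := ih (by omega)
    have h2 : ContinuousOn (fun p => √(scaledRiccati c KW p t)) {p | ∀ t, 0 ≤ (p t).2} := h1.sqrt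
    have h3 : ContinuousOn (fun p : ℕ → ℝ × ℝ => (p t).1) {p | ∀ t, 0 ≤ (p t).2} := by fun_prop
    have h4 : ContinuousOn (fun p : ℕ → ℝ × ℝ => (p t).2) {p | ∀ t, 0 ≤ (p t).2} := by fun_prop
    simp only [scaledRiccati]
    refine ContinuousOn.sub (by fun_prop) (ContinuousOn.div (by fun_prop) (by fun_prop) ?_)
    intro p hp
    have h5 := hKW t ht
    have h6 : 0 ≤ (p t).2 := hp t
    positivity

theorem continuousOn_scaledRate (hKW : ∀ t < n, 0 < KW (t + 1)) :
    ContinuousOn (scaledRate c KW n) {p | ∀ t, 0 ≤ (p t).2} := by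
  refine continuousOn_const.mul (continuousOn_finsetSum _ fun t ht => ?_)
  have ht' := Finset.mem_range.1 ht
  have h1 := continuousOn_scaledRiccati (c := c) hKW t ht'.le
  have h2 : ContinuousOn (fun p => √(scaledRiccati c KW p t)) {p | ∀ t, 0 ≤ (p t).2} := h1.sqrt
  have h3 : ContinuousOn (fun p : ℕ → ℝ × ℝ => (p t).1) {p | ∀ t, 0 ≤ (p t).2} := by fun_prop
  have h4 : ContinuousOn (fun p : ℕ → ℝ × ℝ => (p t).2) {p | ∀ t, 0 ≤ (p t).2} := by fun_prop
  refine ContinuousOn.log (by fun_prop) fun p hp => ?_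
  have h5 := hKW t ht'
  have h6 : 0 ≤ (p t).2 := hp t
  positivity

/-- The parameters `(Λ, K_Z)` and `(a, z)` correspond as soon as they give the same power, the same
innovations variance and the same covariance of noise and innovation at each time. -/
theorem scaledRiccati_eq_riccati
    (h : ∀ t < n, scaledRiccati c KW p t = riccati c KW Λ KZ t →
      (Λ (t + 1) + c (t + 1)) ^ 2 * riccati c KW Λ KZ t + KZ (t + 1)
        = ((p t).1 + c (t + 1) * √(riccati c KW Λ KZ t)) ^ 2 + (p t).2 ∧
      riccati c KW Λ KZ t * (Λ (t + 1) + c (t + 1))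
        = √(riccati c KW Λ KZ t) * ((p t).1 + c (t + 1) * √(riccati c KW Λ KZ t))) :
    ∀ t ≤ n, scaledRiccati c KW p t = riccati c KW Λ KZ t := by
  intro t
  induction t with
  | zero => exact fun _ => rfl
  | succ t ih =>
    intro ht
    have h0 := ih (by omega)
    obtain ⟨h1, h2⟩ := h t ht h0
    rw [scaledRiccati, riccati, h0, mul_assoc, mul_assoc (c (t + 1)), h2]
    congr 2
    linarith

theorem scaledRate_eq_paramRate
    (h : ∀ t < n, scaledRiccati c KW p t = riccati c KW Λ KZ t →
      (Λ (t + 1) + c (t + 1)) ^ 2 * riccati c KW Λ KZ t + KZ (t + 1)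
        = ((p t).1 + c (t + 1) * √(riccati c KW Λ KZ t)) ^ 2 + (p t).2 ∧
      riccati c KW Λ KZ t * (Λ (t + 1) + c (t + 1))
        = √(riccati c KW Λ KZ t) * ((p t).1 + c (t + 1) * √(riccati c KW Λ KZ t))) :
    scaledRate c KW n p = paramRate c KW n Λ KZ := by
  rw [scaledRate, paramRate]
  congr 1
  refine Finset.sum_congr rfl fun t ht => ?_
  have h0 := scaledRiccati_eq_riccati h t (Finset.mem_range.1 ht).le
  rw [(h t (Finset.mem_range.1 ht) h0).1, h0]

/-- Feasible parameters have a rescaled counterpart. -/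
theorem exists_scaledFeasible (hn : 0 < n) (hκ : 0 ≤ κ) (hKW : ∀ t < n, 0 < KW (t + 1))
    (hf : ParamFeasible c KW n κ Λ KZ) :
    ∃ p ∈ scaledFeasible n κ, scaledRate c KW n p = paramRate c KW n Λ KZ := by
  have hK : ∀ t < n, 0 ≤ riccati c KW Λ KZ t := fun t ht => riccati_nonneg hKW hf.1 t ht.le
  have hn' : (0 : ℝ) < n := by exact_mod_cast hn
  have hterm : ∀ t < n, 0 ≤ Λ (t + 1) ^ 2 * riccati c KW Λ KZ t + KZ (t + 1) := fun t ht =>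
    add_nonneg (mul_nonneg (sq_nonneg _) (hK t ht)) (hf.1 t ht)
  have hbound : ∀ t < n, Λ (t + 1) ^ 2 * riccati c KW Λ KZ t + KZ (t + 1) ≤ n * κ := by
    intro t ht
    have h1 := Finset.single_le_sum
      (f := fun t => Λ (t + 1) ^ 2 * riccati c KW Λ KZ t + KZ (t + 1))
      (fun s hs => hterm s (Finset.mem_range.1 hs)) (Finset.mem_range.2 ht)
    have h2 := hf.2
    rw [one_div_mul_eq_div, div_le_iff₀' hn'] at h2
    exact h1.trans h2
  let p : ℕ → ℝ × ℝ := fun t =>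
    if t < n then (Λ (t + 1) * √(riccati c KW Λ KZ t), KZ (t + 1)) else 0
  have hp : ∀ t < n, p t = (Λ (t + 1) * √(riccati c KW Λ KZ t), KZ (t + 1)) :=
    fun t ht => if_pos ht
  have hnκ : 0 ≤ n * κ := mul_nonneg hn'.le hκ
  refine ⟨p, ⟨fun t _ => ?_, ?_⟩, scaledRate_eq_paramRate fun t ht _ => ?_⟩
  · by_cases ht : t < n
    · have h1 := hbound t ht
      have h2 := hf.1 t ht
      have h3 : (Λ (t + 1) * √(riccati c KW Λ KZ t)) ^ 2 ≤ (n * κ + 1) ^ 2 := by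
        rw [mul_pow, Real.sq_sqrt (hK t ht)]
        nlinarith
      have h4 := abs_le_of_sq_le_sq' h3 (by linarith)
      have h5 := mul_nonneg (sq_nonneg (Λ (t + 1))) (hK t ht)
      rw [hp t ht]
      exact ⟨h4, h2, by dsimp only; linarith⟩
    · have h0 : p t = 0 := if_neg ht
      rw [h0]
      exact ⟨⟨by simp only [Prod.fst_zero]; linarith, by simp only [Prod.fst_zero]; linarith⟩,
        le_rfl, by simp only [Prod.snd_zero]; linarith⟩
  · refine le_of_eq_of_le ?_ hf.2
    congr 1
    refine Finset.sum_congr rfl fun t ht => ?_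
    rw [hp t (Finset.mem_range.1 ht), mul_pow, Real.sq_sqrt (hK t (Finset.mem_range.1 ht))]
  · have h1 := Real.sq_sqrt (hK t ht)
    rw [hp t ht]
    dsimp only
    constructor
    · linear_combination (-(Λ (t + 1) + c (t + 1)) ^ 2) * h1
    · linear_combination (-(Λ (t + 1) + c (t + 1))) * h1

/-- Rescaled parameters come from feasible ones. Where the error variance vanishes the feedback part
is invisible, and its power goes to the innovation `Z`. -/
theorem exists_paramFeasible (hKW : ∀ t < n, 0 < KW (t + 1)) (hp : p ∈ scaledFeasible n κ) :
    ∃ Λ KZ, ParamFeasible c KW n κ Λ KZ ∧ scaledRate c KW n p = paramRate c KW n Λ KZ := by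
  let k := scaledRiccati c KW p
  -- where `k = 0` the quotient is `0`, and `KZ` takes up the power `a ^ 2`
  let Λ : ℕ → ℝ := fun t => (p (t - 1)).1 / √(k (t - 1))
  let KZ : ℕ → ℝ := fun t => (p (t - 1)).2 + if k (t - 1) = 0 then (p (t - 1)).1 ^ 2 else 0
  have hKZ : ∀ t < n, 0 ≤ KZ (t + 1) := fun t _ => by
    refine add_nonneg (hp.1 t trivial).2.1 ?_
    split_ifs
    · positivity
    · exact le_rfl
  have key : ∀ t < n, k t = riccati c KW Λ KZ t →
      Λ (t + 1) ^ 2 * riccati c KW Λ KZ t + KZ (t + 1) = (p t).1 ^ 2 + (p t).2 ∧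
      riccati c KW Λ KZ t * Λ (t + 1) = √(riccati c KW Λ KZ t) * (p t).1 := by
    intro t ht h0
    have hR : 0 ≤ riccati c KW Λ KZ t := riccati_nonneg hKW hKZ t ht.le
    have hΛ : Λ (t + 1) = (p t).1 / √(riccati c KW Λ KZ t) := by
      rw [← h0]; rfl
    have hZ : KZ (t + 1)
        = (p t).2 + if riccati c KW Λ KZ t = 0 then (p t).1 ^ 2 else 0 := by
      rw [← h0]; rfl
    rw [hΛ, hZ]
    rcases hR.eq_or_lt with h1 | h1
    · rw [← h1]
      simp [add_comm]
    · have h2 := Real.sqrt_pos.2 h1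
      have h3 := Real.sq_sqrt hR
      rw [if_neg h1.ne', div_pow, h3]
      constructor
      · field_simp
        ring
      · field_simp
        rw [h3, mul_comm]
  have h : ∀ t < n, k t = riccati c KW Λ KZ t →
      (Λ (t + 1) + c (t + 1)) ^ 2 * riccati c KW Λ KZ t + KZ (t + 1)
        = ((p t).1 + c (t + 1) * √(riccati c KW Λ KZ t)) ^ 2 + (p t).2 ∧
      riccati c KW Λ KZ t * (Λ (t + 1) + c (t + 1))
        = √(riccati c KW Λ KZ t) * ((p t).1 + c (t + 1) * √(riccati c KW Λ KZ t)) := by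
    intro t ht h0
    obtain ⟨h1, h2⟩ := key t ht h0
    have h3 := Real.sq_sqrt (riccati_nonneg (c := c) (Λ := Λ) hKW hKZ t ht.le)
    constructor
    · linear_combination h1 + 2 * c (t + 1) * h2 - c (t + 1) ^ 2 * h3
    · linear_combination h2 - c (t + 1) * h3
  refine ⟨Λ, KZ, ⟨hKZ, ?_⟩, scaledRate_eq_paramRate h⟩
  refine le_of_eq_of_le ?_ hp.2
  congr 1
  refine Finset.sum_congr rfl fun t ht => ?_
  have ht' := Finset.mem_range.1 ht
  exact (key t ht' (scaledRiccati_eq_riccati h t ht'.le)).1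

theorem exists_isGreatest_paramRates (hn : 0 < n) (hκ : 0 ≤ κ) (hKW : ∀ t < n, 0 < KW (t + 1)) :
    ∃ Λ KZ, ParamFeasible c KW n κ Λ KZ ∧
      IsGreatest (paramRates c KW n κ) (paramRate c KW n Λ KZ) := by
  have h0 : (0 : ℕ → ℝ × ℝ) ∈ scaledFeasible n κ := by
    have : 0 ≤ n * κ := by positivity
    refine ⟨fun t _ => ⟨⟨?_, ?_⟩, le_rfl, ?_⟩, ?_⟩
    · simp only [Pi.zero_apply, Prod.fst_zero]; linarith
    · simp only [Pi.zero_apply, Prod.fst_zero]; linarith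
    · simp only [Pi.zero_apply, Prod.snd_zero]; linarith
    · simpa using hκ
  obtain ⟨p, hp, hmax⟩ := (isCompact_scaledFeasible n κ).exists_isMaxOn ⟨0, h0⟩
    ((continuousOn_scaledRate (c := c) hKW).mono fun p hp t => (hp.1 t trivial).2.1)
  obtain ⟨Λ, KZ, hf, hr⟩ := exists_paramFeasible (c := c) hKW hp
  refine ⟨Λ, KZ, hf, ⟨Λ, KZ, hf, rfl⟩, ?_⟩
  rintro _ ⟨Λ', KZ', hf', rfl⟩
  obtain ⟨q, hq, hqr⟩ := exists_scaledFeasible hn hκ hKW hf'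
  rw [← hqr, ← hr]
  exact hmax hq

end Attainment

end AGN

theorem mainTheorem3 (n : ℕ) (hn : 0 < n) (c KW : ℕ → ℝ) (hKW : ∀ t < n, 0 < KW (t + 1))
    (κ : ℝ) (hκ : 0 ≤ κ) :
    -- every power-admissible strategy has a well-defined pay-off
    (∀ (v₀ : ℝ) (P : AGN.Strategy), AGN.PowerAdmissible c KW P v₀ n κ →
      AGN.HasFiniteEntropy (AGN.outputLaw c KW P v₀ n) ∧
      AGN.HasFiniteEntropy (AGN.noiseLaw c KW P v₀ n)) ∧
    -- (a) an optimal strategy exists; it is conditionally Gaussian of the stated form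
    (∃ Λ KZ : ℕ → ℝ, AGN.ParamFeasible c KW n κ Λ KZ ∧
      IsGreatest (AGN.paramRates c KW n κ) (AGN.paramRate c KW n Λ KZ) ∧
      ∀ v₀ : ℝ,
        AGN.PowerAdmissible c KW (AGN.filterStrategy c KW Λ KZ) v₀ n κ ∧
        IsGreatest (AGN.gaussianPayoffs c KW n κ v₀)
          (AGN.payoff c KW (AGN.filterStrategy c KW Λ KZ) v₀ n) ∧
        IsGreatest (AGN.allPayoffs c KW n κ v₀)
          (AGN.payoff c KW (AGN.filterStrategy c KW Λ KZ) v₀ n)) ∧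
    -- (a) every choice of the parameters: the form of the strategy and its pay-off
    (∀ Λ KZ : ℕ → ℝ, (∀ t < n, 0 ≤ KZ (t + 1)) →
      AGN.DependsOnNoiseAndOutputs (AGN.filterStrategy c KW Λ KZ) ∧
      (∀ t ≤ n, 0 ≤ AGN.riccati c KW Λ KZ t) ∧
      ∀ v₀ : ℝ,
        AGN.GaussianStrategy c KW (AGN.filterStrategy c KW Λ KZ) v₀ n ∧
        AGN.payoff c KW (AGN.filterStrategy c KW Λ KZ) v₀ n = AGN.paramRate c KW n Λ KZ ∧
        -- the innovations process exists
        (∃ (Ω : Type) (_ : MeasurableSpace Ω) (μ : MeasureTheory.Measure Ω)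
          (_ : MeasureTheory.IsProbabilityMeasure μ) (W Z V X Y : ℕ → Ω → ℝ),
          AGN.InnovationsProcess μ n c KW Λ KZ v₀ W Z V X Y) ∧
        -- every innovations process induces the strategy and obeys the filter equations
        (∀ (Ω : Type*) (_ : MeasurableSpace Ω) (μ : MeasureTheory.Measure Ω)
          (_ : MeasureTheory.IsProbabilityMeasure μ) (W Z V X Y : ℕ → Ω → ℝ),
          AGN.InnovationsProcess μ n c KW Λ KZ v₀ W Z V X Y →
          μ.map (fun ω => ((fun i : Fin n => X (i + 1) ω), (fun i : Fin n => Y (i + 1) ω)))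
            = AGN.jointLaw c KW (AGN.filterStrategy c KW Λ KZ) v₀ n ∧
          -- independence of the input innovations
          (∀ t < n, ProbabilityTheory.IndepFun (Z (t + 1))
            (fun ω => (((fun i : Fin t => V (i + 1) ω), (fun i : Fin t => X (i + 1) ω)),
              (fun i : Fin t => Y (i + 1) ω))) μ) ∧
          ProbabilityTheory.IndepFun (fun ω (i : Fin n) => Z (i + 1) ω)
            (fun ω (i : Fin n) => V (i + 1) ω) μ ∧
          -- the input and output equations at time 1, and in terms of the past inputs
          X 1 =ᵐ[μ] Z 1 ∧
          Y 1 =ᵐ[μ] (fun ω => Z 1 ω + c 1 * v₀ + W 1 ω) ∧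
          (∀ t, 1 ≤ t → t < n →
            X (t + 1) =ᵐ[μ] (fun ω =>
              -Λ (t + 1) * (X t ω - AGN.estimate μ Y t (X t) ω) + Z (t + 1) ω) ∧
            Y (t + 1) =ᵐ[μ] (fun ω =>
              -Λ (t + 1) * (X t ω - AGN.estimate μ Y t (X t) ω)
                + c (t + 1) * (Y t ω - X t ω) + W (t + 1) ω + Z (t + 1) ω)) ∧
          (∀ t < n, Y (t + 1) =ᵐ[μ] (fun ω =>
            Λ (t + 1) * (V t ω - AGN.estimate μ Y t (V t) ω) + c (t + 1) * V t ω
              + W (t + 1) ω + Z (t + 1) ω)) ∧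
          -- the power
          (∀ t < n, MeasureTheory.MemLp (X (t + 1)) 2 μ) ∧
          (1 / (n : ℝ)) * ∑ t ∈ Finset.range n, ∫ ω, X (t + 1) ω ^ 2 ∂μ
            = (1 / (n : ℝ)) * ∑ t ∈ Finset.range n,
                (Λ (t + 1) ^ 2 * AGN.riccati c KW Λ KZ t + KZ (t + 1)) ∧
          -- the mean-square errors solve the generalized Riccati equation
          (∀ t ≤ n, MeasureTheory.MemLp (V t) 2 μ ∧
            ∫ ω, (V t ω - AGN.estimate μ Y t (V t) ω) ^ 2 ∂μ = AGN.riccati c KW Λ KZ t) ∧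
          (∀ t < n,
            ∫ ω, (X (t + 1) ω - AGN.estimate μ Y (t + 1) (X (t + 1)) ω) ^ 2 ∂μ
              = AGN.riccati c KW Λ KZ (t + 1)) ∧
          -- the innovations `I_t = Y_t - E[Y_t | Y^{t-1}]`
          (∀ t < n,
            (fun ω => Y (t + 1) ω - AGN.estimate μ Y t (Y (t + 1)) ω) =ᵐ[μ]
              (fun ω => Y (t + 1) ω - c (t + 1) * AGN.estimate μ Y t (V t) ω) ∧
            (fun ω => Y (t + 1) ω - AGN.estimate μ Y t (Y (t + 1)) ω) =ᵐ[μ]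
              (fun ω => (Λ (t + 1) + c (t + 1)) * (V t ω - AGN.estimate μ Y t (V t) ω)
                + Z (t + 1) ω + W (t + 1) ω) ∧
            μ.map (fun ω => Y (t + 1) ω - AGN.estimate μ Y t (Y (t + 1)) ω)
              = ProbabilityTheory.gaussianReal 0 (AGN.innovVar (c (t + 1)) (KW (t + 1))
                  (AGN.riccati c KW Λ KZ t) (Λ (t + 1)) (KZ (t + 1))).toNNReal) ∧
          (fun ω => Y 1 ω - AGN.estimate μ Y 0 (Y 1) ω) =ᵐ[μ] (fun ω => Z 1 ω + W 1 ω) ∧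
          (∀ s < n, ∀ t < n, s ≠ t →
            ∫ ω, (Y (s + 1) ω - AGN.estimate μ Y s (Y (s + 1)) ω)
              * (Y (t + 1) ω - AGN.estimate μ Y t (Y (t + 1)) ω) ∂μ = 0) ∧
          -- the generalized Kalman filter and its error recursion
          AGN.estimate μ Y 0 (V 0) =ᵐ[μ] (fun _ => v₀) ∧
          (∀ t < n,
            AGN.estimate μ Y (t + 1) (V (t + 1)) =ᵐ[μ] (fun ω =>
              c (t + 1) * AGN.estimate μ Y t (V t) ω
                + AGN.gainM (c (t + 1)) (KW (t + 1)) (AGN.riccati c KW Λ KZ t)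
                    (Λ (t + 1)) (KZ (t + 1))
                  * (Y (t + 1) ω - AGN.estimate μ Y t (Y (t + 1)) ω)) ∧
            AGN.estimate μ Y (t + 1) (V (t + 1)) =ᵐ[μ] (fun ω =>
              AGN.coeffF (c (t + 1)) (KW (t + 1)) (AGN.riccati c KW Λ KZ t)
                  (Λ (t + 1)) (KZ (t + 1)) * AGN.estimate μ Y t (V t) ω
                + AGN.gainM (c (t + 1)) (KW (t + 1)) (AGN.riccati c KW Λ KZ t)
                    (Λ (t + 1)) (KZ (t + 1))
                  * (Y (t + 1) ω + Λ (t + 1) * AGN.estimate μ Y t (V t) ω)) ∧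
            (fun ω => V (t + 1) ω - AGN.estimate μ Y (t + 1) (V (t + 1)) ω) =ᵐ[μ] (fun ω =>
              AGN.coeffF (c (t + 1)) (KW (t + 1)) (AGN.riccati c KW Λ KZ t)
                  (Λ (t + 1)) (KZ (t + 1)) * (V t ω - AGN.estimate μ Y t (V t) ω)
                - AGN.gainM (c (t + 1)) (KW (t + 1)) (AGN.riccati c KW Λ KZ t)
                    (Λ (t + 1)) (KZ (t + 1)) * (Z (t + 1) ω + W (t + 1) ω)
                + W (t + 1) ω)))) ∧
    -- (b) the characterization of the capacity
    (∀ v₀ : ℝ, AGN.ftfiCapacity c KW n κ v₀ = sSup (AGN.paramRates c KW n κ))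
  := by
  -- parameters of maximal rate give an optimal strategy, by the converse
  have hgreat (Λ KZ : ℕ → ℝ) (hf : AGN.ParamFeasible c KW n κ Λ KZ)
      (hmax : IsGreatest (AGN.paramRates c KW n κ) (AGN.paramRate c KW n Λ KZ)) (v₀ : ℝ) :
      AGN.PowerAdmissible c KW (AGN.filterStrategy c KW Λ KZ) v₀ n κ ∧
      IsGreatest (AGN.gaussianPayoffs c KW n κ v₀)
        (AGN.payoff c KW (AGN.filterStrategy c KW Λ KZ) v₀ n) ∧
      IsGreatest (AGN.allPayoffs c KW n κ v₀)
        (AGN.payoff c KW (AGN.filterStrategy c KW Λ KZ) v₀ n) := by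
    have hP := AGN.powerAdmissible_filterStrategy hKW hf v₀
    have hub : ∀ P, AGN.PowerAdmissible c KW P v₀ n κ → AGN.payoff c KW P v₀ n
        ≤ AGN.payoff c KW (AGN.filterStrategy c KW Λ KZ) v₀ n := by
      intro P hP
      obtain ⟨-, Λ', KZ', hf', hle⟩ := AGN.exists_paramRate_ge hKW hP
      rw [AGN.payoff_filterStrategy hKW hf.1]
      exact hle.trans (hmax.2 ⟨Λ', KZ', hf', rfl⟩)
    refine ⟨hP, ⟨⟨_, hP, AGN.gaussianStrategy_filterStrategy v₀, rfl⟩, ?_⟩, ⟨_, hP, rfl⟩, ?_⟩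
    · rintro _ ⟨P, hP, -, rfl⟩
      exact hub P hP
    · rintro _ ⟨P, hP, rfl⟩
      exact hub P hP
  obtain ⟨Λm, KZm, hfm, hmax⟩ := AGN.exists_isGreatest_paramRates (c := c) hn hκ hKW
  refine ⟨fun v₀ P hP => ⟨(AGN.exists_paramRate_ge hKW hP).1, (AGN.entropy_noiseLaw hKW P v₀).1⟩,
    ⟨Λm, KZm, hfm, hmax, hgreat Λm KZm hfm hmax⟩, fun Λ KZ hKZ =>
    ⟨AGN.dependsOnNoiseAndOutputs_filterStrategy, AGN.riccati_nonneg hKW hKZ, fun v₀ =>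
    ⟨AGN.gaussianStrategy_filterStrategy v₀, AGN.payoff_filterStrategy hKW hKZ v₀, ?_, ?_⟩⟩,
    fun v₀ => ?_⟩
  · obtain ⟨Ω, mΩ, μ, hμ, W, Z, V, X, Y, h, hin⟩ := AGN.exists_drivenProcess n c KW Λ KZ v₀
    exact ⟨Ω, mΩ, μ, hμ, W, Z, V, X, Y, h.toInnovations hKW hKZ hin⟩
  · intro Ω mΩ μ hμ W Z V X Y hproc
    have h := hproc.toDriven
    have hin := hproc.filterInput hKW hKZ
    have hin' : ∀ t ≤ n, ∀ s < t, AGN.FilterInput μ c KW Λ KZ v₀ Z V X Y s :=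
      fun t ht s hs => hin s (by omega)
    refine ⟨h.map_histOf le_rfl hin, fun t ht => h.indepFun_Z_history ht (hin' t ht.le),
      h.indepFun_Z_V, h.X_one_ae (hin 0 hn), h.Y_one_ae hn (hin 0 hn),
      fun t h1 ht => ?_, fun t ht => ?_, fun t ht => (h.integral_X_sq hKW hKZ hin ht).1, ?_,
      fun t ht => ⟨h.memLp_V t ht, h.integral_sq_sub_estimate_V hKW hKZ ht (hin' t ht)⟩,
      fun t ht => h.integral_sq_sub_estimate_X hKW hKZ hin ht, fun t ht => ⟨?_, ?_, ?_⟩, ?_, ?_,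
      h.estimate_V hKW hKZ (Nat.zero_le n) (hin' 0 (Nat.zero_le n)), fun t ht => ⟨?_, ?_, ?_⟩⟩
    · obtain ⟨s, rfl⟩ : ∃ s, t = s + 1 := ⟨t - 1, by omega⟩
      constructor
      · filter_upwards [hproc.input (s + 1) ht, h.sub_estimate_X_ae hKW hKZ hin (t := s) (by omega)]
          with ω h2 h3
        rw [h2, h3]
        ring
      · filter_upwards [hproc.input (s + 1) ht, h.sub_estimate_X_ae hKW hKZ hin (t := s) (by omega)]
          with ω h2 h3
        have h4 := congrFun (h.output (s + 1) ht) ω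
        have h5 := congrFun (h.noise_succ (s + 1) ht) ω
        have h6 := congrFun (h.output s (by omega)) ω
        rw [h4, h5, h2, h3, h6]
        ring
    · filter_upwards [hproc.input t ht] with ω h2
      have h3 := congrFun (h.output t ht) ω
      have h4 := congrFun (h.noise_succ t ht) ω
      rw [h3, h4, h2]
      ring
    · congr 1
      exact Finset.sum_congr rfl fun t ht =>
        (h.integral_X_sq hKW hKZ hin (Finset.mem_range.1 ht)).2
    · filter_upwards [h.estimate_Y hKW hKZ hin ht, h.estimate_V hKW hKZ ht.le (hin' t ht.le)]
        with ω h1 h2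
      rw [h1, h2]
    · filter_upwards [h.innovation_ae hKW hKZ hin ht, h.estimate_V hKW hKZ ht.le (hin' t ht.le)]
        with ω h1 h2
      rw [h1, h2]
      rfl
    · rw [MeasureTheory.Measure.map_congr (h.innovation_ae hKW hKZ hin ht)]
      exact (h.law_filterInnov hKW hKZ ht (hin' t ht.le)).1
    · filter_upwards [h.innovation_ae hKW hKZ hin hn] with ω h1
      simp only [zero_add] at h1
      rw [h1]
      simp [AGN.filterInnov, AGN.filterError, AGN.filter, h.noise_zero]
    · intro s hs t ht hst
      have hcongr : (fun ω => (Y (s + 1) ω - AGN.estimate μ Y s (Y (s + 1)) ω)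
            * (Y (t + 1) ω - AGN.estimate μ Y t (Y (t + 1)) ω)) =ᵐ[μ]
          fun ω => AGN.filterInnov c KW Λ KZ v₀ W Z V Y s ω
            * AGN.filterInnov c KW Λ KZ v₀ W Z V Y t ω := by
        filter_upwards [h.innovation_ae hKW hKZ hin hs, h.innovation_ae hKW hKZ hin ht]
          with ω h1 h2
        rw [h1, h2]
      rw [MeasureTheory.integral_congr_ae hcongr]
      rcases lt_or_gt_of_ne hst with h1 | h1
      · exact h.integral_innov_mul hKW hKZ hin h1 ht
      · simp only [mul_comm (AGN.filterInnov c KW Λ KZ v₀ W Z V Y s _)]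
        exact h.integral_innov_mul hKW hKZ hin h1 hs
    · filter_upwards [h.estimate_V hKW hKZ ht (hin' (t + 1) ht),
        h.estimate_V hKW hKZ ht.le (hin' t ht.le), h.innovation_ae hKW hKZ hin ht,
        h.filter_outVec_succ_ae ht (hin t ht)] with ω h1 h2 h3 h4
      rw [h1, h2, h3, h4]
    · filter_upwards [h.estimate_V hKW hKZ ht (hin' (t + 1) ht),
        h.estimate_V hKW hKZ ht.le (hin' t ht.le), h.output_ae ht (hin t ht),
        h.filter_outVec_succ_ae ht (hin t ht)] with ω h1 h2 h3 h4
      rw [h1, h2, h3, h4, AGN.coeffF]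
      ring
    · filter_upwards [h.estimate_V hKW hKZ ht (hin' (t + 1) ht),
        h.estimate_V hKW hKZ ht.le (hin' t ht.le), h.filterError_succ_ae ht (hin t ht)]
        with ω h1 h2 h3
      rw [h1, h2]
      change AGN.filterError c KW Λ KZ v₀ V Y (t + 1) ω
        = _ * AGN.filterError c KW Λ KZ v₀ V Y t ω - _ + _
      rw [h3, AGN.filterInnov, AGN.coeffF]
      ring
  · rw [AGN.ftfiCapacity, (hgreat Λm KZm hfm hmax v₀).2.1.csSup_eq,
      AGN.payoff_filterStrategy hKW hfm.1, hmax.csSup_eq]
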